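/- **Setting.** An episodic loop-free CMDP has finite state and action sets $X, A$ ($A\neq\emptyset$), with $X$ partitioned into layers $X_0=\{x_0\},X_1,\dots,X_L=\{x_L\}$, $L\ge 1$, and an unknown transition function $P$ with $P(x'|x,a)>0$ only if $x\in X_k$, $x'\in X_{k+1}$ for some $k$. In each of $T\ge1$ episodes, a reward vector $r_t\in[0,1]^{X\times A}$ (arbitrarily, stochastically or adversarially) and a constraint matrix $G_t\in[-1,1]^{(X\times A)\times m}$, $m\ge 1$, are chosen; the learner plays a policy $\pi_t$, a trajectory $x_0,a_0,\dots,a_{L-1},x_L$ with $a_k\sim\pi_t(\cdot|x_k)$, $x_{k+1}\sim P(\cdot|x_k,a_k)$ is observed, and then $r_t,G_t$ are revealed. For a transition function $Q$ and a policy $\pi$ let $q^{Q,\pi}(x,a)=\Pr[x_k=x,a_k=a\mid Q,\pi]$ for $x\in X_k$, $k<L$ (and $0$ for $x=x_L$); for a set $\mathcal P$ of transition functions let $\Delta(\mathcal P)=\{q^{Q,\pi}: Q\in\mathcal P,\ \pi \text{ a policy}\}$, and $\Delta(M)=\Delta(\{P\})$. **Algorithm PDGD-OPS** with $\delta\in(0,1)$,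 $C=\frac{5|X||A|}{L}$ and $\eta=\Big(100\,m|X||A|\sqrt{T\ln (T^2/\delta)}\Big)^{-1}$. Start with $\widehat q_1(x,a)=\frac1{|X_k||A|}$ for $x\in X_k$, $k<L$ (and $0$ on $x_L$), and $\lambda_1=0\in\mathbb R^m$. In episode $t$ play $\pi_t(a|x)=\widehat q_t(x,a)/\sum_b\widehat q_t(x,b)$ (a fixed arbitrary policy at states where the denominator is $0$); put $\ell_t=G_t\lambda_t-r_t$, $\eta_t=\big(C\sqrt T\max_{\tau\le t}\|\ell_\tau\|_\infty\big)^{-1}$, and with Euclidean projections set $$\widehat q_{t+1}=\Pi_{\Delta(\mathcal P_i)}\big(\widehat q_t-\eta_t\ell_t\big),\qquad \lambda_{t+1}=\Pi_{[0,T^{1/4}]^m}\big(\lambda_t+\eta\, G_t^\top\widehat q_t\big)$$ (if $\max_{\tau\le t}\|\ell_\tau\|_\infty=0$, then $\ell_t=0$ and $\eta_t\ell_t$ is read as $0$). Here $i$ is the current epoch: epoch $1$ has $\mathcal P_1$ = all loop-free transition functions; after each episode the visit counters of pairs $(x,a)$ and triples $(x,a,x')$ are updated, and if some pair visited in that episode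 has counter at least $\max\{1,2n\}$, with $n$ its counter at the beginning of the current epoch, a new epoch $i$ starts, with $N_i,M_i$ the counters at that moment and $$\mathcal P_i=\Big\{\widehat P:\ \Big\|\widehat P(\cdot|x,a)-\tfrac{M_i(\cdot|x,a)}{\max\{1,N_i(x,a)\}}\Big\|_1\le\sqrt{\tfrac{2|X_{k(x)+1}|\ln(T|X||A|/\delta)}{\max\{1,N_i(x,a)\}}}\ \ \forall (x,a)\Big\},$$ where $\widehat P$ ranges over loop-free transition functions and $k(x)$ is the layer of $x$; this set is used already in the update of that episode. **Feasibility parameter.** *Stochastic constraints:* $G_t$ is drawn from a fixed law $\mathcal G$ independently of the past, $\overline G=\mathbb E_{G\sim\mathcal G}[G]$, and $\rho=\max_{q\in\Delta(M)}\min_{i\in[m]}-[\overline G^\top q]_i$. *Adversarial constraints:* $G_t$ is chosen arbitrarily at the beginning of episode $t$, possibly in reaction to the past, and $\rho=\max_{q\in\Delta(M)}\min_{t\in[T]}\min_{i\in[m]}-[G_t^\top q]_i$. *Condition 2:* $\rho\ge T^{-1/8}L\sqrt{20m}$. **Theorem.** Let $\zeta=\frac{20mL^2}{\rho^2}$. 1.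 With stochastic constraints, if Condition 2 holds, then with probability at least $1-2\delta$: $\ \|\lambda_t\|_1\le\zeta$ for all $t\in[T+1]$. 2. With adversarial constraints, with probability at least $1-\delta$: if Condition 2 holds for the chosen sequence $G_1,\dots,G_T$, then $\|\lambda_t\|_1\le\zeta$ for all $t\in[T+1]$. (In particular, for constraints fixed in advance that satisfy Condition 2, the bound holds with probability at least $1-\delta$.) -/

import Mathlib

open MeasureTheory ProbabilityTheory
open scoped BigOperators

noncomputable section

namespace CMDP

/-- The layered state space of an episodic loop-free MDP: `X` is partitioned into the layers
`X_k = {x | layer x = k}`, `k = 0, …, L`, and the first and last layers are singletons. -/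
structure LayeredSpace (X : Type*) (L : ℕ) where
  layer : X → ℕ
  source : X
  sink : X
  layer_le : ∀ x, layer x ≤ L
  layer_eq_zero_iff : ∀ x, layer x = 0 ↔ x = source
  layer_eq_last_iff : ∀ x, layer x = L ↔ x = sink

/-- `X_k`. -/
def LayeredSpace.layerSet {X : Type*} {L : ℕ} (S : LayeredSpace X L) (k : ℕ) : Set X :=
  {x | S.layer x = k}

section MDP

variable {X A : Type*} [Fintype X] [Fintype A] {L m : ℕ}

/-- Loop-free transition functions; `P x a x'` is `P(x' | x, a)`. No transition leaves the last
layer. -/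
structure IsTransition (S : LayeredSpace X L) (P : X → A → X → ℝ) : Prop where
  nonneg : ∀ x a x', 0 ≤ P x a x'
  sum_eq_one : ∀ x a, S.layer x < L → ∑ x', P x a x' = 1
  layer_succ : ∀ x a x', 0 < P x a x' → S.layer x' = S.layer x + 1

/-- Policies; `π x a` is `π(a | x)`. -/
structure IsPolicy (π : X → A → ℝ) : Prop where
  nonneg : ∀ x a, 0 ≤ π x a
  sum_eq_one : ∀ x, ∑ a, π x a = 1

open Classical in
/-- `visitProb S P π k x = Pr[x_k = x | P, π]`, the law of the state at step `k`. -/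
def visitProb (S : LayeredSpace X L) (P : X → A → X → ℝ) (π : X → A → ℝ) : ℕ → X → ℝ
  | 0 => fun x => if x = S.source then 1 else 0
  | k + 1 => fun x' => ∑ x, ∑ a, visitProb S P π k x * π x a * P x a x'

/-- `q^{P,π}(x,a,x') = Pr[x_k = x, a_k = a, x_{k+1} = x' | P, π]` for `x ∈ X_k`. -/
def occTriple (S : LayeredSpace X L) (P : X → A → X → ℝ) (π : X → A → ℝ) (x : X) (a : A)
    (x' : X) : ℝ :=
  visitProb S P π (S.layer x) x * π x a * P x a x'

/-- The occupancy measure vector `q^{P,π}(x,a) = ∑_{x'} q^{P,π}(x,a,x')` (it vanishes on the last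
layer, which no transition leaves). -/
def occ (S : LayeredSpace X L) (P : X → A → X → ℝ) (π : X → A → ℝ) : X × A → ℝ :=
  fun p => ∑ x', occTriple S P π p.1 p.2 x'

/-- `Δ(Ps)`: the occupancy measure vectors of some transition function in `Ps` and some policy. -/
def occSet (S : LayeredSpace X L) (Ps : Set (X → A → X → ℝ)) : Set (X × A → ℝ) :=
  {q | ∃ P ∈ Ps, ∃ π, IsPolicy π ∧ q = occ S P π}

/-- `[Gᵀ q]_i`. -/
def costOf (G : X × A → Fin m → ℝ) (q : X × A → ℝ) (i : Fin m) : ℝ := ∑ p, G p i * q p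

/-- The feasibility parameter for stochastic constraints with mean `Gbar`:
`ρ = max_{q ∈ Δ(M)} min_i -[Gbarᵀ q]_i`. -/
def rhoStoch (S : LayeredSpace X L) (P : X → A → X → ℝ) (Gbar : X × A → Fin m → ℝ) : ℝ :=
  sSup ((fun q => ⨅ i, -costOf Gbar q i) '' occSet S {P})

/-- The feasibility parameter for adversarial constraints `G 0, …, G (T - 1)`:
`ρ = max_{q ∈ Δ(M)} min_t min_i -[G_tᵀ q]_i`. -/
def rhoAdv (S : LayeredSpace X L) (P : X → A → X → ℝ) (T : ℕ)
    (G : ℕ → X × A → Fin m → ℝ) : ℝ :=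
  sSup ((fun q => ⨅ t : Fin T, ⨅ i, -costOf (G t) q i) '' occSet S {P})

/-- The condition `ρ ≥ T^{-1/8} L √(20 m)`. -/
def RhoCondition (T L m : ℕ) (ρ : ℝ) : Prop :=
  (T : ℝ) ^ (-(1 / 8) : ℝ) * L * √(20 * m) ≤ ρ

end MDP

section Algorithm

open Classical in
/-- Euclidean projection of `y` onto `C` (a minimiser over `C` of the Euclidean distance to `y`;
it exists and is unique when `C` is nonempty, closed and convex). -/
def euclProj {ι : Type*} [Fintype ι] (C : Set (ι → ℝ)) (y : ι → ℝ) : ι → ℝ :=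
  if h : ∃ z ∈ C, ∀ w ∈ C, ∑ i, (y i - z i) ^ 2 ≤ ∑ i, (y i - w i) ^ 2 then h.choose else y

/-- What the learner observes in one episode: the trajectory `x_0, a_0, …, a_{L-1}, x_L`, the
reward vector `r_t` and the constraint matrix `G_t`. -/
structure Episode (X A : Type*) (L m : ℕ) where
  state : Fin (L + 1) → X
  action : Fin L → A
  reward : X × A → ℝ
  cost : X × A → Fin m → ℝ

/-- Epoch index `i`, current visit counters `N_i(x,a)`, `M_i(x'|x,a)`, and their values `N0`, `M0`
at the beginning of the current epoch. -/
structure Counters (X A : Type*) where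
  epoch : ℕ
  N : X → A → ℕ
  M : X → A → X → ℕ
  N0 : X → A → ℕ
  M0 : X → A → X → ℕ

/-- The state of PDGD-OPS between two episodes: `q̂_t`, `λ_t`, the running maximum
`max_{τ < t} ‖ℓ_τ‖_∞`, and the counters. -/
structure AlgState (X A : Type*) (m : ℕ) where
  qhat : X × A → ℝ
  lam : Fin m → ℝ
  lossMax : ℝ
  counters : Counters X A

variable {X A : Type*} [Fintype X] [Fintype A] {L m : ℕ}

open Classical in
/-- Add the visits of the episode to the counters; start a new epoch if some visited pair has at
least doubled its counter since the beginning of the epoch. -/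
def Counters.update (c : Counters X A) (e : Episode X A L m) : Counters X A :=
  let N' : X → A → ℕ := fun x a =>
    c.N x a + Fintype.card {k : Fin L // e.state k.castSucc = x ∧ e.action k = a}
  let M' : X → A → X → ℕ := fun x a x' =>
    c.M x a x' + Fintype.card
      {k : Fin L // e.state k.castSucc = x ∧ e.action k = a ∧ e.state k.succ = x'}
  if ∃ k : Fin L, max 1 (2 * c.N0 (e.state k.castSucc) (e.action k)) ≤
      N' (e.state k.castSucc) (e.action k)
  then ⟨c.epoch + 1, N', M', N', M'⟩
  else ⟨c.epoch, N', M', c.N0, c.M0⟩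

/-- The empirical transition function `P̄_i(x' | x, a)`. -/
def Counters.empirical (c : Counters X A) (x : X) (a : A) (x' : X) : ℝ :=
  (c.M0 x a x' : ℝ) / max 1 (c.N0 x a : ℝ)

/-- The confidence radius `ε_i(x, a)`. -/
def Counters.radius (c : Counters X A) (S : LayeredSpace X L) (T : ℕ) (δ : ℝ) (x : X) (a : A) :
    ℝ :=
  √(2 * (S.layerSet (S.layer x + 1)).ncard
      * Real.log (T * Fintype.card X * Fintype.card A / δ) / max 1 (c.N0 x a : ℝ))

/-- The confidence set `𝒫_i`: all transition functions in the first epoch, and afterwards those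
within `ε_i` of the empirical one in the 1-norm. -/
def Counters.confSet (c : Counters X A) (S : LayeredSpace X L) (T : ℕ) (δ : ℝ) :
    Set (X → A → X → ℝ) :=
  {P | IsTransition S P ∧
    (c.epoch ≠ 1 → ∀ x a, ∑ x', |P x a x' - c.empirical x a x'| ≤ c.radius S T δ x a)}

open Classical in
/-- `q̂_1`, the marginal of `q̂_1(x,a,x') = 1 / (|X_k| |A| |X_{k+1}|)` for
`(x,a,x') ∈ X_k × A × X_{k+1}`; `λ_1 = 0`; first epoch, zero counters. -/
def initState (A : Type*) [Fintype A] (m : ℕ) (S : LayeredSpace X L) : AlgState X A m where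
  qhat := fun p => ∑ x', if S.layer x' = S.layer p.1 + 1 then
    1 / (((S.layerSet (S.layer p.1)).ncard : ℝ) * Fintype.card A *
      (S.layerSet (S.layer p.1 + 1)).ncard) else 0
  lam := 0
  lossMax := 0
  counters := ⟨1, fun _ _ => 0, fun _ _ _ => 0, fun _ _ => 0, fun _ _ _ => 0⟩

/-- The Lagrangian loss `ℓ_t = G_t λ_t - r_t`. -/
def AlgState.loss (s : AlgState X A m) (e : Episode X A L m) : X × A → ℝ :=
  fun p => ∑ i, e.cost p i * s.lam i - e.reward p

/-- The dual learning rate `η = 1 / (K √(T ln (T² / δ)))`. -/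
def dualRate (T : ℕ) (δ K : ℝ) : ℝ := 1 / (K * √(T * Real.log ((T : ℝ) ^ 2 / δ)))

/-- One episode of updates of PDGD-OPS with constants `C` (primal) and `K` (dual). The primal
learning rate is `η_t = 1 / (max_{τ ≤ t} ‖ℓ_τ‖_∞ · C √T)`. -/
def AlgState.update (S : LayeredSpace X L) (T : ℕ) (δ C K : ℝ) (s : AlgState X A m)
    (e : Episode X A L m) : AlgState X A m where
  counters := s.counters.update e
  lossMax := max s.lossMax ‖s.loss e‖
  qhat := euclProj (occSet S ((s.counters.update e).confSet S T δ))
    (fun p => s.qhat p - 1 / (max s.lossMax ‖s.loss e‖ * C * √T) * s.loss e p)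
  lam := euclProj {v : Fin m → ℝ | ∀ i, 0 ≤ v i ∧ v i ≤ (T : ℝ) ^ (1 / 4 : ℝ)}
    (fun i => s.lam i + dualRate T δ K * costOf e.cost s.qhat i)

/-- `pdgdOps S T δ C K e t` is the state of PDGD-OPS after the first `t` episodes
`e 0, …, e (t - 1)`; thus its fields `qhat` and `lam` are `q̂_{t+1}` and `λ_{t+1}` in the usual
numbering of episodes from `1`. -/
def pdgdOps (S : LayeredSpace X L) (T : ℕ) (δ C K : ℝ) (e : ℕ → Episode X A L m) :
    ℕ → AlgState X A m
  | 0 => initState A m S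
  | t + 1 => (pdgdOps S T δ C K e t).update S T δ C K (e t)

open Classical in
/-- The policy `π^q(a|x) = q(x,a) / q(x)` induced by `q`; where `q(x) = 0`, the quotient is
undefined and the learner uses a fixed policy `π₀`. -/
def inducedPolicy (π₀ : X → A → ℝ) (q : X × A → ℝ) (x : X) (a : A) : ℝ :=
  if ∑ b, q (x, b) = 0 then π₀ x a else q (x, a) / ∑ b, q (x, b)

end Algorithm

section Interaction

variable {X A Ω : Type*} {L m : ℕ}

/-- The σ-algebra generated by everything that happened in episodes `0, …, t - 1`. -/
@[reducible] def history (E : ℕ → Ω → Episode X A L m) (t : ℕ) : MeasurableSpace Ω :=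
  ⨆ s : Fin t,
    MeasurableSpace.comap (fun ω => (E s ω).state) ⊤ ⊔
    MeasurableSpace.comap (fun ω => (E s ω).action) ⊤ ⊔
    MeasurableSpace.comap (fun ω => (E s ω).reward) inferInstance ⊔
    MeasurableSpace.comap (fun ω => (E s ω).cost) inferInstance

/-- The σ-algebra just before the action `a_k` of episode `t` is drawn: the past episodes, the
reward vector and constraint matrix of episode `t` (chosen at its beginning), the states
`x_0, …, x_k` and the actions `a_0, …, a_{k-1}`. -/
@[reducible] def actionHistory (E : ℕ → Ω → Episode X A L m) (t : ℕ) (k : Fin L) : MeasurableSpace Ω :=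
  history E t ⊔
  MeasurableSpace.comap (fun ω => (E t ω).reward) inferInstance ⊔
  MeasurableSpace.comap (fun ω => (E t ω).cost) inferInstance ⊔
  (⨆ j : {j : Fin (L + 1) // j ≤ k.castSucc},
    MeasurableSpace.comap (fun ω => (E t ω).state j) ⊤) ⊔
  (⨆ j : {j : Fin L // j < k}, MeasurableSpace.comap (fun ω => (E t ω).action j) ⊤)

/-- The σ-algebra just after `a_k` and before the next state `x_{k+1}` of episode `t`. -/
@[reducible] def stateHistory (E : ℕ → Ω → Episode X A L m) (t : ℕ) (k : Fin L) : MeasurableSpace Ω :=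
  actionHistory E t k ⊔ MeasurableSpace.comap (fun ω => (E t ω).action k) ⊤

/-- The random episodes `E 0, …, E (T - 1)` arise from the interaction of PDGD-OPS with the CMDP.
At the beginning of each episode the environment chooses a reward vector in `[0,1]` and a
constraint matrix in `[-1,1]`; this structure does not restrict how (fixed in advance,
stochastically, or adversarially in reaction to the past). Then actions are drawn from the policy
induced by the current `q̂`, and states from the transition function `P`. -/
structure IsInteraction [Fintype X] [Fintype A] [MeasurableSpace Ω] (μ : Measure Ω)
    (S : LayeredSpace X L) (P : X → A → X → ℝ) (π₀ : X → A → ℝ) (T : ℕ) (δ C K : ℝ)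
    (E : ℕ → Ω → Episode X A L m) : Prop where
  measurable_state : ∀ t < T, ∀ z, MeasurableSet {ω | (E t ω).state = z}
  measurable_action : ∀ t < T, ∀ z, MeasurableSet {ω | (E t ω).action = z}
  measurable_reward : ∀ t < T, Measurable fun ω => (E t ω).reward
  measurable_cost : ∀ t < T, Measurable fun ω => (E t ω).cost
  reward_mem : ∀ t < T, ∀ ω p, (E t ω).reward p ∈ Set.Icc (0 : ℝ) 1
  cost_mem : ∀ t < T, ∀ ω p i, (E t ω).cost p i ∈ Set.Icc (-1 : ℝ) 1
  start : ∀ t < T, ∀ ω, (E t ω).state 0 = S.source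
  action_law : ∀ t < T, ∀ (k : Fin L) (b : A),
    μ⟦{ω | (E t ω).action k = b} | actionHistory E t k⟧ =ᵐ[μ]
      fun ω => inducedPolicy π₀ (pdgdOps S T δ C K (fun s => E s ω) t).qhat
        ((E t ω).state k.castSucc) b
  state_law : ∀ t < T, ∀ (k : Fin L) (y : X),
    μ⟦{ω | (E t ω).state k.succ = y} | stateHistory E t k⟧ =ᵐ[μ]
      fun ω => P ((E t ω).state k.castSucc) ((E t ω).action k) y

/-- Stochastic constraints: `G_t` has the fixed law `𝒢` and is drawn independently of the past. -/
def StochasticCosts [MeasurableSpace Ω] (μ : Measure Ω) (T : ℕ)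
    (E : ℕ → Ω → Episode X A L m) (𝒢 : Measure (X × A → Fin m → ℝ)) : Prop :=
  ∀ t < T, μ.map (fun ω => (E t ω).cost) = 𝒢 ∧
    Indep (MeasurableSpace.comap (fun ω => (E t ω).cost) inferInstance) (history E t) μ

end Interaction

/-- `Ḡ = 𝔼_{G ∼ 𝒢}[G]`, entrywise. -/
def meanCost {X A : Type*} {m : ℕ} (𝒢 : Measure (X × A → Fin m → ℝ)) : X × A → Fin m → ℝ :=
  fun p i => ∫ g, g p i ∂𝒢

end CMDP

end

open CMDP

open CMDP

set_option linter.unusedSectionVars false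

namespace CMDP

/-! ### Euclidean projection -/

section Projection

variable {ι : Type*} [Fintype ι] {C : Set (ι → ℝ)}

/-! The bound is a drift argument for the potential `‖λ_t‖₂²`, run on a single trajectory on which
every confidence set contains `P`. Nonexpansiveness of the projection gives `‖λ_{t+1}‖₂² ≤ ‖λ_t‖₂² +
2η⟨λ_t, G_tᵀ q̂_t⟩ + η² m L²`. Let `q₀ ∈ Δ(M)` have all its costs at most `-ρ/2`. Since `ℓ_t = G_t
λ_t - r_t`, replacing `q̂_t` by `q₀` in the middle term costs at most `L` for the reward plus the
instantaneous regret `⟨ℓ_t, q̂_t - q₀⟩`, and afterwards the term is at most `-(ρ/2)‖λ_t‖₁`, up to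
the noise of `G_t`. So once `‖λ_t‖₁` exceeds `θ = 4L/ρ` the potential falls, apart from accumulated
regret and noise.

These errors depend on the size of `λ`, which is what has to be bounded. The circle is broken by
looking at a first time `t₂` with `‖λ‖₁ > ζ`: before it the losses are at most `1 + ζ`, so regret
and noise up to `t₂` are of order `ζ √(T log)`, and multiplication by `η` makes them a small
multiple of `ζ`. Summing the drift from the last visit below `θ` up to `t₂` gives `‖λ_{t₂}‖₁² ≤ m
‖λ_{t₂}‖₂² ≤ ζ²`, a contradiction (`le_of_potential_drift`, with constants in `sum_abs_lam_le`). The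
regret on every interval of episodes comes from projected gradient descent (`primal_regret_le`),
which needs the projection sets to be convex (`exists_mix`). The feasibility condition enters
through `ρ > 0` and `log (T²/δ) ≥ 1`.

Probability enters twice. First, `P` stays in all confidence sets with probability at least `1 - δ`
(`IsInteraction.exists_clean_event`): a Hoeffding bound for the successes at the `n`-th visit of a
pair, with a union over `n`, over sets of next states and over pairs. Second, for stochastic
constraints, a Hoeffding–Azuma bound for `∑ ⟨λ_t, (G_t - Ḡ)ᵀ q₀⟩` over all intervals costs another
`δ` (`StochasticCosts.exists_noise_event`). For adversarial constraints there is no noise, and `q₀`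
may depend on the run. -/

theorem euclProj_spec (hC : IsCompact C) (hne : C.Nonempty) (y : ι → ℝ) :
    euclProj C y ∈ C ∧
      ∀ w ∈ C, ∑ i, (y i - euclProj C y i) ^ 2 ≤ ∑ i, (y i - w i) ^ 2 := by
  have h : ∃ z ∈ C, ∀ w ∈ C, ∑ i, (y i - z i) ^ 2 ≤ ∑ i, (y i - w i) ^ 2 := by
    have hcont : ContinuousOn (fun z : ι → ℝ => ∑ i, (y i - z i) ^ 2) C := by fun_prop
    obtain ⟨z, hz, hmin⟩ := hC.exists_isMinOn hne hcont
    exact ⟨z, hz, fun w hw => hmin hw⟩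
  rw [euclProj, dif_pos h]
  exact h.choose_spec

theorem euclProj_mem (hC : IsCompact C) (hne : C.Nonempty) (y : ι → ℝ) : euclProj C y ∈ C :=
  (euclProj_spec hC hne y).1

theorem euclProj_empty (y : ι → ℝ) : euclProj (∅ : Set (ι → ℝ)) y = y := by
  simp [euclProj]

/-- Otherwise a short move from the projection towards `w`, which stays in `C` by convexity, would
decrease the distance to `y`. -/
theorem euclProj_variational (hC : IsCompact C) (hconv : Convex ℝ C) {w : ι → ℝ} (hw : w ∈ C)
    (y : ι → ℝ) : ∑ i, (y i - euclProj C y i) * (w i - euclProj C y i) ≤ 0 := by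
  obtain ⟨hz, hmin⟩ := euclProj_spec hC ⟨w, hw⟩ y
  set z := euclProj C y with hzdef
  by_contra! hpos
  set a := ∑ i, (y i - z i) * (w i - z i) with ha
  set b := ∑ i, (w i - z i) ^ 2 with hb
  have hb0 : 0 ≤ b := Finset.sum_nonneg fun i _ => sq_nonneg _
  have key : ∀ s : ℝ, 0 ≤ s → s ≤ 1 → 0 ≤ s * (s * b - 2 * a) := by
    intro s hs0 hs1
    have hmem : (1 - s) • z + s • w ∈ C := hconv hz hw (by linarith) hs0 (by ring)
    have h := hmin _ hmem
    have e : ∑ i, (y i - ((1 - s) • z + s • w) i) ^ 2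
        = ∑ i, (y i - z i) ^ 2 + s * (s * b - 2 * a) := by
      rw [ha, hb, Finset.mul_sum, Finset.mul_sum, ← Finset.sum_sub_distrib, Finset.mul_sum,
        ← Finset.sum_add_distrib]
      refine Finset.sum_congr rfl fun i _ => ?_
      simp only [Pi.add_apply, Pi.smul_apply, smul_eq_mul]
      ring
    linarith
  -- With `s = a / (a + b)` one has `s * b ≤ a < 2 * a`, which makes the increment in `key`
  -- negative.
  have hs : 0 < a / (a + b) := by positivity
  have hs1 : a / (a + b) ≤ 1 := by rw [div_le_one (by positivity)]; linarith
  have h := key _ hs.le hs1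
  have h2 : a / (a + b) * b ≤ a := by
    rw [div_mul_eq_mul_div, div_le_iff₀ (by positivity)]
    nlinarith
  have := mul_pos hs (show 0 < 2 * a - a / (a + b) * b by linarith)
  nlinarith

theorem sum_sq_euclProj_sub_le (hC : IsCompact C) (hconv : Convex ℝ C) {w : ι → ℝ} (hw : w ∈ C)
    (y : ι → ℝ) : ∑ i, (euclProj C y i - w i) ^ 2 ≤ ∑ i, (y i - w i) ^ 2 := by
  have h := euclProj_variational hC hconv hw y
  have e : ∑ i, (y i - w i) ^ 2 = ∑ i, (euclProj C y i - w i) ^ 2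
      + ∑ i, (y i - euclProj C y i) ^ 2
      - 2 * ∑ i, (y i - euclProj C y i) * (w i - euclProj C y i) := by
    rw [Finset.mul_sum, ← Finset.sum_add_distrib, ← Finset.sum_sub_distrib]
    exact Finset.sum_congr rfl fun i _ => by ring
  have : 0 ≤ ∑ i, (y i - euclProj C y i) ^ 2 := Finset.sum_nonneg fun i _ => sq_nonneg _
  linarith

/-- Apply the variational inequality at each of the two projections, tested against the other one,
and expand the square of `(y - y') - (z - z')`. -/
theorem sum_sq_euclProj_sub_euclProj_le (hC : IsCompact C) (hne : C.Nonempty)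
    (hconv : Convex ℝ C) (y y' : ι → ℝ) :
    ∑ i, (euclProj C y i - euclProj C y' i) ^ 2 ≤ ∑ i, (y i - y' i) ^ 2 := by
  have h1 := euclProj_variational hC hconv (euclProj_mem hC hne y') y
  have h2 := euclProj_variational hC hconv (euclProj_mem hC hne y) y'
  set z := euclProj C y
  set z' := euclProj C y'
  have e : ∑ i, (y i - y' i) ^ 2 = ∑ i, (z i - z' i) ^ 2
      + ∑ i, ((y i - y' i) - (z i - z' i)) ^ 2
      - 2 * ∑ i, (y i - z i) * (z' i - z i) - 2 * ∑ i, (y' i - z' i) * (z i - z' i) := by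
    rw [Finset.mul_sum, Finset.mul_sum, ← Finset.sum_add_distrib, ← Finset.sum_sub_distrib,
      ← Finset.sum_sub_distrib]
    exact Finset.sum_congr rfl fun i _ => by ring
  have : 0 ≤ ∑ i, ((y i - y' i) - (z i - z' i)) ^ 2 := Finset.sum_nonneg fun i _ => sq_nonneg _
  linarith

/-- Serves the measurability of the iterates. Empty sets must be covered, because nothing guarantees
that a confidence set is nonempty off the clean event; there the projection is the identity by
definition. -/
theorem continuous_euclProj (hC : IsCompact C) (hconv : Convex ℝ C) :
    Continuous (euclProj C) := by
  rcases C.eq_empty_or_nonempty with rfl | hne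
  · exact continuous_id.congr fun y => (euclProj_empty y).symm
  refine continuous_iff_continuousAt.2 fun y => tendsto_pi_nhds.2 fun i => ?_
  rw [tendsto_iff_dist_tendsto_zero]
  have hlim : Filter.Tendsto (fun y' : ι → ℝ => √(∑ i, (y' i - y i) ^ 2)) (nhds y) (nhds 0) := by
    have hc : Continuous fun y' : ι → ℝ => √(∑ i, (y' i - y i) ^ 2) := by fun_prop
    simpa using hc.tendsto y
  refine squeeze_zero (fun _ => dist_nonneg) (fun y' => ?_) hlim
  rw [Real.dist_eq, ← Real.sqrt_sq_eq_abs]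
  refine Real.sqrt_le_sqrt (le_trans ?_ (sum_sq_euclProj_sub_euclProj_le hC hne hconv y' y))
  exact Finset.single_le_sum (f := fun i => (euclProj C y' i - euclProj C y i) ^ 2)
    (fun i _ => sq_nonneg _) (Finset.mem_univ i)

end Projection

/-! ### Occupancy measures -/

section Occupancy

variable {X A : Type*} [Fintype X] [Fintype A] {L : ℕ} {S : LayeredSpace X L}
  {P : X → A → X → ℝ} {π : X → A → ℝ}

theorem IsTransition.eq_zero (hP : IsTransition S P) {x : X} {a : A} {x' : X}
    (h : S.layer x' ≠ S.layer x + 1) : P x a x' = 0 :=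
  le_antisymm (not_lt.1 fun hpos => h (hP.layer_succ x a x' hpos)) (hP.nonneg x a x')

theorem IsTransition.eq_zero_of_last (hP : IsTransition S P) {x : X} (a : A) (x' : X)
    (h : ¬ S.layer x < L) : P x a x' = 0 :=
  hP.eq_zero (by have := S.layer_le x'; omega)

theorem IsTransition.sum_le_one (hP : IsTransition S P) (x : X) (a : A) : ∑ x', P x a x' ≤ 1 := by
  by_cases h : S.layer x < L
  · exact (hP.sum_eq_one x a h).le
  · simp [hP.eq_zero_of_last a _ h]

theorem IsTransition.le_one (hP : IsTransition S P) (x : X) (a : A) (x' : X) : P x a x' ≤ 1 :=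
  (Finset.single_le_sum (f := P x a) (fun y _ => hP.nonneg x a y) (Finset.mem_univ x')).trans
    (hP.sum_le_one x a)

theorem IsPolicy.le_one (hπ : IsPolicy π) (x : X) (a : A) : π x a ≤ 1 :=
  (Finset.single_le_sum (f := π x) (fun y _ => hπ.nonneg x y) (Finset.mem_univ a)).trans
    (hπ.sum_eq_one x).le

theorem visitProb_nonneg (hP : IsTransition S P) (hπ : IsPolicy π) (k : ℕ) (x : X) :
    0 ≤ visitProb S P π k x := by
  induction k generalizing x with
  | zero => simp only [visitProb]; split_ifs <;> norm_num
  | succ k ih =>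
    simp only [visitProb]
    exact Finset.sum_nonneg fun y _ => Finset.sum_nonneg fun a _ =>
      mul_nonneg (mul_nonneg (ih y) (hπ.nonneg y a)) (hP.nonneg y a x)

/-- Mass is preserved before the last layer and lost after it, hence an inequality valid for all
`k`. -/
theorem sum_visitProb_le_one (hP : IsTransition S P) (hπ : IsPolicy π) (k : ℕ) :
    ∑ x, visitProb S P π k x ≤ 1 := by
  induction k with
  | zero =>
    simp only [visitProb]
    rw [Finset.sum_eq_single S.source (fun x _ hx => if_neg hx) (by simp), if_pos rfl]
  | succ k ih =>
    simp only [visitProb]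
    rw [Finset.sum_comm]
    refine le_trans (Finset.sum_le_sum fun y _ => ?_) ih
    rw [Finset.sum_comm]
    calc ∑ a, ∑ x', visitProb S P π k y * π y a * P y a x'
        ≤ ∑ a, visitProb S P π k y * π y a := by
          refine Finset.sum_le_sum fun a _ => ?_
          rw [← Finset.mul_sum]
          exact mul_le_of_le_one_right
            (mul_nonneg (visitProb_nonneg hP hπ k y) (hπ.nonneg y a)) (hP.sum_le_one y a)
      _ = visitProb S P π k y := by rw [← Finset.mul_sum, hπ.sum_eq_one, mul_one]

theorem visitProb_le_one (hP : IsTransition S P) (hπ : IsPolicy π) (k : ℕ) (x : X) :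
    visitProb S P π k x ≤ 1 :=
  (Finset.single_le_sum (f := visitProb S P π k) (fun y _ => visitProb_nonneg hP hπ k y)
    (Finset.mem_univ x)).trans (sum_visitProb_le_one hP hπ k)

theorem visitProb_eq_zero (hP : IsTransition S P) {k : ℕ} {x : X} (h : S.layer x ≠ k) :
    visitProb S P π k x = 0 := by
  induction k generalizing x with
  | zero => simp only [visitProb]; rw [if_neg fun hx => h ((S.layer_eq_zero_iff x).2 hx)]
  | succ k ih =>
    simp only [visitProb]
    refine Finset.sum_eq_zero fun y _ => Finset.sum_eq_zero fun a _ => ?_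
    by_cases hy : S.layer y = k
    · rw [hP.eq_zero (by omega), mul_zero]
    · rw [ih hy]; simp

theorem occ_nonneg (hP : IsTransition S P) (hπ : IsPolicy π) (p : X × A) : 0 ≤ occ S P π p :=
  Finset.sum_nonneg fun _ _ => mul_nonneg (mul_nonneg (visitProb_nonneg hP hπ _ _)
    (hπ.nonneg _ _)) (hP.nonneg _ _ _)

theorem occ_eq (p : X × A) :
    occ S P π p = visitProb S P π (S.layer p.1) p.1 * π p.1 p.2 * ∑ x', P p.1 p.2 x' := by
  simp only [occ, occTriple, Finset.mul_sum]

theorem occ_le_one (hP : IsTransition S P) (hπ : IsPolicy π) (p : X × A) : occ S P π p ≤ 1 := by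
  rw [occ_eq]
  exact mul_le_one₀ (mul_le_one₀ (visitProb_le_one hP hπ _ _) (hπ.nonneg _ _) (hπ.le_one _ _))
    (Finset.sum_nonneg fun _ _ => hP.nonneg _ _ _) (hP.sum_le_one _ _)

/-- A nonnegative function on states which has mass at most one on every layer before the last and
vanishes on the last one has total mass at most `L`. -/
theorem sum_le_of_layers {f : X → ℝ} (h0 : ∀ x, ¬ S.layer x < L → f x = 0)
    (h1 : ∀ k < L, ∑ x, (if S.layer x = k then f x else 0) ≤ 1) : ∑ x, f x ≤ L := by
  have e : ∀ x, f x = ∑ k ∈ Finset.range L, if S.layer x = k then f x else 0 := by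
    intro x
    rw [Finset.sum_ite_eq]
    split_ifs with h
    · rfl
    · exact h0 x (by simpa using h)
  calc ∑ x, f x = ∑ k ∈ Finset.range L, ∑ x, if S.layer x = k then f x else 0 := by
        rw [Finset.sum_comm]; exact Finset.sum_congr rfl fun x _ => e x
    _ ≤ ∑ k ∈ Finset.range L, (1 : ℝ) :=
        Finset.sum_le_sum fun k hk => h1 k (Finset.mem_range.1 hk)
    _ = L := by simp

theorem sum_occ_le (hP : IsTransition S P) (hπ : IsPolicy π) : ∑ p, occ S P π p ≤ L := by
  rw [Fintype.sum_prod_type]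
  refine sum_le_of_layers (S := S) (fun x hx => ?_) fun k _ => ?_
  · refine Finset.sum_eq_zero fun a _ => ?_
    rw [occ_eq]; simp [hP.eq_zero_of_last a _ hx]
  · refine le_trans (Finset.sum_le_sum fun x _ => ?_) (sum_visitProb_le_one hP hπ k)
    split_ifs with h
    · calc ∑ a, occ S P π (x, a) ≤ ∑ a, visitProb S P π k x * π x a := by
            refine Finset.sum_le_sum fun a _ => ?_
            rw [occ_eq, h]
            exact mul_le_of_le_one_right
              (mul_nonneg (visitProb_nonneg hP hπ k x) (hπ.nonneg x a)) (hP.sum_le_one x a)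
        _ = _ := by rw [← Finset.mul_sum, hπ.sum_eq_one, mul_one]
    · exact visitProb_nonneg hP hπ k x

/-- The bounds satisfied by every occupancy measure vector which the analysis uses. -/
structure IsSubOcc (L : ℕ) (q : X × A → ℝ) : Prop where
  nonneg : ∀ p, 0 ≤ q p
  le_one : ∀ p, q p ≤ 1
  sum_le : ∑ p, q p ≤ L

theorem isSubOcc_of_mem_occSet {Ps : Set (X → A → X → ℝ)} (hPs : ∀ P ∈ Ps, IsTransition S P)
    {q : X × A → ℝ} (hq : q ∈ occSet S Ps) : IsSubOcc L q := by
  obtain ⟨P, hP, π, hπ, rfl⟩ := hq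
  exact ⟨occ_nonneg (hPs P hP) hπ, occ_le_one (hPs P hP) hπ, sum_occ_le (hPs P hP) hπ⟩

/-- The first iterate is not the result of a projection, so its bounds are checked by hand. -/
theorem isSubOcc_initState [Nonempty A] (m : ℕ) :
    IsSubOcc L (initState A m S).qhat := by
  classical
  have hn : ∀ x : X, (1 : ℝ) ≤ (S.layerSet (S.layer x)).ncard := fun x => by
    have : 0 < (S.layerSet (S.layer x)).ncard := (Set.ncard_pos (Set.toFinite _)).2 ⟨x, rfl⟩
    exact_mod_cast this
  have hA : (1 : ℝ) ≤ Fintype.card A := by exact_mod_cast Fintype.card_pos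
  have hnn : ∀ p : X × A, 0 ≤ (initState A m S).qhat p := fun p => by
    simp only [initState]
    exact Finset.sum_nonneg fun x' _ => by split_ifs <;> positivity
  have hcard : ∀ k : ℕ, ((Finset.univ.filter fun x : X => S.layer x = k).card : ℝ)
      = (S.layerSet k).ncard := fun k => by
    rw [LayeredSpace.layerSet, ← Set.ncard_coe_finset]; simp
  have hle : ∀ p : X × A, (initState A m S).qhat p ≤
      1 / ((S.layerSet (S.layer p.1)).ncard * Fintype.card A) := fun p => by
    have h1 := hn p.1
    simp only [initState]
    rw [← Finset.sum_filter, Finset.sum_const, nsmul_eq_mul, hcard]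
    -- The next layer is empty when `p.1` is in the last layer; the quotient is then a division by
    -- zero, hence zero.
    rcases Nat.eq_zero_or_pos (S.layerSet (S.layer p.1 + 1)).ncard with h | h
    · rw [h]; simp only [Nat.cast_zero, mul_zero, div_zero]; positivity
    · have : (0 : ℝ) < (S.layerSet (S.layer p.1 + 1)).ncard := by exact_mod_cast h
      apply le_of_eq
      field_simp
  refine ⟨hnn, fun p => (hle p).trans ?_, ?_⟩
  · have h1 := hn p.1
    rw [div_le_one (by positivity)]
    exact one_le_mul_of_one_le_of_one_le h1 hA
  · rw [Fintype.sum_prod_type]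
    refine sum_le_of_layers (S := S) (fun x hx => ?_) fun k _ => ?_
    · refine Finset.sum_eq_zero fun a _ => ?_
      simp only [initState]
      refine Finset.sum_eq_zero fun x' _ => if_neg ?_
      have := S.layer_le x'
      omega
    · rw [← Finset.sum_filter]
      calc ∑ x ∈ Finset.univ.filter (fun x : X => S.layer x = k),
            ∑ a, (initState A m S).qhat (x, a)
          ≤ ∑ x ∈ Finset.univ.filter (fun x : X => S.layer x = k),
            (1 / (S.layerSet k).ncard : ℝ) := by
            refine Finset.sum_le_sum fun x hx => ?_
            have hx' : S.layer x = k := by simpa using hx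
            have h1 := hn x
            rw [hx'] at h1
            calc ∑ a, (initState A m S).qhat (x, a)
                ≤ ∑ a : A, (1 / ((S.layerSet k).ncard * Fintype.card A) : ℝ) :=
                  Finset.sum_le_sum fun a _ => by simpa [hx'] using hle (x, a)
              _ = _ := by
                  rw [Finset.sum_const, nsmul_eq_mul, Finset.card_univ]; field_simp
        _ ≤ 1 := by
            rw [Finset.sum_const, nsmul_eq_mul, hcard]
            rw [mul_one_div]
            exact div_self_le_one _

end Occupancy

/-! ### Compactness and convexity of the sets of occupancy measures -/

section OccSet

variable {X A : Type*} [Fintype X] [Fintype A] {L : ℕ} {S : LayeredSpace X L}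

theorem continuous_visitProb (k : ℕ) (x : X) :
    Continuous fun z : (X → A → X → ℝ) × (X → A → ℝ) => visitProb S z.1 z.2 k x := by
  induction k generalizing x with
  | zero => simp only [visitProb]; exact continuous_const
  | succ k ih => simp only [visitProb]; fun_prop

theorem continuous_occ :
    Continuous fun z : (X → A → X → ℝ) × (X → A → ℝ) => occ S z.1 z.2 := by
  refine continuous_pi fun p => ?_
  simp only [occ, occTriple]
  have := continuous_visitProb (S := S) (A := A) (S.layer p.1) p.1
  fun_prop

theorem isCompact_setOf_isPolicy : IsCompact {π : X → A → ℝ | IsPolicy π} := by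
  have e : {π : X → A → ℝ | IsPolicy π}
      = {π | ∀ x a, 0 ≤ π x a} ∩ {π | ∀ x, ∑ a, π x a = 1} := by
    ext π; exact ⟨fun h => ⟨h.1, h.2⟩, fun h => ⟨h.1, h.2⟩⟩
  have hcl : IsClosed {π : X → A → ℝ | IsPolicy π} := by
    rw [e]
    refine IsClosed.inter ?_ ?_
    · simp only [Set.ofPred_forall]
      exact isClosed_iInter fun x => isClosed_iInter fun a =>
        isClosed_le continuous_const (by fun_prop)
    · simp only [Set.ofPred_forall]
      exact isClosed_iInter fun x => isClosed_eq (by fun_prop) continuous_const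
  exact (isCompact_Icc (a := (0 : X → A → ℝ)) (b := 1)).of_isClosed_subset hcl
    fun π hπ => ⟨fun x a => hπ.nonneg x a, fun x a => hπ.le_one x a⟩

/-- `layer_succ` has an open premise; its contrapositive, `P x a x' ≤ 0` off the next layer, is a
closed condition. -/
theorem isClosed_setOf_isTransition : IsClosed {P : X → A → X → ℝ | IsTransition S P} := by
  have e : {P : X → A → X → ℝ | IsTransition S P}
      = {P | ∀ x a x', 0 ≤ P x a x'} ∩ ({P | ∀ x a, S.layer x < L → ∑ x', P x a x' = 1} ∩
        {P | ∀ x a x', S.layer x' ≠ S.layer x + 1 → P x a x' ≤ 0}) := by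
    ext P
    refine ⟨fun h => ⟨h.1, h.2, fun x a x' hx => (h.eq_zero hx).le⟩,
      fun h => ⟨h.1, h.2.1, fun x a x' hpos => ?_⟩⟩
    by_contra hx
    exact absurd (h.2.2 x a x' hx) (not_le.2 hpos)
  rw [e]
  refine IsClosed.inter ?_ (IsClosed.inter ?_ ?_)
  · simp only [Set.ofPred_forall]
    exact isClosed_iInter fun x => isClosed_iInter fun a => isClosed_iInter fun x' =>
      isClosed_le continuous_const (by fun_prop)
  · simp only [Set.ofPred_forall]
    exact isClosed_iInter fun x => isClosed_iInter fun a => isClosed_iInter fun _ =>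
      isClosed_eq (by fun_prop) continuous_const
  · simp only [Set.ofPred_forall]
    exact isClosed_iInter fun x => isClosed_iInter fun a => isClosed_iInter fun x' =>
      isClosed_iInter fun _ => isClosed_le (by fun_prop) continuous_const

theorem isCompact_confSet (c : Counters X A) (T : ℕ) (δ : ℝ) : IsCompact (c.confSet S T δ) := by
  have hcl : IsClosed (c.confSet S T δ) := by
    refine isClosed_setOf_isTransition.inter ?_
    show IsClosed {P : X → A → X → ℝ | c.epoch ≠ 1 → ∀ x a,
      ∑ x', |P x a x' - c.empirical x a x'| ≤ c.radius S T δ x a}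
    simp only [Set.ofPred_forall]
    exact isClosed_iInter fun _ => isClosed_iInter fun x => isClosed_iInter fun a =>
      isClosed_le (by fun_prop) continuous_const
  exact (isCompact_Icc (a := (0 : X → A → X → ℝ)) (b := 1)).of_isClosed_subset hcl
    fun P hP => ⟨fun x a x' => hP.1.nonneg x a x', fun x a x' => hP.1.le_one x a x'⟩

theorem isCompact_occSet {Ps : Set (X → A → X → ℝ)} (h : IsCompact Ps) :
    IsCompact (occSet S Ps) := by
  have e : occSet S Ps = (fun z : (X → A → X → ℝ) × (X → A → ℝ) => occ S z.1 z.2) ''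
      (Ps ×ˢ {π | IsPolicy π}) := by
    ext q
    constructor
    · rintro ⟨P, hP, π, hπ, rfl⟩
      exact ⟨(P, π), ⟨hP, hπ⟩, rfl⟩
    · rintro ⟨⟨P, π⟩, ⟨hP, hπ⟩, rfl⟩
      exact ⟨P, hP, π, hπ, rfl⟩
  rw [e]
  exact (h.prod isCompact_setOf_isPolicy).image continuous_occ

/-- The row-wise mixture of two transition functions. -/
def mixTransition (s : X → A → ℝ) (P₁ P₂ : X → A → X → ℝ) (x : X) (a : A) (x' : X) : ℝ :=
  s x a * P₁ x a x' + (1 - s x a) * P₂ x a x'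

/-- The row-wise mixture of two policies. -/
def mixPolicy (r : X → ℝ) (π₁ π₂ : X → A → ℝ) (x : X) (a : A) : ℝ :=
  r x * π₁ x a + (1 - r x) * π₂ x a

theorem isPolicy_mixPolicy {r : X → ℝ} (hr : ∀ x, r x ∈ Set.Icc (0 : ℝ) 1) {π₁ π₂ : X → A → ℝ}
    (h₁ : IsPolicy π₁) (h₂ : IsPolicy π₂) : IsPolicy (mixPolicy r π₁ π₂) where
  nonneg x a := add_nonneg (mul_nonneg (hr x).1 (h₁.nonneg x a))
    (mul_nonneg (sub_nonneg.2 (hr x).2) (h₂.nonneg x a))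
  sum_eq_one x := by
    simp only [mixPolicy]
    rw [Finset.sum_add_distrib, ← Finset.mul_sum, ← Finset.mul_sum, h₁.sum_eq_one, h₂.sum_eq_one]
    ring

theorem isTransition_mixTransition {s : X → A → ℝ} (hs : ∀ x a, s x a ∈ Set.Icc (0 : ℝ) 1)
    {P₁ P₂ : X → A → X → ℝ} (h₁ : IsTransition S P₁) (h₂ : IsTransition S P₂) :
    IsTransition S (mixTransition s P₁ P₂) where
  nonneg x a x' := add_nonneg (mul_nonneg (hs x a).1 (h₁.nonneg x a x'))
    (mul_nonneg (sub_nonneg.2 (hs x a).2) (h₂.nonneg x a x'))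
  sum_eq_one x a hx := by
    simp only [mixTransition]
    rw [Finset.sum_add_distrib, ← Finset.mul_sum, ← Finset.mul_sum, h₁.sum_eq_one x a hx,
      h₂.sum_eq_one x a hx]
    ring
  layer_succ x a x' h := by
    by_contra hne
    simp [mixTransition, h₁.eq_zero hne, h₂.eq_zero hne] at h

/-- The confidence set imposes a separate norm ball on each row, so every row may be mixed with its
own weight. -/
theorem mixTransition_mem_confSet {s : X → A → ℝ} (hs : ∀ x a, s x a ∈ Set.Icc (0 : ℝ) 1)
    {c : Counters X A} {T : ℕ} {δ : ℝ} {P₁ P₂ : X → A → X → ℝ} (h₁ : P₁ ∈ c.confSet S T δ)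
    (h₂ : P₂ ∈ c.confSet S T δ) : mixTransition s P₁ P₂ ∈ c.confSet S T δ := by
  refine ⟨isTransition_mixTransition hs h₁.1 h₂.1, fun hc x a => ?_⟩
  have k₁ := h₁.2 hc x a
  have k₂ := h₂.2 hc x a
  obtain ⟨hs0, hs1⟩ := hs x a
  calc ∑ x', |mixTransition s P₁ P₂ x a x' - c.empirical x a x'|
      ≤ ∑ x', (s x a * |P₁ x a x' - c.empirical x a x'|
        + (1 - s x a) * |P₂ x a x' - c.empirical x a x'|) := by
        refine Finset.sum_le_sum fun x' _ => ?_
        have e : mixTransition s P₁ P₂ x a x' - c.empirical x a x'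
            = s x a * (P₁ x a x' - c.empirical x a x')
              + (1 - s x a) * (P₂ x a x' - c.empirical x a x') := by
          simp only [mixTransition]; ring
        rw [e]
        refine (abs_add_le _ _).trans (le_of_eq ?_)
        rw [abs_mul, abs_mul, abs_of_nonneg hs0, abs_of_nonneg (sub_nonneg.2 hs1)]
    _ = s x a * ∑ x', |P₁ x a x' - c.empirical x a x'|
        + (1 - s x a) * ∑ x', |P₂ x a x' - c.empirical x a x'| := by
        rw [Finset.sum_add_distrib, ← Finset.mul_sum, ← Finset.mul_sum]
    _ ≤ s x a * c.radius S T δ x a + (1 - s x a) * c.radius S T δ x a :=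
        add_le_add (mul_le_mul_of_nonneg_left k₁ hs0)
          (mul_le_mul_of_nonneg_left k₂ (sub_nonneg.2 hs1))
    _ = c.radius S T δ x a := by ring

/-- The weight of the first of two nonnegative masses in their sum. -/
theorem exists_weight {u v : ℝ} (hu : 0 ≤ u) (hv : 0 ≤ v) :
    ∃ s ∈ Set.Icc (0 : ℝ) 1, (u + v) * s = u := by
  rcases eq_or_lt_of_le (add_nonneg hu hv) with h | h
  · exact ⟨0, by simp, by linarith⟩
  · exact ⟨u / (u + v), ⟨by positivity, (div_le_one h).2 (by linarith)⟩, by field_simp⟩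

/-- Occupancy measures are not linear in `(P, π)`, but their convex combinations are again occupancy
measures: mix the policies at `x` in proportion to the weighted state masses, and the transitions at
`(x, a)` in proportion to the weighted state-action masses. With these weights the flows add up, and
induction on the step shows that the visit probabilities mix linearly. -/
theorem exists_mix {P₁ P₂ : X → A → X → ℝ} {π₁ π₂ : X → A → ℝ} (hP₁ : IsTransition S P₁)
    (hP₂ : IsTransition S P₂) (hπ₁ : IsPolicy π₁) (hπ₂ : IsPolicy π₂) {α β : ℝ} (hα : 0 ≤ α)
    (hβ : 0 ≤ β) (hαβ : α + β = 1) :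
    ∃ s : X → A → ℝ, (∀ x a, s x a ∈ Set.Icc (0 : ℝ) 1) ∧
      ∃ r : X → ℝ, (∀ x, r x ∈ Set.Icc (0 : ℝ) 1) ∧
        occ S (mixTransition s P₁ P₂) (mixPolicy r π₁ π₂)
          = α • occ S P₁ π₁ + β • occ S P₂ π₂ := by
  set w₁ : X → ℝ := fun x => α * visitProb S P₁ π₁ (S.layer x) x with hw₁
  set w₂ : X → ℝ := fun x => β * visitProb S P₂ π₂ (S.layer x) x with hw₂
  have n₁ : ∀ x, 0 ≤ w₁ x := fun x => mul_nonneg hα (visitProb_nonneg hP₁ hπ₁ _ _)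
  have n₂ : ∀ x, 0 ≤ w₂ x := fun x => mul_nonneg hβ (visitProb_nonneg hP₂ hπ₂ _ _)
  choose r hr hrw using fun x => exists_weight (n₁ x) (n₂ x)
  choose s hs hsw using fun (x : X) (a : A) =>
    exists_weight (mul_nonneg (n₁ x) (hπ₁.nonneg x a)) (mul_nonneg (n₂ x) (hπ₂.nonneg x a))
  refine ⟨s, hs, r, hr, ?_⟩
  have hu : ∀ x a, (w₁ x + w₂ x) * mixPolicy r π₁ π₂ x a = w₁ x * π₁ x a + w₂ x * π₂ x a := by
    intro x a
    simp only [mixPolicy]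
    linear_combination (π₁ x a - π₂ x a) * hrw x
  have huP : ∀ x a x', (w₁ x + w₂ x) * mixPolicy r π₁ π₂ x a * mixTransition s P₁ P₂ x a x'
      = w₁ x * π₁ x a * P₁ x a x' + w₂ x * π₂ x a * P₂ x a x' := by
    intro x a x'
    rw [hu]
    simp only [mixTransition]
    linear_combination (P₁ x a x' - P₂ x a x') * hsw x a
  have hv : ∀ k x, visitProb S (mixTransition s P₁ P₂) (mixPolicy r π₁ π₂) k x
      = α * visitProb S P₁ π₁ k x + β * visitProb S P₂ π₂ k x := by
    intro k
    induction k with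
    | zero =>
      intro x
      simp only [visitProb]
      rw [← add_mul, hαβ, one_mul]
    | succ k ih =>
      intro x'
      simp only [visitProb]
      rw [Finset.mul_sum, Finset.mul_sum, ← Finset.sum_add_distrib]
      refine Finset.sum_congr rfl fun x _ => ?_
      rw [Finset.mul_sum, Finset.mul_sum, ← Finset.sum_add_distrib]
      refine Finset.sum_congr rfl fun a _ => ?_
      rw [ih x]
      -- The weights were defined from the masses at step `S.layer x`; at any other step both visit
      -- probabilities vanish.
      by_cases hx : S.layer x = k
      · have := huP x a x'
        simp only [hw₁, hw₂, hx] at this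
        rw [this]; ring
      · rw [visitProb_eq_zero hP₁ hx, visitProb_eq_zero hP₂ hx]; ring
  funext p
  simp only [occ, occTriple, Pi.add_apply, Pi.smul_apply, smul_eq_mul]
  rw [Finset.mul_sum, Finset.mul_sum, ← Finset.sum_add_distrib]
  refine Finset.sum_congr rfl fun x' _ => ?_
  rw [hv]
  have := huP p.1 p.2 x'
  simp only [hw₁, hw₂] at this
  rw [this]; ring

theorem convex_occSet_confSet (c : Counters X A) (T : ℕ) (δ : ℝ) :
    Convex ℝ (occSet S (c.confSet S T δ)) := by
  rintro _ ⟨P₁, hP₁, π₁, hπ₁, rfl⟩ _ ⟨P₂, hP₂, π₂, hπ₂, rfl⟩ α β hα hβ hαβ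
  obtain ⟨s, hs, r, hr, e⟩ := exists_mix hP₁.1 hP₂.1 hπ₁ hπ₂ hα hβ hαβ
  exact ⟨_, mixTransition_mem_confSet hs hP₁ hP₂, _, isPolicy_mixPolicy hr hπ₁ hπ₂, e.symm⟩

theorem isCompact_occSet_confSet (c : Counters X A) (T : ℕ) (δ : ℝ) :
    IsCompact (occSet S (c.confSet S T δ)) :=
  isCompact_occSet (isCompact_confSet c T δ)

theorem isCompact_box {m : ℕ} (u : ℝ) : IsCompact {v : Fin m → ℝ | ∀ i, 0 ≤ v i ∧ v i ≤ u} := by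
  have e : {v : Fin m → ℝ | ∀ i, 0 ≤ v i ∧ v i ≤ u} = Set.Icc 0 (fun _ => u) := by
    ext v; simp [Set.mem_Icc, Pi.le_def, forall_and]
  rw [e]; exact isCompact_Icc

theorem convex_box {m : ℕ} (u : ℝ) : Convex ℝ {v : Fin m → ℝ | ∀ i, 0 ≤ v i ∧ v i ≤ u} := by
  have e : {v : Fin m → ℝ | ∀ i, 0 ≤ v i ∧ v i ≤ u} = Set.Icc 0 (fun _ => u) := by
    ext v; simp [Set.mem_Icc, Pi.le_def, forall_and]
  rw [e]; exact convex_Icc _ _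

end OccSet

/-! ### The potential argument -/

/-- If the potential `Φ` decreases up to the error `B` while `Λ` exceeds `θ`, and `Φ` and `Λ ^ 2`
are comparable, then `Λ` never exceeds `ζ`. -/
theorem le_of_potential_drift {T : ℕ} {Λ Φ p : ℕ → ℝ} {l r θ η c B ζ M : ℝ}
    (hstep : ∀ t < T, Φ (t + 1) ≤ Φ t + 2 * η * p t + c)
    (hreg : ∀ t₁ t₂, t₁ < t₂ → t₂ ≤ T → (∀ t < t₂, Λ t ≤ ζ) →
      ∑ t ∈ Finset.Ico t₁ t₂, p t ≤ ∑ t ∈ Finset.Ico t₁ t₂, (l - r * Λ t) + B)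
    (hθ : 2 * η * (l - r * θ) + c ≤ 0) (h0 : Λ 0 ≤ θ) (hΛ : ∀ t, 0 ≤ Λ t) (hr : 0 ≤ r)
    (hη : 0 ≤ η) (hΦ : ∀ t, Φ t ≤ Λ t ^ 2) (hΦ' : ∀ t, Λ t ^ 2 ≤ M * Φ t) (hM : 0 < M)
    (hfin : M * (θ ^ 2 + 2 * η * l + c + 2 * η * B) ≤ ζ ^ 2) (hθζ : θ ≤ ζ) :
    ∀ t ≤ T, Λ t ≤ ζ := by
  have hθ0 : 0 ≤ θ := (hΛ 0).trans h0
  intro t₂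
  induction t₂ using Nat.strong_induction_on with
  | _ t₂ ih =>
    intro ht₂
    have hbefore : ∀ t < t₂, Λ t ≤ ζ := fun t ht => ih t ht (by omega)
    by_contra! hgt
    classical
    -- The last time up to `t₂` at which `Λ` is at most `θ`; it exists because of `h0`.
    set t₁ := Nat.findGreatest (fun t => Λ t ≤ θ) t₂ with ht₁
    have hs₁ : Λ t₁ ≤ θ := Nat.findGreatest_spec (P := fun t => Λ t ≤ θ) (Nat.zero_le t₂) h0
    have hlt : t₁ < t₂ := by
      refine lt_of_le_of_ne (Nat.findGreatest_le t₂) fun h => ?_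
      rw [h] at hs₁; linarith
    have habove : ∀ t, t₁ < t → t ≤ t₂ → θ < Λ t := fun t h h' =>
      not_le.1 (Nat.findGreatest_is_greatest h h')
    have htel : ∀ n, t₁ ≤ n → n ≤ t₂ →
        Φ n ≤ Φ t₁ + ∑ t ∈ Finset.Ico t₁ n, (2 * η * p t + c) := by
      intro n hn
      induction n, hn using Nat.le_induction with
      | base => simp
      | succ n hn ihn =>
        intro hn2
        rw [Finset.sum_Ico_succ_top hn]
        have := hstep n (by omega)
        have := ihn (by omega)
        linarith
    have h1 := htel t₂ hlt.le le_rfl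
    have h2 := mul_le_mul_of_nonneg_left (hreg t₁ t₂ hlt ht₂ hbefore)
      (show 0 ≤ 2 * η by positivity)
    rw [Finset.sum_add_distrib, ← Finset.mul_sum] at h1
    have h3 : 2 * η * ∑ t ∈ Finset.Ico t₁ t₂, (l - r * Λ t) + ∑ _t ∈ Finset.Ico t₁ t₂, c
        ≤ 2 * η * l + c := by
      -- The term at `t₁` is split off: there `Λ` is still below `θ`, so only the bound `2 * η * l +
      -- c` is available. All later terms are nonpositive by `hθ`.
      rw [Finset.mul_sum, ← Finset.sum_add_distrib, Finset.sum_eq_sum_Ico_succ_bot hlt]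
      have h4 : ∑ t ∈ Finset.Ico (t₁ + 1) t₂, (2 * η * (l - r * Λ t) + c) ≤ 0 := by
        refine Finset.sum_nonpos fun t ht => ?_
        rw [Finset.mem_Ico] at ht
        have := habove t (by omega) (by omega)
        have : 2 * η * (l - r * Λ t) ≤ 2 * η * (l - r * θ) :=
          mul_le_mul_of_nonneg_left (by nlinarith) (by positivity)
        linarith
      have : 2 * η * (l - r * Λ t₁) ≤ 2 * η * l :=
        mul_le_mul_of_nonneg_left (by nlinarith [hΛ t₁]) (by positivity)
      linarith
    have h5 : Φ t₁ ≤ θ ^ 2 := (hΦ t₁).trans (pow_le_pow_left₀ (hΛ t₁) hs₁ 2)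
    have h6 : Φ t₂ ≤ θ ^ 2 + 2 * η * l + c + 2 * η * B := by linarith
    have h7 := mul_le_mul_of_nonneg_left h6 hM.le
    have h8 : ζ ^ 2 < Λ t₂ ^ 2 := pow_lt_pow_left₀ hgt (hθ0.trans hθζ) two_ne_zero
    linarith [hΦ' t₂]

/-! ### One step of projected gradient descent -/

/-- Projecting does not increase the distance to `w`; expand the square of the unprojected step and
multiply by the inverse step size `a`. The case `a = 0` covers episodes before any nonzero loss. -/
theorem two_mul_sum_le_of_euclProj {ι : Type*} [Fintype ι] {C : Set (ι → ℝ)} (hC : IsCompact C)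
    (hconv : Convex ℝ C) {w q l : ι → ℝ} (hw : w ∈ C) {a : ℝ} (ha : 0 ≤ a)
    (ha0 : a = 0 → l = 0) :
    2 * ∑ i, l i * (q i - w i) ≤ a * (∑ i, (q i - w i) ^ 2
        - ∑ i, (euclProj C (fun i => q i - 1 / a * l i) i - w i) ^ 2) + (∑ i, l i ^ 2) / a := by
  rcases ha.eq_or_lt with h | h
  · simp [ha0 h.symm, ← h]
  have hp := sum_sq_euclProj_sub_le hC hconv hw (fun i => q i - 1 / a * l i)
  have e : ∑ i, (q i - 1 / a * l i - w i) ^ 2 = ∑ i, (q i - w i) ^ 2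
      - 2 / a * ∑ i, l i * (q i - w i) + (∑ i, l i ^ 2) / a ^ 2 := by
    rw [Finset.mul_sum, Finset.sum_div, ← Finset.sum_sub_distrib, ← Finset.sum_add_distrib]
    exact Finset.sum_congr rfl fun i _ => by field_simp; ring
  rw [e] at hp
  have := mul_le_mul_of_nonneg_left hp ha
  have e2 : a * (∑ i, (q i - w i) ^ 2 - 2 / a * ∑ i, l i * (q i - w i) + (∑ i, l i ^ 2) / a ^ 2)
      = a * ∑ i, (q i - w i) ^ 2 - 2 * ∑ i, l i * (q i - w i) + (∑ i, l i ^ 2) / a := by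
    field_simp
  rw [e2] at this
  linarith

/-- Summation by parts for gradient descent with nonincreasing step sizes `1 / a t`. -/
theorem sum_mul_sub_le_of_monotone {a d : ℕ → ℝ} {D : ℝ} (ha : Monotone a) (ha0 : 0 ≤ a 0)
    (hd0 : ∀ t, 0 ≤ d t) {t₁ t₂ : ℕ} (h : t₁ ≤ t₂) (hd : ∀ t ≤ t₂, d t ≤ D) :
    ∑ t ∈ Finset.Ico t₁ t₂, a (t + 1) * (d t - d (t + 1)) ≤ a t₂ * D := by
  have hnn : ∀ t, 0 ≤ a t := fun t => ha0.trans (ha (Nat.zero_le t))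
  -- The induction carries `D - d n` instead of `D`: as this factor is nonnegative, `a n` can be
  -- replaced by the larger `a (n + 1)` at every step.
  have key : ∀ n, t₁ ≤ n → n ≤ t₂ →
      ∑ t ∈ Finset.Ico t₁ n, a (t + 1) * (d t - d (t + 1)) ≤ a n * (D - d n) := by
    intro n hn
    induction n, hn using Nat.le_induction with
    | base =>
      intro h
      simpa using mul_nonneg (hnn _) (sub_nonneg.2 (hd _ h))
    | succ n hn ihn =>
      intro hn2
      rw [Finset.sum_Ico_succ_top hn]
      have h1 := ihn (by omega)
      have h2 : a n * (D - d n) ≤ a (n + 1) * (D - d n) :=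
        mul_le_mul_of_nonneg_right (ha (Nat.le_succ n)) (sub_nonneg.2 (hd n (by omega)))
      nlinarith
  exact (key t₂ h le_rfl).trans
    (mul_le_mul_of_nonneg_left (by linarith [hd0 t₂]) (hnn t₂))

/-! ### The iterates of PDGD-OPS -/

section Iterates

variable {X A : Type*} [Fintype X] [Fintype A] {L m T : ℕ} {S : LayeredSpace X L}
  {δ C K : ℝ} {e : ℕ → Episode X A L m}

theorem abs_costOf_le {G : X × A → Fin m → ℝ} (hG : ∀ p i, |G p i| ≤ 1) {q : X × A → ℝ}
    (hq : IsSubOcc L q) (i : Fin m) : |costOf G q i| ≤ L := by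
  refine (Finset.abs_sum_le_sum_abs _ _).trans (le_trans (Finset.sum_le_sum fun p _ => ?_) hq.sum_le)
  rw [abs_mul, abs_of_nonneg (hq.nonneg p)]
  exact mul_le_of_le_one_left (hq.nonneg p) (hG p i)

/-- For `u, v ∈ [0, 1]` one has `(u - v)² ≤ u + v`; this makes the squared diameter linear in `L`.
-/
theorem sum_sq_sub_le {q w : X × A → ℝ} (hq : IsSubOcc L q) (hw : IsSubOcc L w) :
    ∑ p, (q p - w p) ^ 2 ≤ 2 * L := by
  calc ∑ p, (q p - w p) ^ 2 ≤ ∑ p, (q p + w p) := by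
        refine Finset.sum_le_sum fun p _ => ?_
        nlinarith [hq.nonneg p, hq.le_one p, hw.nonneg p, hw.le_one p,
          mul_nonneg (hq.nonneg p) (hw.nonneg p)]
    _ ≤ 2 * L := by
        rw [Finset.sum_add_distrib]; linarith [hq.sum_le, hw.sum_le]

theorem lam_mem_box (t : ℕ) (i : Fin m) :
    0 ≤ (pdgdOps S T δ C K e t).lam i ∧ (pdgdOps S T δ C K e t).lam i ≤ (T : ℝ) ^ (1 / 4 : ℝ) := by
  cases t with
  | zero => exact ⟨le_rfl, by simp only [pdgdOps, initState, Pi.zero_apply]; positivity⟩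
  | succ t =>
    exact euclProj_mem (isCompact_box _) ⟨0, fun i => ⟨le_rfl, by
      simp only [Pi.zero_apply]; positivity⟩⟩ _ i

theorem lossMax_mono : Monotone fun t => (pdgdOps S T δ C K e t).lossMax :=
  monotone_nat_of_le_succ fun _ => le_max_left _ _

theorem norm_loss_le_lossMax (t : ℕ) :
    ‖(pdgdOps S T δ C K e t).loss (e t)‖ ≤ (pdgdOps S T δ C K e (t + 1)).lossMax :=
  le_max_right _ _

theorem norm_loss_le {s : AlgState X A m} {ep : Episode X A L m}
    (hr : ∀ p, ep.reward p ∈ Set.Icc (0 : ℝ) 1) (hc : ∀ p i, ep.cost p i ∈ Set.Icc (-1 : ℝ) 1) :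
    ‖s.loss ep‖ ≤ 1 + ∑ i, |s.lam i| := by
  have h0 : 0 ≤ ∑ i, |s.lam i| := Finset.sum_nonneg fun i _ => abs_nonneg _
  refine (pi_norm_le_iff_of_nonneg (by linarith)).2 fun p => ?_
  rw [Real.norm_eq_abs, AlgState.loss]
  refine (abs_sub _ _).trans ?_
  rw [add_comm]
  refine add_le_add (abs_le.2 ⟨by linarith [(hr p).1], (hr p).2⟩) ?_
  refine (Finset.abs_sum_le_sum_abs _ _).trans (Finset.sum_le_sum fun i _ => ?_)
  rw [abs_mul]
  exact mul_le_of_le_one_left (abs_nonneg _) (abs_le.2 (hc p i))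

theorem lossMax_le (hr : ∀ t < T, ∀ p, (e t).reward p ∈ Set.Icc (0 : ℝ) 1)
    (hc : ∀ t < T, ∀ p i, (e t).cost p i ∈ Set.Icc (-1 : ℝ) 1) {ζ : ℝ} (hζ : 0 ≤ ζ) {n : ℕ}
    (hn : n ≤ T) (h : ∀ t < n, ∑ i, |(pdgdOps S T δ C K e t).lam i| ≤ ζ) :
    (pdgdOps S T δ C K e n).lossMax ≤ 1 + ζ := by
  induction n with
  | zero => simp only [pdgdOps, initState]; linarith
  | succ n ih =>
    refine max_le (ih (by omega) fun t ht => h t (by omega)) ?_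
    exact (norm_loss_le (hr n hn) (hc n hn)).trans (by linarith [h n (by omega)])

/-- Since `P` lies in the confidence set, the set projected onto is nonempty and the iterate really
belongs to it. -/
theorem isSubOcc_qhat [Nonempty A] {P : X → A → X → ℝ} (hπ : ∃ π : X → A → ℝ, IsPolicy π)
    (hclean : ∀ t ≤ T, P ∈ (pdgdOps S T δ C K e t).counters.confSet S T δ) {t : ℕ} (ht : t ≤ T) :
    IsSubOcc L (pdgdOps S T δ C K e t).qhat := by
  cases t with
  | zero => exact isSubOcc_initState m
  | succ t =>
    obtain ⟨π, hπ⟩ := hπ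
    exact isSubOcc_of_mem_occSet (S := S) (fun Q hQ => hQ.1)
      (euclProj_mem (isCompact_occSet_confSet _ T δ) ⟨_, P, hclean (t + 1) ht, π, hπ, rfl⟩ _)

/-- Regret of the primal iterates on an interval of episodes. -/
theorem primal_regret_le [Nonempty A] {P : X → A → X → ℝ}
    (hclean : ∀ t ≤ T, P ∈ (pdgdOps S T δ C K e t).counters.confSet S T δ)
    {q₀ : X × A → ℝ} (hq₀ : q₀ ∈ occSet S {P}) (hC : 0 < C) {t₁ t₂ : ℕ} (h₁₂ : t₁ ≤ t₂)
    (h₂ : t₂ ≤ T) :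
    2 * ∑ t ∈ Finset.Ico t₁ t₂, ∑ p, (pdgdOps S T δ C K e t).loss (e t) p *
        ((pdgdOps S T δ C K e t).qhat p - q₀ p)
      ≤ (pdgdOps S T δ C K e t₂).lossMax * √T *
        (2 * L * C + Fintype.card X * Fintype.card A / C) := by
  obtain ⟨P', rfl, π, hπ, rfl⟩ := hq₀
  have hq₀ : ∀ t ≤ T, occ S P' π ∈ occSet S ((pdgdOps S T δ C K e t).counters.confSet S T δ) :=
    fun t ht => ⟨P', hclean t ht, π, hπ, rfl⟩
  have hsub₀ : IsSubOcc L (occ S P' π) :=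
    isSubOcc_of_mem_occSet (S := S) (fun Q hQ => hQ.1) (hq₀ 0 (Nat.zero_le T))
  rcases Nat.eq_zero_or_pos T with hT | hT
  · obtain rfl : t₁ = 0 := by omega
    obtain rfl : t₂ = 0 := by omega
    simp [pdgdOps, initState]
  have hsT : 0 < √(T : ℝ) := Real.sqrt_pos.2 (by exact_mod_cast hT)
  set st := pdgdOps S T δ C K e with hst
  set a : ℕ → ℝ := fun t => (st t).lossMax * C * √T with ha
  set d : ℕ → ℝ := fun t => ∑ p, ((st t).qhat p - occ S P' π p) ^ 2 with hd
  -- `a (t + 1)` is the inverse of the step size used in episode `t`; it grows with the running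
  -- maximum of the losses.
  have hmono : Monotone a := fun s t hst' => by
    have := lossMax_mono (S := S) (T := T) (δ := δ) (C := C) (K := K) (e := e) hst'
    simp only [ha]
    gcongr
  have hM0 : ∀ t, 0 ≤ (st t).lossMax := fun t =>
    lossMax_mono (S := S) (T := T) (δ := δ) (C := C) (K := K) (e := e) (Nat.zero_le t)
  have hstep : ∀ t ∈ Finset.Ico t₁ t₂, 2 * ∑ p, (st t).loss (e t) p *
      ((st t).qhat p - occ S P' π p) ≤ a (t + 1) * (d t - d (t + 1))
        + (st t₂).lossMax * (Fintype.card X * Fintype.card A / (C * √T)) := by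
    intro t ht
    rw [Finset.mem_Ico] at ht
    have hle := norm_loss_le_lossMax (S := S) (T := T) (δ := δ) (C := C) (K := K) (e := e) t
    rw [← hst] at hle
    have h0 := two_mul_sum_le_of_euclProj (isCompact_occSet_confSet _ T δ)
      (convex_occSet_confSet _ T δ) (hq₀ (t + 1) (by omega)) (q := (st t).qhat)
      (l := (st t).loss (e t)) (a := a (t + 1)) (by have := hM0 (t + 1); positivity)
      (fun h => by
        have h' : (st (t + 1)).lossMax = 0 := by
          simpa [ha, hC.ne', hsT.ne'] using h
        rw [h'] at hle
        exact norm_le_zero_iff.1 hle)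
    refine h0.trans (add_le_add le_rfl ?_)
    -- One factor of the running maximum cancels against the step size, so the error is linear in
    -- it. Each episode contributes order `1 / √T`, the whole interval at most order `√T`.
    have hsq : ∑ p, (st t).loss (e t) p ^ 2
        ≤ Fintype.card X * Fintype.card A * (st (t + 1)).lossMax ^ 2 := by
      calc ∑ p, (st t).loss (e t) p ^ 2 ≤ ∑ _p : X × A, (st (t + 1)).lossMax ^ 2 := by
            refine Finset.sum_le_sum fun p _ => sq_le_sq' ?_ ?_
            · have := (norm_le_pi_norm ((st t).loss (e t)) p).trans hle
              exact (abs_le.1 this).1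
            · have := (norm_le_pi_norm ((st t).loss (e t)) p).trans hle
              exact (abs_le.1 this).2
        _ = _ := by simp [Finset.card_univ]
    have hm2 : (st (t + 1)).lossMax ≤ (st t₂).lossMax :=
      lossMax_mono (S := S) (T := T) (δ := δ) (C := C) (K := K) (e := e) (by omega)
    rcases (hM0 (t + 1)).eq_or_lt with h | h
    · have : a (t + 1) = 0 := by simp [ha, ← h]
      rw [this, div_zero]
      have := hM0 t₂
      positivity
    · calc (∑ p, (st t).loss (e t) p ^ 2) / a (t + 1)
          ≤ (Fintype.card X * Fintype.card A * (st (t + 1)).lossMax ^ 2) / a (t + 1) := by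
            have : 0 ≤ a (t + 1) := by have := hM0 (t + 1); positivity
            gcongr
        _ = (st (t + 1)).lossMax * (Fintype.card X * Fintype.card A / (C * √T)) := by
            simp only [ha]; field_simp
        _ ≤ _ := mul_le_mul_of_nonneg_right hm2 (by positivity)
  have hsum := sum_mul_sub_le_of_monotone (a := a) (d := d) (D := 2 * L) hmono
    (by have := hM0 0; positivity) (fun t => Finset.sum_nonneg fun p _ => sq_nonneg _) h₁₂
    (fun t ht => sum_sq_sub_le (isSubOcc_qhat ⟨π, hπ⟩ hclean (ht.trans h₂)) hsub₀)
  rw [Finset.mul_sum]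
  refine (Finset.sum_le_sum hstep).trans ?_
  rw [Finset.sum_add_distrib, Finset.sum_const, nsmul_eq_mul, Nat.card_Ico]
  have hcount : ((t₂ - t₁ : ℕ) : ℝ) ≤ √T * √T := by
    rw [Real.mul_self_sqrt (Nat.cast_nonneg T)]
    exact_mod_cast (by omega : t₂ - t₁ ≤ T)
  calc ∑ t ∈ Finset.Ico t₁ t₂, a (t + 1) * (d t - d (t + 1)) + ((t₂ - t₁ : ℕ) : ℝ) *
        ((st t₂).lossMax * (Fintype.card X * Fintype.card A / (C * √T)))
      ≤ a t₂ * (2 * L) + √T * √T *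
        ((st t₂).lossMax * (Fintype.card X * Fintype.card A / (C * √T))) := by
        refine add_le_add hsum (mul_le_mul_of_nonneg_right hcount ?_)
        have := hM0 t₂
        positivity
    _ = _ := by simp only [ha]; field_simp

/-- The projection is compared with the point `0` of the box, and every cost is at most `L` in
absolute value. -/
theorem dual_step_le {t : ℕ} (hc : ∀ p i, (e t).cost p i ∈ Set.Icc (-1 : ℝ) 1)
    (hq : IsSubOcc L (pdgdOps S T δ C K e t).qhat) :
    ∑ i, (pdgdOps S T δ C K e (t + 1)).lam i ^ 2
      ≤ ∑ i, (pdgdOps S T δ C K e t).lam i ^ 2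
        + 2 * dualRate T δ K * ∑ i, (pdgdOps S T δ C K e t).lam i *
          costOf (e t).cost (pdgdOps S T δ C K e t).qhat i
        + dualRate T δ K ^ 2 * (m * L ^ 2) := by
  set η := dualRate T δ K with hη
  set s := pdgdOps S T δ C K e t with hs
  have h0 : (0 : Fin m → ℝ) ∈ {v : Fin m → ℝ | ∀ i, 0 ≤ v i ∧ v i ≤ (T : ℝ) ^ (1 / 4 : ℝ)} :=
    fun i => ⟨le_rfl, by simp only [Pi.zero_apply]; positivity⟩
  have h := sum_sq_euclProj_sub_le (isCompact_box _) (convex_box _) h0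
    (fun i => s.lam i + η * costOf (e t).cost s.qhat i)
  simp only [Pi.zero_apply, sub_zero] at h
  refine le_trans (le_of_eq rfl) (h.trans ?_)
  have h1 : ∑ i, costOf (e t).cost s.qhat i ^ 2 ≤ m * (L : ℝ) ^ 2 := by
    calc ∑ i, costOf (e t).cost s.qhat i ^ 2 ≤ ∑ _i : Fin m, (L : ℝ) ^ 2 := by
          refine Finset.sum_le_sum fun i _ => ?_
          have := abs_le.1 (abs_costOf_le (fun p i => abs_le.2 (hc p i)) hq i)
          exact sq_le_sq' this.1 this.2
      _ = _ := by simp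
  have e1 : ∑ i, (s.lam i + η * costOf (e t).cost s.qhat i) ^ 2 = ∑ i, s.lam i ^ 2
      + 2 * η * ∑ i, s.lam i * costOf (e t).cost s.qhat i
      + η ^ 2 * ∑ i, costOf (e t).cost s.qhat i ^ 2 := by
    rw [Finset.mul_sum, Finset.mul_sum, ← Finset.sum_add_distrib, ← Finset.sum_add_distrib]
    exact Finset.sum_congr rfl fun i _ => by ring
  rw [e1]
  have := mul_le_mul_of_nonneg_left h1 (sq_nonneg η)
  linarith

theorem sum_loss_mul (s : AlgState X A m) (ep : Episode X A L m) (q : X × A → ℝ) :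
    ∑ p, s.loss ep p * q p = ∑ i, s.lam i * costOf ep.cost q i - ∑ p, ep.reward p * q p := by
  simp only [AlgState.loss, costOf, sub_mul, Finset.sum_sub_distrib, Finset.sum_mul,
    Finset.mul_sum]
  rw [Finset.sum_comm]
  congr 1
  exact Finset.sum_congr rfl fun i _ => Finset.sum_congr rfl fun p _ => by ring

/-- The loss is the weighted cost minus the reward, so comparing `q` with `q₀` leaves a difference
of rewards, at most `L`. -/
theorem sum_lam_costOf_le {ep : Episode X A L m} {s : AlgState X A m} {q q₀ : X × A → ℝ}
    (hr : ∀ p, ep.reward p ∈ Set.Icc (0 : ℝ) 1) (hq : IsSubOcc L q) (hq₀ : IsSubOcc L q₀) :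
    ∑ i, s.lam i * costOf ep.cost q i
      ≤ L + ∑ i, s.lam i * costOf ep.cost q₀ i + ∑ p, s.loss ep p * (q p - q₀ p) := by
  have e1 : ∑ p, s.loss ep p * (q p - q₀ p) = ∑ p, s.loss ep p * q p - ∑ p, s.loss ep p * q₀ p := by
    rw [← Finset.sum_sub_distrib]; exact Finset.sum_congr rfl fun p _ => by ring
  rw [e1, sum_loss_mul, sum_loss_mul]
  have h1 : ∑ p, ep.reward p * q p ≤ L :=
    (Finset.sum_le_sum fun p _ => mul_le_of_le_one_left (hq.nonneg p) (hr p).2).trans hq.sum_le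
  have h2 : 0 ≤ ∑ p, ep.reward p * q₀ p :=
    Finset.sum_nonneg fun p _ => mul_nonneg (hr p).1 (hq₀.nonneg p)
  linarith

end Iterates

/-! ### The bound on a single run, with explicit constants. -/

section Deterministic

variable {X A : Type*} [Fintype X] [Fintype A] {L m T : ℕ} {S : LayeredSpace X L}
  {δ C K : ℝ} {e : ℕ → Episode X A L m}

/-- A row of total mass one, sitting in a layer before the last, must have a target in the next
layer. -/
theorem exists_layer_eq [Nonempty A] {P : X → A → X → ℝ} (hP : IsTransition S P) {k : ℕ}
    (hk : k ≤ L) : ∃ x, S.layer x = k := by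
  induction k with
  | zero => exact ⟨S.source, (S.layer_eq_zero_iff _).2 rfl⟩
  | succ k ih =>
    obtain ⟨x, hx⟩ := ih (by omega)
    have a : A := Classical.arbitrary A
    by_contra! h
    have h1 := hP.sum_eq_one x a (by omega)
    rw [Finset.sum_eq_zero fun x' _ => hP.eq_zero (by rw [hx]; exact h x')] at h1
    exact zero_ne_one h1

theorem lt_card [Nonempty A] {P : X → A → X → ℝ} (hP : IsTransition S P) :
    L < Fintype.card X := by
  choose f hf using fun k : Fin (L + 1) => exists_layer_eq hP (Nat.lt_succ_iff.1 k.2)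
  have hinj : Function.Injective f := fun i j h => Fin.ext (by rw [← hf i, ← hf j, h])
  simpa using Fintype.card_le_of_injective f hinj

theorem le_card_mul_card [Nonempty A] {P : X → A → X → ℝ} (hP : IsTransition S P) :
    (L : ℝ) ≤ Fintype.card X * Fintype.card A := by
  have h1 := lt_card hP
  have h2 : 0 < Fintype.card A := Fintype.card_pos
  exact_mod_cast h1.le.trans (Nat.le_mul_of_pos_right _ h2)

theorem RhoCondition.pos {ρ : ℝ} (h : RhoCondition T L m ρ) (hL : 0 < L) (hm : 0 < m)
    (hT : 0 < T) : 0 < ρ := by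
  refine lt_of_lt_of_le ?_ h
  positivity

/-- For `T = 1` the condition would force `ρ ≥ L √(20 m) > L`. Hence `T ≥ 2` and `T² / δ ≥ 4 > exp
1`. -/
theorem RhoCondition.one_le_log {ρ : ℝ} (h : RhoCondition T L m ρ) (hρ : ρ ≤ L) (hL : 0 < L)
    (hm : 0 < m) (hT : 0 < T) (hδ : δ ∈ Set.Ioo (0 : ℝ) 1) :
    1 ≤ Real.log ((T : ℝ) ^ 2 / δ) := by
  have hT2 : 2 ≤ T := by
    by_contra! hlt
    obtain rfl : T = 1 := by omega
    have h1 := h.trans hρ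
    simp only [Nat.cast_one, Real.one_rpow, one_mul] at h1
    have hL' : (0 : ℝ) < L := by exact_mod_cast hL
    have hm' : (1 : ℝ) ≤ m := by exact_mod_cast hm
    have h2 : (1 : ℝ) < √(20 * m) := by
      rw [Real.lt_sqrt (by norm_num)]; linarith
    nlinarith
  have h4 : (4 : ℝ) ≤ (T : ℝ) ^ 2 / δ := by
    rw [le_div_iff₀ hδ.1]
    have : (2 : ℝ) ≤ T := by exact_mod_cast hT2
    nlinarith [hδ.1, hδ.2]
  rw [Real.le_log_iff_exp_le (by linarith)]
  linarith [Real.exp_one_lt_d9]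

theorem sum_sq_le_sq_sum_abs {m : ℕ} {v : Fin m → ℝ} : ∑ i, v i ^ 2 ≤ (∑ i, |v i|) ^ 2 := by
  have := Finset.sum_sq_le_sq_sum_of_nonneg (s := Finset.univ) (f := fun i => |v i|)
    fun i _ => abs_nonneg _
  simpa using this

theorem sq_sum_abs_le {m : ℕ} {v : Fin m → ℝ} : (∑ i, |v i|) ^ 2 ≤ m * ∑ i, v i ^ 2 := by
  have := sq_sum_le_card_mul_sum_sq (s := Finset.univ) (f := fun i => |v i|)
  simpa using this

/-- The dual iterates stay bounded on every run on which the confidence sets contain the true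
transition function and a strictly feasible occupancy measure `q₀` has small cost up to noise. -/
theorem sum_abs_lam_le [Nonempty A] (hL : 0 < L) (hm : 0 < m) (hT : 0 < T)
    (hC : C = 5 * (Fintype.card X * Fintype.card A) / L)
    (hK : K = 100 * m * (Fintype.card X * Fintype.card A))
    {P : X → A → X → ℝ} (hP : IsTransition S P)
    (hr : ∀ t < T, ∀ p, (e t).reward p ∈ Set.Icc (0 : ℝ) 1)
    (hc : ∀ t < T, ∀ p i, (e t).cost p i ∈ Set.Icc (-1 : ℝ) 1)
    (hclean : ∀ t ≤ T, P ∈ (pdgdOps S T δ C K e t).counters.confSet S T δ)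
    {q₀ : X × A → ℝ} (hq₀ : q₀ ∈ occSet S {P}) {ρ ζ : ℝ} (hρ0 : 0 < ρ) (hρL : ρ ≤ L)
    (hlog : 1 ≤ Real.log ((T : ℝ) ^ 2 / δ)) (hζ : ζ = 20 * m * L ^ 2 / ρ ^ 2)
    (hnoise : ∀ t₁ t₂, t₁ < t₂ → t₂ ≤ T →
      (∀ t < t₂, ∑ i, |(pdgdOps S T δ C K e t).lam i| ≤ ζ) →
      ∑ t ∈ Finset.Ico t₁ t₂, ∑ i, (pdgdOps S T δ C K e t).lam i * costOf (e t).cost q₀ i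
        ≤ ∑ t ∈ Finset.Ico t₁ t₂, -(ρ / 2) * ∑ i, |(pdgdOps S T δ C K e t).lam i|
          + L * ζ * √(2 * T * Real.log ((T : ℝ) ^ 2 / δ))) :
    ∀ t ≤ T, ∑ i, |(pdgdOps S T δ C K e t).lam i| ≤ ζ := by
  set N : ℝ := Fintype.card X * Fintype.card A with hN
  have hLN : (L : ℝ) ≤ N := le_card_mul_card hP
  have hL1 : (1 : ℝ) ≤ L := by exact_mod_cast hL
  have hm1 : (1 : ℝ) ≤ m := by exact_mod_cast hm
  have hT1 : (1 : ℝ) ≤ T := by exact_mod_cast hT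
  have hN1 : 1 ≤ N := hL1.trans hLN
  set lg := Real.log ((T : ℝ) ^ 2 / δ) with hlg
  set sT := √(T : ℝ) with hsT
  set sl := √lg with hsl
  have hsT1 : 1 ≤ sT := Real.one_le_sqrt.2 hT1
  have hsl1 : 1 ≤ sl := Real.one_le_sqrt.2 hlog
  have hC0 : 0 < C := by rw [hC]; positivity
  set η := dualRate T δ K with hη
  have hηeq : η = 1 / (100 * m * N * (sT * sl)) := by
    rw [hη, dualRate, ← hlg, Real.sqrt_mul (by positivity), hK]
  have hη0 : 0 < η := by rw [hηeq]; positivity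
  have hηK : η * (100 * m * N * (sT * sl)) = 1 := by rw [hηeq]; field_simp
  set κ := (L : ℝ) / ρ with hκ
  have hκ1 : 1 ≤ κ := (one_le_div hρ0).2 hρL
  have hζκ : ζ = 20 * m * κ ^ 2 := by rw [hζ, hκ, div_pow]; ring
  have hκ2 : κ ≤ κ ^ 2 := by nlinarith
  have hmκ : κ ^ 2 ≤ m * κ ^ 2 := by nlinarith
  have hζ20 : 20 ≤ ζ := by linarith
  -- the step size is small compared with `1 / (m N)`
  have hηmN : η * (m * N) ≤ 1 / 100 := by
    have h1 : 1 ≤ sT * sl := one_le_mul_of_one_le_of_one_le hsT1 hsl1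
    have h2 : η * (m * N) * 1 ≤ η * (m * N) * (sT * sl) :=
      mul_le_mul_of_nonneg_left h1 (by positivity)
    have h3 : η * (m * N) * (sT * sl) = 1 / 100 := by linear_combination hηK / 100
    linarith
  have hηmL : η * (m * L) ≤ 1 / 100 := le_trans (by gcongr) hηmN
  have hηT : m * (η * (N * sT)) ≤ 1 / 100 := by
    have h2 : η * (m * N * sT) * 1 ≤ η * (m * N * sT) * sl :=
      mul_le_mul_of_nonneg_left hsl1 (by positivity)
    have h3 : η * (m * N * sT) * sl = 1 / 100 := by linear_combination hηK / 100
    linarith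
  have hηTl : m * (η * (L * (sT * sl))) ≤ 1 / 100 := by
    have : m * (η * (L * (sT * sl))) ≤ m * (η * (N * (sT * sl))) := by gcongr
    have h3 : m * (η * (N * (sT * sl))) = 1 / 100 := by linear_combination hηK / 100
    linarith
  have hsqrt2 : √(2 * T * lg) = √2 * (sT * sl) := by
    rw [Real.sqrt_mul (by positivity), Real.sqrt_mul (by norm_num)]; ring
  have hs2 : √2 ≤ 3 / 2 := by
    rw [Real.sqrt_le_left (by norm_num)]; norm_num
  -- The first summand is the primal regret for losses at most `1 + ζ`, the second the noise. The
  -- factor `100 * m * N` in the dual rate makes `m * (2 * η * B)` a small multiple of `1 + ζ`.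
  set B := (1 + ζ) * sT * (11 * N) / 2 + L * ζ * √(2 * T * lg) with hB
  have hmηB : m * (2 * η * B) ≤ 11 / 100 * (1 + ζ) + 3 / 100 * ζ := by
    have e1 : m * (2 * η * B) = 11 * (1 + ζ) * (m * (η * (N * sT)))
        + 2 * √2 * ζ * (m * (η * (L * (sT * sl)))) := by
      rw [hB, hsqrt2]; ring
    rw [e1]
    have h1 : 11 * (1 + ζ) * (m * (η * (N * sT))) ≤ 11 * (1 + ζ) * (1 / 100) := by gcongr
    have h2 : 2 * √2 * ζ * (m * (η * (L * (sT * sl)))) ≤ 2 * (3 / 2) * ζ * (1 / 100) := by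
      gcongr
    linarith
  obtain ⟨-, -, π, hπ, -⟩ := id hq₀
  have hsub₀ : IsSubOcc L q₀ :=
    isSubOcc_of_mem_occSet (S := S) (fun Q hQ => by rw [Set.mem_singleton_iff] at hQ; rwa [hQ]) hq₀
  have hsub : ∀ t ≤ T, IsSubOcc L (pdgdOps S T δ C K e t).qhat := fun t ht =>
    isSubOcc_qhat ⟨π, hπ⟩ hclean ht
  refine le_of_potential_drift
    (Φ := fun t => ∑ i, (pdgdOps S T δ C K e t).lam i ^ 2)
    (p := fun t => ∑ i, (pdgdOps S T δ C K e t).lam i *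
      costOf (e t).cost (pdgdOps S T δ C K e t).qhat i)
    (l := L) (r := ρ / 2) (θ := 4 * κ) (η := η) (c := η ^ 2 * (m * L ^ 2)) (B := B) (M := m)
    (fun t ht => dual_step_le (hc t ht) (hsub t ht.le)) ?_ ?_ ?_
    (fun t => Finset.sum_nonneg fun i _ => abs_nonneg _) (by positivity) hη0.le
    (fun t => sum_sq_le_sq_sum_abs) (fun t => sq_sum_abs_le) (by positivity) ?_ ?_
  · intro t₁ t₂ h12 h2 hle
    have h1 := primal_regret_le (K := K) hclean hq₀ hC0 h12.le h2
    have h3 := hnoise t₁ t₂ h12 h2 hle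
    have hM := lossMax_le hr hc (by linarith) h2 hle
    -- The choice of `C` gives `10 * N + L / 5`, and `L ≤ N`.
    have h4 : 2 * L * C + N / C ≤ 11 * N := by
      have e1 : 2 * L * C = 10 * N := by rw [hC]; field_simp; ring
      have e2 : N / C = L / 5 := by rw [hC]; field_simp
      rw [e1, e2]; linarith
    have h5 : (pdgdOps S T δ C K e t₂).lossMax * sT * (2 * L * C + N / C)
        ≤ (1 + ζ) * sT * (11 * N) := by
      have : 0 ≤ 2 * L * C + N / C := by positivity
      gcongr
    calc ∑ t ∈ Finset.Ico t₁ t₂, ∑ i, (pdgdOps S T δ C K e t).lam i *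
          costOf (e t).cost (pdgdOps S T δ C K e t).qhat i
        ≤ ∑ t ∈ Finset.Ico t₁ t₂, (L + ∑ i, (pdgdOps S T δ C K e t).lam i *
          costOf (e t).cost q₀ i + ∑ p, (pdgdOps S T δ C K e t).loss (e t) p *
            ((pdgdOps S T δ C K e t).qhat p - q₀ p)) := by
          refine Finset.sum_le_sum fun t ht => ?_
          rw [Finset.mem_Ico] at ht
          exact sum_lam_costOf_le (hr t (by omega)) (hsub t (by omega)) hsub₀
      _ ≤ _ := by
          rw [Finset.sum_add_distrib, Finset.sum_add_distrib]
          have e1 : ∑ t ∈ Finset.Ico t₁ t₂, ((L : ℝ) - ρ / 2 *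
              ∑ i, |(pdgdOps S T δ C K e t).lam i|) = ∑ _t ∈ Finset.Ico t₁ t₂, (L : ℝ)
              + ∑ t ∈ Finset.Ico t₁ t₂, -(ρ / 2) * ∑ i, |(pdgdOps S T δ C K e t).lam i| := by
            rw [← Finset.sum_add_distrib]
            exact Finset.sum_congr rfl fun t _ => by ring
          rw [e1, hB]
          linarith
  -- The threshold `4 * κ` doubles the reward term `L`, so the drift is `-2ηL + η² m L²`, negative
  -- since `η m L ≤ 1 / 100`.
  · have e1 : ρ / 2 * (4 * κ) = 2 * L := by rw [hκ]; field_simp; ring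
    rw [e1]
    have : η * L * (η * (m * L)) ≤ η * L * (1 / 100) := by gcongr
    have h0 : 0 ≤ η * L := by positivity
    have e2 : 2 * η * (L - 2 * L) + η ^ 2 * (m * (L : ℝ) ^ 2)
        = η * L * (η * (m * L)) - 2 * (η * L) := by ring
    linarith
  · simp only [pdgdOps, initState, Pi.zero_apply, abs_zero, Finset.sum_const_zero]
    positivity
  -- The main term is `16 m κ² = 4ζ/5`. Everything together is linear in `ζ`, and `ζ² ≥ 20 ζ`
  -- absorbs it.
  · have e1 : m * ((4 * κ) ^ 2 + 2 * η * L + η ^ 2 * (m * L ^ 2) + 2 * η * B)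
        = 4 / 5 * ζ + 2 * (η * (m * L)) + (η * (m * L)) ^ 2 + m * (2 * η * B) := by
      rw [hζκ]; ring
    rw [e1]
    have h1 : (η * (m * L)) ^ 2 ≤ (1 / 100) ^ 2 := by gcongr
    have h2 : 20 * ζ ≤ ζ ^ 2 := by rw [sq]; gcongr
    linarith
  · linarith

end Deterministic

/-! ### Exponential moments -/

/-- Hoeffding's lemma for a Bernoulli variable. -/
theorem bernoulli_mgf_le {p : ℝ} (hp : p ∈ Set.Icc (0 : ℝ) 1) (c : ℝ) :
    p * Real.exp (c * (1 - p) - c ^ 2 / 8) + (1 - p) * Real.exp (c * (0 - p) - c ^ 2 / 8) ≤ 1 := by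
  obtain ⟨h0, h1⟩ := hp
  -- The Bernoulli law of mean `p`, to which the general Hoeffding lemma on `[0, 1]` is applied.
  let ν : Measure ℝ := ENNReal.ofReal p • Measure.dirac 1 + ENNReal.ofReal (1 - p) • Measure.dirac 0
  have hν : IsProbabilityMeasure ν := ⟨by
    simp only [ν, Measure.coe_add, Measure.coe_smul, Pi.add_apply, Pi.smul_apply, measure_univ,
      smul_eq_mul, mul_one]
    rw [← ENNReal.ofReal_add h0 (by linarith)]
    simp⟩
  have hint : ∀ f : ℝ → ℝ, ∫ x, f x ∂ν = p * f 1 + (1 - p) * f 0 := by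
    intro f
    have hi : ∀ (q : ENNReal) (x : ℝ), q ≠ ⊤ → Integrable f (q • Measure.dirac x) := fun q x hq =>
      (integrable_dirac (by simp)).smul_measure hq
    rw [integral_add_measure (hi _ _ ENNReal.ofReal_ne_top) (hi _ _ ENNReal.ofReal_ne_top),
      integral_smul_measure, integral_smul_measure, integral_dirac, integral_dirac,
      ENNReal.toReal_ofReal h0, ENNReal.toReal_ofReal (by linarith), smul_eq_mul, smul_eq_mul]
  have hb : ∀ᵐ x ∂ν, (id x : ℝ) ∈ Set.Icc (0 : ℝ) 1 := by
    rw [ae_iff]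
    simp [ν]
  have h := (hasSubgaussianMGF_of_mem_Icc (μ := ν) (X := id) (a := 0) (b := 1) aemeasurable_id hb).mgf_le c
  rw [mgf] at h
  simp only [hint, id] at h
  norm_num at h
  have e : Real.exp (c ^ 2 / 8) * Real.exp (-(c ^ 2 / 8)) = 1 := by
    rw [← Real.exp_add]; simp
  have h2 := mul_le_mul_of_nonneg_right h (Real.exp_pos (-(c ^ 2 / 8))).le
  rw [sub_eq_add_neg (c * (1 - p)), Real.exp_add, sub_eq_add_neg (c * (0 - p)), Real.exp_add]
  have e3 : (1 / 4 * c ^ 2 / 2) = c ^ 2 / 8 := by ring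
  rw [e3, e] at h2
  rw [zero_sub, mul_neg]
  linarith

section PullOut

variable {Ω : Type*} {m₀ : MeasurableSpace Ω} {μ : Measure Ω} [IsProbabilityMeasure μ]

/-- Pulling `f` out of the conditional expectation; this integrated form is how the conditional law
of the next state is used. -/
theorem integral_mul_indicator_eq {m : MeasurableSpace Ω} (hm : m ≤ m₀) {f g : Ω → ℝ}
    (hf : Measurable[m] f) {b : ℝ} (hb : ∀ ω, |f ω| ≤ b) {s : Set Ω} (hs : MeasurableSet[m₀] s)
    (hg : μ⟦s | m⟧ =ᵐ[μ] g) :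
    ∫ ω, f ω * s.indicator (fun _ => (1 : ℝ)) ω ∂μ = ∫ ω, f ω * g ω ∂μ := by
  have hi : Integrable (s.indicator (fun _ => (1 : ℝ))) μ := (integrable_const 1).indicator hs
  have hfs : StronglyMeasurable[m] f := hf.stronglyMeasurable
  have hfi : Integrable (f * s.indicator (fun _ => (1 : ℝ))) μ :=
    hi.bdd_mul (hf.mono hm le_rfl).aestronglyMeasurable (Filter.Eventually.of_forall hb)
  have h1 := condExp_mul_of_stronglyMeasurable_left (μ := μ) hfs hfi hi
  have h2 := integral_condExp (μ := μ) hm (f := f * s.indicator (fun _ => (1 : ℝ)))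
  calc ∫ ω, f ω * s.indicator (fun _ => (1 : ℝ)) ω ∂μ
      = ∫ ω, (μ[f * s.indicator (fun _ => (1 : ℝ)) | m]) ω ∂μ := h2.symm
    _ = ∫ ω, f ω * g ω ∂μ := by
        refine integral_congr_ae ?_
        filter_upwards [h1, hg] with ω h1 h2
        rw [h1, Pi.mul_apply, h2]

end PullOut

/-! ### Bernoulli trials at random times -/

section Trials

open Classical in
/-- The number of the trials `V 0, …, V (t - 1)` which take place. -/
noncomputable def trialCount {Ω : Type*} (V : ℕ → Set Ω) (t : ℕ) (ω : Ω) : ℕ :=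
  ((Finset.range t).filter fun s => ω ∈ V s).card

/-- The number of successes `D s` among the trials `V 0, …, V (t - 1)`. -/
noncomputable def successCount {Ω : Type*} (V D : ℕ → Set Ω) (t : ℕ) (ω : Ω) : ℕ :=
  trialCount (fun s => V s ∩ D s) t ω

variable {Ω : Type*} {m₀ : MeasurableSpace Ω} {μ : Measure Ω} [IsProbabilityMeasure μ]

theorem trialCount_succ (V : ℕ → Set Ω) (t : ℕ) (ω : Ω) [Decidable (ω ∈ V t)] :
    trialCount V (t + 1) ω = trialCount V t ω + if ω ∈ V t then 1 else 0 := by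
  classical
  rw [trialCount, Finset.range_add_one, Finset.filter_insert]
  split_ifs
  · rw [Finset.card_insert_of_notMem (by simp), trialCount]
  · rw [trialCount, add_zero]

theorem trialCount_mono (V : ℕ → Set Ω) (ω : Ω) : Monotone fun t => trialCount V t ω := by
  classical
  exact monotone_nat_of_le_succ fun t => by rw [trialCount_succ]; omega

theorem trialCount_le (V : ℕ → Set Ω) (t : ℕ) (ω : Ω) : trialCount V t ω ≤ t := by
  classical
  rw [trialCount]
  exact (Finset.card_filter_le _ _).trans (by simp)

theorem measurable_trialCount {ℱ : ℕ → MeasurableSpace Ω} (hmono : Monotone ℱ) {V : ℕ → Set Ω}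
    {T : ℕ} (hV : ∀ s < T, MeasurableSet[ℱ (s + 1)] (V s)) {t : ℕ} (ht : t ≤ T) :
    Measurable[ℱ t] (trialCount V t) := by
  classical
  induction t with
  | zero =>
    have : trialCount V 0 = fun _ => 0 := by funext ω; simp [trialCount]
    rw [this]; exact measurable_const
  | succ t ih =>
    have h1 : Measurable[ℱ (t + 1)] (trialCount V t) :=
      (ih (by omega)).mono (hmono (Nat.le_succ t)) le_rfl
    have e : trialCount V (t + 1) = fun ω => trialCount V t ω + if ω ∈ V t then 1 else 0 := by
      funext ω; rw [trialCount_succ]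
    rw [e]
    exact h1.add (Measurable.ite (hV t (by omega)) measurable_const measurable_const)

/-- One factor of the exponential supermartingale: active when the trial takes place and fewer than
`n` trials took place before. -/
noncomputable def trialTerm (V D : ℕ → Set Ω) (n : ℕ) (c p : ℝ) (s : ℕ) (ω : Ω) : ℝ :=
  (V s ∩ {ω | trialCount V s ω < n}).indicator (fun _ => (1 : ℝ)) ω *
    (c * ((D s).indicator (fun _ => (1 : ℝ)) ω - p) - c ^ 2 / 8)

theorem measurable_sum_trialTerm {ℱ : ℕ → MeasurableSpace Ω} (hmono : Monotone ℱ)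
    {V D : ℕ → Set Ω} {T : ℕ} (hV : ∀ s < T, MeasurableSet[ℱ (s + 1)] (V s))
    (hD : ∀ s < T, MeasurableSet[ℱ (s + 1)] (D s)) (n : ℕ) (c p : ℝ) {t : ℕ} (ht : t ≤ T) :
    Measurable[ℱ t] fun ω => ∑ s ∈ Finset.range t, trialTerm V D n c p s ω := by
  refine Finset.measurable_sum _ fun s hs => ?_
  rw [Finset.mem_range] at hs
  have hle : ℱ (s + 1) ≤ ℱ t := hmono hs
  have hc : Measurable[ℱ (s + 1)] (trialCount V s) :=
    (measurable_trialCount hmono hV (by omega)).mono (hmono (Nat.le_succ s)) le_rfl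
  have hset : MeasurableSet[ℱ (s + 1)] (V s ∩ {ω | trialCount V s ω < n}) :=
    (hV s (by omega)).inter (hc (measurableSet_Iio (a := n)))
  refine Measurable.mono ?_ hle le_rfl
  unfold trialTerm
  exact (measurable_const.indicator hset).mul
    (((measurable_const.mul ((measurable_const.indicator (hD s (by omega))).sub
      measurable_const))).sub measurable_const)

theorem trialTerm_le {V D : ℕ → Set Ω} {n : ℕ} {c p : ℝ} (hc : 0 ≤ c) (hp : 0 ≤ p) (s : ℕ)
    (ω : Ω) : trialTerm V D n c p s ω ≤ c := by
  have h0 : (V s ∩ {ω | trialCount V s ω < n}).indicator (fun _ => (1 : ℝ)) ω = 0 ∨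
      (V s ∩ {ω | trialCount V s ω < n}).indicator (fun _ => (1 : ℝ)) ω = 1 :=
    Set.indicator_eq_zero_or_self _ _ _
  have h1 : (D s).indicator (fun _ => (1 : ℝ)) ω = 0 ∨ (D s).indicator (fun _ => (1 : ℝ)) ω = 1 :=
    Set.indicator_eq_zero_or_self _ _ _
  unfold trialTerm
  have := mul_nonneg hc hp
  rcases h0 with h0 | h0 <;> rcases h1 with h1 | h1 <;> rw [h0, h1] <;>
    nlinarith [sq_nonneg c]

/-- A supermartingale argument: an active factor has conditional mean at most one by
`bernoulli_mgf_le`, an inactive one equals one. `𝒢 s` lies between `ℱ s` and `ℱ (s + 1)` and knows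
whether trial `s` takes place; the success law is only required on that event. -/
theorem integral_exp_sum_trialTerm_le {ℱ 𝒢 : ℕ → MeasurableSpace Ω} (hmono : Monotone ℱ)
    {T : ℕ} (hℱ : ∀ t ≤ T, ℱ t ≤ m₀) (h𝒢 : ∀ t < T, ℱ t ≤ 𝒢 t) (h𝒢' : ∀ t < T, 𝒢 t ≤ ℱ (t + 1))
    {V D : ℕ → Set Ω} (hV : ∀ s < T, MeasurableSet[𝒢 s] (V s))
    (hD : ∀ s < T, MeasurableSet[ℱ (s + 1)] (D s)) {p : ℝ} (hp : p ∈ Set.Icc (0 : ℝ) 1)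
    (hlaw : ∀ s < T, ∀ f : Ω → ℝ, Measurable[𝒢 s] f → (∃ b, ∀ ω, |f ω| ≤ b) →
      (∀ ω, ω ∉ V s → f ω = 0) →
      ∫ ω, f ω * (D s).indicator (fun _ => (1 : ℝ)) ω ∂μ = p * ∫ ω, f ω ∂μ)
    (n : ℕ) {c : ℝ} (hc : 0 ≤ c) {t : ℕ} (ht : t ≤ T) :
    ∫ ω, Real.exp (∑ s ∈ Finset.range t, trialTerm V D n c p s ω) ∂μ ≤ 1 := by
  have hV' : ∀ s < T, MeasurableSet[ℱ (s + 1)] (V s) := fun s hs => h𝒢' s hs _ (hV s hs)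
  have hbd : ∀ t ω, ∑ s ∈ Finset.range t, trialTerm V D n c p s ω ≤ t * c := fun t ω => by
    refine (Finset.sum_le_card_nsmul _ _ c fun s _ => trialTerm_le hc hp.1 s ω).trans ?_
    simp
  induction t with
  | zero => simp
  | succ t ih =>
    refine le_trans ?_ (ih (by omega))
    set W : Ω → ℝ := fun ω => Real.exp (∑ s ∈ Finset.range t, trialTerm V D n c p s ω) with hW
    set J : Set Ω := V t ∩ {ω | trialCount V t ω < n} with hJ
    set j : Ω → ℝ := J.indicator fun _ => (1 : ℝ) with hj
    set d : Ω → ℝ := (D t).indicator fun _ => (1 : ℝ) with hd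
    set α := Real.exp (c * (1 - p) - c ^ 2 / 8) with hα
    set β := Real.exp (c * (0 - p) - c ^ 2 / 8) with hβ
    have hWm : Measurable[ℱ t] W :=
      Real.measurable_exp.comp (measurable_sum_trialTerm hmono hV' hD n c p (by omega))
    have hJm : MeasurableSet[𝒢 t] J := (hV t (by omega)).inter
      (h𝒢 t (by omega) _ (measurable_trialCount hmono hV' (by omega) (measurableSet_Iio (a := n))))
    have hjm : Measurable[𝒢 t] j := measurable_const.indicator hJm
    have hWb : ∀ ω, |W ω| ≤ Real.exp (t * c) := fun ω => by
      rw [abs_of_pos (Real.exp_pos _)]; exact Real.exp_le_exp.2 (hbd t ω)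
    have hj01 : ∀ ω, j ω = 0 ∨ j ω = 1 := fun ω => Set.indicator_eq_zero_or_self _ _ _
    have hd01 : ∀ ω, d ω = 0 ∨ d ω = 1 := fun ω => Set.indicator_eq_zero_or_self _ _ _
    have hfm : Measurable[𝒢 t] fun ω => W ω * j ω := (hWm.mono (h𝒢 t (by omega)) le_rfl).mul hjm
    have hfb : ∀ ω, |W ω * j ω| ≤ Real.exp (t * c) := fun ω => by
      rcases hj01 ω with h | h <;> rw [h]
      · simpa using (Real.exp_pos _).le
      · simpa using hWb ω
    have hle : 𝒢 t ≤ m₀ := (h𝒢' t (by omega)).trans (hℱ _ ht)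
    have hWi : Integrable W μ := Integrable.of_bound
      (hWm.mono (hℱ t (by omega)) le_rfl).aestronglyMeasurable _ (Filter.Eventually.of_forall hWb)
    have hfi : Integrable (fun ω => W ω * j ω) μ := Integrable.of_bound
      (hfm.mono hle le_rfl).aestronglyMeasurable _ (Filter.Eventually.of_forall hfb)
    have hdm : Measurable d := measurable_const.indicator (hℱ _ ht _ (hD t (by omega)))
    have hfdi : Integrable (fun ω => W ω * j ω * d ω) μ := by
      refine Integrable.of_bound (((hfm.mono hle le_rfl).mul hdm).aestronglyMeasurable)
        (Real.exp (t * c)) (Filter.Eventually.of_forall fun ω => ?_)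
      rw [Real.norm_eq_abs]
      rcases hd01 ω with h | h <;> rw [h]
      · simpa using (Real.exp_pos _).le
      · simpa using hfb ω
    -- Both indicators take the values `0` and `1` only, so the new exponential factor is affine in
    -- `j` and `j * d`, and the law of `D t` applies to it linearly.
    have e : ∀ ω, Real.exp (∑ s ∈ Finset.range (t + 1), trialTerm V D n c p s ω)
        = W ω + (β - 1) * (W ω * j ω) + (α - β) * (W ω * j ω * d ω) := fun ω => by
      rw [Finset.sum_range_succ, Real.exp_add, trialTerm]
      change W ω * Real.exp (j ω * (c * (d ω - p) - c ^ 2 / 8)) = _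
      rcases hj01 ω with h | h <;> rcases hd01 ω with h' | h' <;> rw [h, h']
      · simp
      · simp
      · rw [one_mul]; ring
      · rw [one_mul]; ring
    simp_rw [e]
    have h0 : ∀ ω, ω ∉ V t → W ω * j ω = 0 := fun ω hω => by
      rw [hj, Set.indicator_of_notMem fun h => hω h.1, mul_zero]
    have hl := hlaw t (by omega) _ hfm ⟨_, hfb⟩ h0
    rw [integral_add (f := fun ω => W ω + (β - 1) * (W ω * j ω)) (hWi.add (hfi.const_mul _))
      (hfdi.const_mul _), integral_add hWi (hfi.const_mul _), integral_const_mul, integral_const_mul, hl]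
    have hpos : 0 ≤ ∫ ω, W ω * j ω ∂μ := integral_nonneg fun ω => by
      rcases hj01 ω with h | h <;> simp [h, hW, (Real.exp_pos _).le]
    have hb := bernoulli_mgf_le hp c
    have : (β - 1) * ∫ ω, W ω * j ω ∂μ + (α - β) * (p * ∫ ω, W ω * j ω ∂μ)
        = (p * α + (1 - p) * β - 1) * ∫ ω, W ω * j ω ∂μ := by ring
    nlinarith

/-- The exponent freezes after the `n`-th trial, so its value at the fixed time `T` records the
state at that random time; no stopping theorem is needed. -/
theorem sum_trialTerm_eq {V D : ℕ → Set Ω} {n : ℕ} {c p : ℝ} {ω : Ω} {t T : ℕ} (ht : t ≤ T)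
    (hn : trialCount V t ω = n) :
    ∑ s ∈ Finset.range T, trialTerm V D n c p s ω
      = c * (successCount V D t ω - n * p) - n * (c ^ 2 / 8) := by
  classical
  have h1 : ∀ u ≤ t, ∑ s ∈ Finset.range u, trialTerm V D n c p s ω
      = c * (successCount V D u ω - trialCount V u ω * p) - trialCount V u ω * (c ^ 2 / 8) := by
    intro u
    induction u with
    | zero => simp [successCount, trialCount]
    | succ u ih =>
      intro hu
      have h2 := trialCount_mono V ω hu
      simp only [hn] at h2
      rw [Finset.sum_range_succ, ih (by omega), successCount, successCount, trialCount_succ V,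
        trialCount_succ (fun s => V s ∩ D s)]
      rw [trialCount_succ] at h2
      unfold trialTerm
      by_cases hV : ω ∈ V u
      · rw [if_pos hV] at h2
        rw [Set.indicator_of_mem (show ω ∈ V u ∩ {ω | trialCount V u ω < n} from
          ⟨hV, show trialCount V u ω < n by omega⟩), if_pos hV]
        by_cases hD : ω ∈ D u
        · rw [Set.indicator_of_mem hD, if_pos (show ω ∈ V u ∩ D u from ⟨hV, hD⟩)]; push_cast; ring
        · rw [Set.indicator_of_notMem hD, if_neg fun h => hD h.2]; push_cast; ring
      · rw [Set.indicator_of_notMem fun h => hV h.1, if_neg hV, if_neg fun h => hV h.1]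
        push_cast; ring
  have h2 : ∀ u, t ≤ u → ∑ s ∈ Finset.range u, trialTerm V D n c p s ω
      = ∑ s ∈ Finset.range t, trialTerm V D n c p s ω := by
    intro u hu
    induction u, hu using Nat.le_induction with
    | base => rfl
    | succ u hu ih =>
      have h3 := trialCount_mono V ω hu
      simp only [hn] at h3
      rw [Finset.sum_range_succ, ih, trialTerm,
        Set.indicator_of_notMem (fun h => absurd h.2 (not_lt.2 h3))]
      ring
  rw [h2 T ht, h1 t le_rfl, hn]

/-- A maximal Hoeffding inequality for the number of successes at the time of the `n`-th trial. -/
theorem measure_trial_deviation_le {ℱ 𝒢 : ℕ → MeasurableSpace Ω} (hmono : Monotone ℱ)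
    {T : ℕ} (hℱ : ∀ t ≤ T, ℱ t ≤ m₀) (h𝒢 : ∀ t < T, ℱ t ≤ 𝒢 t) (h𝒢' : ∀ t < T, 𝒢 t ≤ ℱ (t + 1))
    {V D : ℕ → Set Ω} (hV : ∀ s < T, MeasurableSet[𝒢 s] (V s))
    (hD : ∀ s < T, MeasurableSet[ℱ (s + 1)] (D s)) {p : ℝ} (hp : p ∈ Set.Icc (0 : ℝ) 1)
    (hlaw : ∀ s < T, ∀ f : Ω → ℝ, Measurable[𝒢 s] f → (∃ b, ∀ ω, |f ω| ≤ b) →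
      (∀ ω, ω ∉ V s → f ω = 0) →
      ∫ ω, f ω * (D s).indicator (fun _ => (1 : ℝ)) ω ∂μ = p * ∫ ω, f ω ∂μ)
    (n : ℕ) {ε : ℝ} (hε : 0 ≤ ε) :
    μ.real {ω | ∃ t ≤ T, trialCount V t ω = n ∧ n * (ε / 2) ≤ successCount V D t ω - n * p}
      ≤ Real.exp (-(n * ε ^ 2 / 2)) := by
  have hV' : ∀ s < T, MeasurableSet[ℱ (s + 1)] (V s) := fun s hs => h𝒢' s hs _ (hV s hs)
  -- The parameter `2 * ε` maximises `c * (n * ε / 2) - n * c ^ 2 / 8`, with maximum `n * ε ^ 2 /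
  -- 2`.
  set W : Ω → ℝ := fun ω =>
    Real.exp (∑ s ∈ Finset.range T, trialTerm V D n (2 * ε) p s ω) with hW
  have hWm : Measurable W := Real.measurable_exp.comp
    ((measurable_sum_trialTerm hmono hV' hD n (2 * ε) p le_rfl).mono (hℱ T le_rfl) le_rfl)
  have hWi : Integrable W μ := by
    refine Integrable.of_bound hWm.aestronglyMeasurable (Real.exp (T * (2 * ε)))
      (Filter.Eventually.of_forall fun ω => ?_)
    rw [Real.norm_eq_abs, abs_of_pos (Real.exp_pos _)]
    refine Real.exp_le_exp.2 ((Finset.sum_le_card_nsmul _ _ (2 * ε)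
      fun s _ => trialTerm_le (by positivity) hp.1 s ω).trans ?_)
    simp
  have h1 := integral_exp_sum_trialTerm_le hmono hℱ h𝒢 h𝒢' hV hD hp hlaw n
    (show 0 ≤ 2 * ε by positivity) le_rfl
  have h2 := mul_meas_ge_le_integral_of_nonneg (μ := μ) (f := W)
    (Filter.Eventually.of_forall fun ω => (Real.exp_pos _).le) hWi (Real.exp (n * ε ^ 2 / 2))
  have h3 : μ.real {ω | ∃ t ≤ T, trialCount V t ω = n ∧
      n * (ε / 2) ≤ successCount V D t ω - n * p} ≤ μ.real {ω | Real.exp (n * ε ^ 2 / 2) ≤ W ω} := by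
    refine measureReal_mono ?_
    rintro ω ⟨t, ht, hn, hdev⟩
    simp only [Set.mem_ofPred_eq, hW]
    refine Real.exp_le_exp.2 ?_
    rw [sum_trialTerm_eq ht hn]
    nlinarith
  refine h3.trans ?_
  rw [Real.exp_neg, ← one_div, le_div_iff₀ (Real.exp_pos _), mul_comm]
  exact h2.trans h1

end Trials

/-! ### The σ-algebras of the interaction -/

section Sigma

variable {X A Ω : Type*} {L m : ℕ} (E : ℕ → Ω → Episode X A L m)

theorem episode_le_history {s t : ℕ} (h : s < t) :
    MeasurableSpace.comap (fun ω => (E s ω).state) ⊤ ⊔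
    MeasurableSpace.comap (fun ω => (E s ω).action) ⊤ ⊔
    MeasurableSpace.comap (fun ω => (E s ω).reward) inferInstance ⊔
    MeasurableSpace.comap (fun ω => (E s ω).cost) inferInstance ≤ history E t :=
  le_iSup (fun s : Fin t => MeasurableSpace.comap (fun ω => (E s ω).state) ⊤ ⊔
    MeasurableSpace.comap (fun ω => (E s ω).action) ⊤ ⊔
    MeasurableSpace.comap (fun ω => (E s ω).reward) inferInstance ⊔
    MeasurableSpace.comap (fun ω => (E s ω).cost) inferInstance) ⟨s, h⟩

theorem comap_state_le_history {s t : ℕ} (h : s < t) :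
    MeasurableSpace.comap (fun ω => (E s ω).state) ⊤ ≤ history E t :=
  ((le_sup_left.trans le_sup_left).trans le_sup_left).trans (episode_le_history E h)

theorem comap_action_le_history {s t : ℕ} (h : s < t) :
    MeasurableSpace.comap (fun ω => (E s ω).action) ⊤ ≤ history E t :=
  ((le_sup_right.trans le_sup_left).trans le_sup_left).trans (episode_le_history E h)

theorem comap_reward_le_history {s t : ℕ} (h : s < t) :
    MeasurableSpace.comap (fun ω => (E s ω).reward) inferInstance ≤ history E t :=
  (le_sup_right.trans le_sup_left).trans (episode_le_history E h)

theorem comap_cost_le_history {s t : ℕ} (h : s < t) :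
    MeasurableSpace.comap (fun ω => (E s ω).cost) inferInstance ≤ history E t :=
  le_sup_right.trans (episode_le_history E h)

theorem history_mono : Monotone (history E) := fun _ _ h =>
  iSup_le fun s => episode_le_history E (s.2.trans_le h)

theorem history_le_stateHistory (t : ℕ) (k : Fin L) : history E t ≤ stateHistory E t k :=
  ((le_sup_left.trans le_sup_left).trans (le_sup_left.trans le_sup_left)).trans le_sup_left

theorem stateHistory_le_history_succ (t : ℕ) (k : Fin L) :
    stateHistory E t k ≤ history E (t + 1) := by
  have ht : t < t + 1 := Nat.lt_succ_self t
  have hs : ∀ j, MeasurableSpace.comap (fun ω => (E t ω).state j) ⊤ ≤ history E (t + 1) := by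
    intro j
    refine le_trans ?_ (comap_state_le_history E ht)
    rintro _ ⟨u, -, rfl⟩
    exact ⟨{z | z j ∈ u}, trivial, rfl⟩
  have ha : ∀ j, MeasurableSpace.comap (fun ω => (E t ω).action j) ⊤ ≤ history E (t + 1) := by
    intro j
    refine le_trans ?_ (comap_action_le_history E ht)
    rintro _ ⟨u, -, rfl⟩
    exact ⟨{z | z j ∈ u}, trivial, rfl⟩
  refine sup_le (sup_le (sup_le (sup_le (sup_le (history_mono E ht.le)
    (comap_reward_le_history E ht)) (comap_cost_le_history E ht)) ?_) ?_) (ha k)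
  · exact iSup_le fun j => hs j
  · exact iSup_le fun j => ha j

theorem measurableSet_stateHistory_visit (t : ℕ) (k : Fin L) (x : X) (a : A) :
    MeasurableSet[stateHistory E t k] {ω | (E t ω).state k.castSucc = x ∧ (E t ω).action k = a} := by
  refine MeasurableSet.inter (s₁ := {ω | (E t ω).state k.castSucc = x})
    (s₂ := {ω | (E t ω).action k = a}) ?_ ?_
  · have h : MeasurableSpace.comap (fun ω => (E t ω).state k.castSucc) ⊤ ≤ stateHistory E t k :=
      ((le_iSup (fun j : {j : Fin (L + 1) // j ≤ k.castSucc} =>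
        MeasurableSpace.comap (fun ω => (E t ω).state j) ⊤) ⟨k.castSucc, le_rfl⟩).trans
        (le_sup_right.trans le_sup_left)).trans le_sup_left
    exact h _ ⟨{x}, trivial, rfl⟩
  · have h : MeasurableSpace.comap (fun ω => (E t ω).action k) ⊤ ≤ stateHistory E t k :=
      le_sup_right
    exact h _ ⟨{a}, trivial, rfl⟩

theorem measurableSet_history_state {s t : ℕ} (h : s < t) (k : Fin (L + 1)) (u : Set X) :
    MeasurableSet[history E t] {ω | (E s ω).state k ∈ u} :=
  comap_state_le_history E h _ ⟨{z | z k ∈ u}, trivial, rfl⟩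

end Sigma

/-! ### Measurability, layers and the transition law along the random trajectories. -/

section Interaction

variable {X A Ω : Type*} [Fintype X] [Fintype A] [MeasurableSpace Ω] {μ : Measure Ω}
  [IsProbabilityMeasure μ] {L m T : ℕ} {S : LayeredSpace X L} {P : X → A → X → ℝ}
  {π₀ : X → A → ℝ} {δ C K : ℝ} {E : ℕ → Ω → Episode X A L m}

theorem comap_top_le {Ω β : Type*} [mΩ : MeasurableSpace Ω] [Countable β] {f : Ω → β}
    (h : ∀ z, MeasurableSet {ω | f ω = z}) : MeasurableSpace.comap f ⊤ ≤ mΩ := by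
  rintro _ ⟨u, -, rfl⟩
  have e : f ⁻¹' u = ⋃ z ∈ u, {ω | f ω = z} := by ext ω; simp
  rw [e]
  exact MeasurableSet.biUnion (Set.to_countable u) fun z _ => h z

theorem IsInteraction.history_le (hE : IsInteraction μ S P π₀ T δ C K E) {t : ℕ} (ht : t ≤ T) :
    history E t ≤ ‹MeasurableSpace Ω› := by
  refine iSup_le fun s => ?_
  have hs : (s : ℕ) < T := s.2.trans_le ht
  exact sup_le (sup_le (sup_le (comap_top_le (hE.measurable_state s hs))
    (comap_top_le (hE.measurable_action s hs))) (hE.measurable_reward s hs).comap_le)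
    (hE.measurable_cost s hs).comap_le

theorem IsInteraction.stateHistory_le (hE : IsInteraction μ S P π₀ T δ C K E) {t : ℕ} (ht : t < T)
    (k : Fin L) : stateHistory E t k ≤ ‹MeasurableSpace Ω› :=
  (stateHistory_le_history_succ E t k).trans (hE.history_le ht)

theorem IsInteraction.measurableSet_state (hE : IsInteraction μ S P π₀ T δ C K E) {t : ℕ}
    (ht : t < T) (k : Fin (L + 1)) (u : Set X) : MeasurableSet {ω | (E t ω).state k ∈ u} :=
  hE.history_le ht _ (measurableSet_history_state E (Nat.lt_succ_self t) k u)

/-- Almost surely, the `k`-th state of every episode lies in layer `k`. -/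
theorem IsInteraction.ae_layer (hE : IsInteraction μ S P π₀ T δ C K E) (hP : IsTransition S P) :
    ∀ᵐ ω ∂μ, ∀ t < T, ∀ k : Fin (L + 1), S.layer ((E t ω).state k) = k := by
  refine ae_all_iff.2 fun t => ?_
  by_cases ht : t < T
  swap
  · exact Filter.Eventually.of_forall fun ω h => absurd h ht
  suffices h : ∀ k : ℕ, ∀ hk : k < L + 1, ∀ᵐ ω ∂μ, S.layer ((E t ω).state ⟨k, hk⟩) = k by
    filter_upwards [ae_all_iff.2 fun k : Fin (L + 1) => h k k.2] with ω hω _ k using hω k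
  intro k
  induction k with
  | zero =>
    intro _
    exact Filter.Eventually.of_forall fun ω => (S.layer_eq_zero_iff _).2 (hE.start t ht ω)
  | succ k ih =>
    intro hk
    have hkL : k < L := by omega
    have hy : ∀ y : X, S.layer y ≠ k + 1 →
        ∀ᵐ ω ∂μ, (E t ω).state ⟨k + 1, hk⟩ ≠ y := by
      intro y hy
      have hs : MeasurableSet {ω | (E t ω).state (Fin.succ ⟨k, hkL⟩) = y} :=
        hE.measurableSet_state ht (Fin.succ ⟨k, hkL⟩) {y}
      -- The probability of reaching `y` is the integral of the transition probability to `y`, which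
      -- vanishes when the previous state is in layer `k`.
      have h1 := integral_mul_indicator_eq (hE.stateHistory_le ht ⟨k, hkL⟩) (f := fun _ => 1)
        measurable_const (b := 1) (by simp) hs (hE.state_law t ht ⟨k, hkL⟩ y)
      have h2 : ∫ ω, (1 : ℝ) * P ((E t ω).state (Fin.castSucc ⟨k, hkL⟩))
          ((E t ω).action ⟨k, hkL⟩) y ∂μ = 0 := by
        refine integral_eq_zero_of_ae ?_
        filter_upwards [ih (by omega)] with ω hω
        have hω' : S.layer ((E t ω).state (Fin.castSucc ⟨k, hkL⟩)) = k := hω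
        rw [hP.eq_zero (by rw [hω']; exact hy)]
        simp
      rw [h2] at h1
      simp only [one_mul] at h1
      rw [integral_indicator hs, integral_const, smul_eq_mul, mul_one,
        measureReal_restrict_apply_univ, measureReal_eq_zero_iff] at h1
      exact measure_eq_zero_iff_ae_notMem.1 h1
    have hy' : ∀ᵐ ω ∂μ, ∀ y : X, S.layer y ≠ k + 1 → (E t ω).state ⟨k + 1, hk⟩ ≠ y := by
      refine ae_all_iff.2 fun y => ?_
      by_cases h : S.layer y ≠ k + 1
      · filter_upwards [hy y h] with ω hω _ using hω
      · exact Filter.Eventually.of_forall fun ω h' => absurd h' h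
    filter_upwards [hy'] with ω hω
    by_contra hne
    exact hω _ hne rfl

/-- The conditional law of the next state, tested against functions supported on visits of
`(x, a)`. -/
theorem IsInteraction.integral_next_state (hE : IsInteraction μ S P π₀ T δ C K E) {t : ℕ}
    (ht : t < T) (k : Fin L) (x : X) (a : A) (B : Finset X) {f : Ω → ℝ}
    (hf : Measurable[stateHistory E t k] f) (hb : ∃ b, ∀ ω, |f ω| ≤ b)
    (h0 : ∀ ω, ω ∉ {ω | (E t ω).state k.castSucc = x ∧ (E t ω).action k = a} → f ω = 0) :
    ∫ ω, f ω * ({ω | (E t ω).state k.succ ∈ B} : Set Ω).indicator (fun _ => (1 : ℝ)) ω ∂μ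
      = (∑ y ∈ B, P x a y) * ∫ ω, f ω ∂μ := by
  classical
  obtain ⟨b, hb⟩ := hb
  have hfi : Integrable f μ := Integrable.of_bound
    (hf.mono (hE.stateHistory_le ht k) le_rfl).aestronglyMeasurable b
    (Filter.Eventually.of_forall hb)
  have hs : ∀ y, MeasurableSet {ω | (E t ω).state k.succ = y} := fun y =>
    hE.measurableSet_state ht k.succ {y}
  have hy : ∀ y, ∫ ω, f ω * ({ω | (E t ω).state k.succ = y} : Set Ω).indicator
      (fun _ => (1 : ℝ)) ω ∂μ = P x a y * ∫ ω, f ω ∂μ := by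
    intro y
    rw [integral_mul_indicator_eq (hE.stateHistory_le ht k) hf hb (hs y) (hE.state_law t ht k y),
      ← integral_const_mul]
    refine integral_congr_ae (Filter.Eventually.of_forall fun ω => ?_)
    by_cases hω : (E t ω).state k.castSucc = x ∧ (E t ω).action k = a
    · simp only [hω.1, hω.2, mul_comm]
    · simp only [h0 ω hω, zero_mul, mul_zero]
  have e : ∀ ω, f ω * ({ω | (E t ω).state k.succ ∈ B} : Set Ω).indicator (fun _ => (1 : ℝ)) ω
      = ∑ y ∈ B, f ω * ({ω | (E t ω).state k.succ = y} : Set Ω).indicator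
        (fun _ => (1 : ℝ)) ω := by
    intro ω
    rw [← Finset.mul_sum]
    congr 1
    simp only [Set.indicator_apply, Set.mem_ofPred_eq, Finset.sum_ite_eq]
  simp_rw [e]
  rw [integral_finsetSum]
  · rw [Finset.sum_mul]
    exact Finset.sum_congr rfl fun y _ => hy y
  · intro y _
    have : (fun ω => f ω * ({ω | (E t ω).state k.succ = y} : Set Ω).indicator
        (fun _ => (1 : ℝ)) ω) = ({ω | (E t ω).state k.succ = y} : Set Ω).indicator f := by
      funext ω
      simp [Set.indicator_apply]
    rw [this]
    exact hfi.indicator (hs y)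

end Interaction

/-! ### The counters -/

section Counters

variable {X A Ω : Type*} [Fintype X] [Fintype A] {L m T : ℕ} {S : LayeredSpace X L}
  {δ C K : ℝ} {E : ℕ → Ω → Episode X A L m}

open Classical in
theorem Counters.update_N (c : Counters X A) (e : Episode X A L m) (x : X) (a : A) :
    (c.update e).N x a
      = c.N x a + Fintype.card {k : Fin L // e.state k.castSucc = x ∧ e.action k = a} := by
  simp only [Counters.update]
  split_ifs <;> rfl

open Classical in
theorem Counters.update_M (c : Counters X A) (e : Episode X A L m) (x : X) (a : A) (x' : X) :
    (c.update e).M x a x' = c.M x a x' + Fintype.card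
      {k : Fin L // e.state k.castSucc = x ∧ e.action k = a ∧ e.state k.succ = x'} := by
  simp only [Counters.update]
  split_ifs <;> rfl

/-- Counters at the start of an epoch are running counters at an earlier time. Accuracy of the
running counters at all times is therefore enough, whatever the rule for starting epochs. -/
theorem counters_start (e : ℕ → Episode X A L m) (t : ℕ) :
    ∃ s ≤ t, (pdgdOps S T δ C K e t).counters.N0 = (pdgdOps S T δ C K e s).counters.N ∧
      (pdgdOps S T δ C K e t).counters.M0 = (pdgdOps S T δ C K e s).counters.M := by
  induction t with
  | zero => exact ⟨0, le_rfl, rfl, rfl⟩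
  | succ t ih =>
    obtain ⟨s, hs, h1, h2⟩ := ih
    by_cases h : ∃ k : Fin L, max 1 (2 * (pdgdOps S T δ C K e t).counters.N0
        ((e t).state k.castSucc) ((e t).action k)) ≤ ((pdgdOps S T δ C K e t).counters.update
          (e t)).N ((e t).state k.castSucc) ((e t).action k)
    · refine ⟨t + 1, le_rfl, ?_⟩
      simp only [Counters.update_N] at h
      simp only [pdgdOps, AlgState.update, Counters.update]
      rw [if_pos h]
      exact ⟨rfl, rfl⟩
    · refine ⟨s, hs.trans (Nat.le_succ t), ?_⟩
      simp only [Counters.update_N] at h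
      simp only [pdgdOps, AlgState.update, Counters.update] at h1 h2 ⊢
      rw [if_neg h]
      exact ⟨h1, h2⟩

theorem card_subtype_eq_ite {L : ℕ} (k : Fin L) (p : Fin L → Prop) (hp : ∀ j, p j → j = k)
    [Fintype {j // p j}] [Decidable (p k)] : Fintype.card {j // p j} = if p k then 1 else 0 := by
  classical
  split_ifs with h
  · rw [Fintype.card_eq_one_iff]
    exact ⟨⟨k, h⟩, fun j => Subtype.ext (hp j j.2)⟩
  · rw [Fintype.card_eq_zero_iff]
    exact ⟨fun j => h (hp j j.2 ▸ j.2)⟩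

/-- A layered trajectory can visit `x` only at step `layer x`, so each episode is at most one trial
for `(x, a)`. -/
theorem counters_N_eq {ω : Ω} {t : ℕ}
    (hlay : ∀ s < t, ∀ k : Fin (L + 1), S.layer ((E s ω).state k) = k) (k : Fin L) {x : X}
    (hx : S.layer x = k) (a : A) :
    (pdgdOps S T δ C K (fun s => E s ω) t).counters.N x a
      = trialCount (fun s => {ω | (E s ω).state k.castSucc = x ∧ (E s ω).action k = a}) t ω := by
  classical
  induction t with
  | zero => simp [pdgdOps, initState, trialCount]
  | succ t ih =>
    simp only [pdgdOps, AlgState.update]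
    rw [Counters.update_N, ih fun s hs => hlay s (by omega), trialCount_succ]
    congr 1
    refine card_subtype_eq_ite k _ fun j hj => ?_
    have := hlay t (Nat.lt_succ_self t) j.castSucc
    rw [hj.1, hx] at this
    exact Fin.ext this.symm

theorem counters_M_eq {ω : Ω} {t : ℕ}
    (hlay : ∀ s < t, ∀ k : Fin (L + 1), S.layer ((E s ω).state k) = k) (k : Fin L) {x : X}
    (hx : S.layer x = k) (a : A) (x' : X) :
    (pdgdOps S T δ C K (fun s => E s ω) t).counters.M x a x'
      = successCount (fun s => {ω | (E s ω).state k.castSucc = x ∧ (E s ω).action k = a})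
        (fun s => {ω | (E s ω).state k.succ = x'}) t ω := by
  classical
  induction t with
  | zero => simp [pdgdOps, initState, trialCount, successCount]
  | succ t ih =>
    simp only [pdgdOps, AlgState.update]
    rw [Counters.update_M, ih fun s hs => hlay s (by omega), successCount, successCount,
      trialCount_succ]
    congr 1
    rw [card_subtype_eq_ite k _ fun j hj => ?_]
    · exact if_congr and_assoc.symm rfl rfl
    have := hlay t (Nat.lt_succ_self t) j.castSucc
    rw [hj.1, hx] at this
    exact Fin.ext this.symm

theorem sum_successCount (V : ℕ → Set Ω) (Y : ℕ → Ω → X) (B : Finset X) (t : ℕ) (ω : Ω) :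
    ∑ y ∈ B, successCount V (fun s => {ω | Y s ω = y}) t ω
      = successCount V (fun s => {ω | Y s ω ∈ B}) t ω := by
  classical
  induction t with
  | zero => simp [successCount, trialCount]
  | succ t ih =>
    simp only [successCount] at ih ⊢
    rw [trialCount_succ, ← ih]
    simp_rw [trialCount_succ]
    rw [Finset.sum_add_distrib]
    congr 1
    by_cases hV : ω ∈ V t
    · simp only [Set.mem_inter_iff, hV, true_and, Set.mem_ofPred_eq, Finset.sum_ite_eq]
    · simp [hV]

theorem mem_confSet_of_forall {P : X → A → X → ℝ} (hP : IsTransition S P) {e : ℕ → Episode X A L m}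
    (h : ∀ t ≤ T, ∀ x a, ∑ x', |P x a x' - (pdgdOps S T δ C K e t).counters.M x a x' /
        max 1 ((pdgdOps S T δ C K e t).counters.N x a : ℝ)| ≤
      √(2 * (S.layerSet (S.layer x + 1)).ncard
        * Real.log (T * Fintype.card X * Fintype.card A / δ) /
          max 1 ((pdgdOps S T δ C K e t).counters.N x a : ℝ))) :
    ∀ t ≤ T, P ∈ (pdgdOps S T δ C K e t).counters.confSet S T δ := by
  intro t ht
  obtain ⟨s, hs, h1, h2⟩ := counters_start (S := S) (T := T) (δ := δ) (C := C) (K := K) e t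
  refine ⟨hP, fun _ x a => ?_⟩
  simp only [Counters.empirical, Counters.radius, h1, h2]
  exact h s (hs.trans ht) x a

end Counters

/-! ### The confidence sets contain the true transition function. -/

section Confidence

/-- Half of the 1-norm of a vector with zero sum is the sum of its positive part. -/
theorem sum_abs_eq_two_mul {X : Type*} [Fintype X] {d : X → ℝ} (h : ∑ x, d x = 0) :
    ∑ x, |d x| = 2 * ∑ x with 0 < d x, d x := by
  have e : ∀ x, |d x| = 2 * (if 0 < d x then d x else 0) - d x := fun x => by
    split_ifs with hx
    · rw [abs_of_pos hx]; ring
    · rw [abs_of_nonpos (not_lt.1 hx)]; ring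
  rw [Finset.sum_congr rfl fun x _ => e x, Finset.sum_sub_distrib, h, sub_zero, ← Finset.mul_sum,
    Finset.sum_filter]

open Classical in
/-- The proper nonempty subsets of a finite set. -/
noncomputable def properSubsets {X : Type*} (F : Finset X) : Finset (Finset X) :=
  F.powerset.filter fun B => B.Nonempty ∧ ∃ x ∈ F, x ∉ B

theorem mem_properSubsets {X : Type*} {F B : Finset X} :
    B ∈ properSubsets F ↔ B ⊆ F ∧ B.Nonempty ∧ ∃ x ∈ F, x ∉ B := by
  simp [properSubsets]

/-- There are none if `F` has at most one point, and otherwise `2 ^ s ≤ 4 ^ (s - 1) ≤ D ^ (s - 1)`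
with `s = F.card`. The gained factor `1 / D` pays for the remaining unions. -/
theorem card_properSubsets_le {X : Type*} (F : Finset X) {D : ℝ} (hD : 0 < D)
    (h : 2 ≤ F.card → 4 ≤ D) : ((properSubsets F).card : ℝ) ≤ D ^ F.card * (1 / D) := by
  classical
  rcases Nat.lt_or_ge F.card 2 with h2 | h2
  · have : properSubsets F = ∅ := by
      refine Finset.eq_empty_of_forall_notMem fun B hB => ?_
      obtain ⟨hBF, ⟨y, hy⟩, x, hx, hxB⟩ := mem_properSubsets.1 hB
      have : x = y := Finset.card_le_one.1 (by omega) x hx y (hBF hy)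
      exact hxB (this ▸ hy)
    rw [this]
    simp only [Finset.card_empty, Nat.cast_zero]
    positivity
  · have h4 := h h2
    obtain ⟨n, hn⟩ : ∃ n, F.card = n + 2 := ⟨F.card - 2, by omega⟩
    have h1 : (properSubsets F).card ≤ 2 ^ F.card :=
      (Finset.card_filter_le _ _).trans (Finset.card_powerset F).le
    calc ((properSubsets F).card : ℝ) ≤ 2 ^ (n + 2) := by rw [← hn]; exact_mod_cast h1
      _ ≤ 4 ^ (n + 1) := by
          have : (2 : ℝ) ^ n ≤ 4 ^ n := pow_le_pow_left₀ (by norm_num) (by norm_num) n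
          rw [pow_add, pow_add]; linarith
      _ ≤ D ^ (n + 1) := pow_le_pow_left₀ (by norm_num) h4 _
      _ = D ^ F.card * (1 / D) := by rw [hn]; field_simp; ring

variable {X A Ω : Type*} [Fintype X] [Fintype A] [MeasurableSpace Ω] {μ : Measure Ω}
  [IsProbabilityMeasure μ] {L m T : ℕ} {S : LayeredSpace X L} {P : X → A → X → ℝ}
  {π₀ : X → A → ℝ} {δ C K : ℝ} {E : ℕ → Ω → Episode X A L m}

/-- A layer with two points is neither the first nor the last, so source and sink are two further
states. -/
theorem four_le_card_of_layer {k : ℕ}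
    (h : 2 ≤ (S.layerSet k).ncard) : 4 ≤ Fintype.card X := by
  obtain ⟨x, hx, y, hy, hxy⟩ := (Set.one_lt_ncard (Set.toFinite _)).1 h
  have hx' : S.layer x = k := hx
  have hy' : S.layer y = k := hy
  have h0 : k ≠ 0 := fun h0 =>
    hxy (((S.layer_eq_zero_iff x).1 (hx'.trans h0)).trans
      ((S.layer_eq_zero_iff y).1 (hy'.trans h0)).symm)
  have hkL : k ≠ L := fun h0 =>
    hxy (((S.layer_eq_last_iff x).1 (hx'.trans h0)).trans
      ((S.layer_eq_last_iff y).1 (hy'.trans h0)).symm)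
  have hs : S.layer S.source = 0 := (S.layer_eq_zero_iff _).2 rfl
  have he : S.layer S.sink = L := (S.layer_eq_last_iff _).2 rfl
  have hL0 : L ≠ 0 := by have := S.layer_le x; omega
  classical
  have hcard : ({S.source, x, y, S.sink} : Finset X).card = 4 := by
    have n1 : S.source ≠ x := fun h => h0 (by rw [← hx', ← h, hs])
    have n2 : S.source ≠ y := fun h => h0 (by rw [← hy', ← h, hs])
    have n3 : S.source ≠ S.sink := fun h => hL0 (by rw [← he, ← h, hs])
    have n4 : x ≠ S.sink := fun h => hkL (by rw [← hx', h, he])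
    have n5 : y ≠ S.sink := fun h => hkL (by rw [← hy', h, he])
    rw [Finset.card_insert_of_notMem (by simp [n1, n2, n3]),
      Finset.card_insert_of_notMem (by simp [hxy, n4]),
      Finset.card_insert_of_notMem (by simp [n5]), Finset.card_singleton]
  rw [← hcard]
  exact Finset.card_le_univ _

/-- The empirical transition probabilities of one pair `(x, a)` are within the confidence radius
at all times, outside of an event of small probability. -/
theorem IsInteraction.exists_bad_event [Nonempty A] (hE : IsInteraction μ S P π₀ T δ C K E)
    (hP : IsTransition S P) (hL : 0 < L) (hT : 0 < T) (hδ : δ ∈ Set.Ioo (0 : ℝ) 1) (x : X) (a : A) :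
    ∃ F : Set Ω, μ.real F ≤ δ / (Fintype.card X * Fintype.card A) ∧ ∀ ω ∉ F,
      (∀ t < T, ∀ k : Fin (L + 1), S.layer ((E t ω).state k) = k) → ∀ t ≤ T,
      ∑ x', |P x a x' - (pdgdOps S T δ C K (fun s => E s ω) t).counters.M x a x' /
        max 1 ((pdgdOps S T δ C K (fun s => E s ω) t).counters.N x a : ℝ)| ≤
      √(2 * (S.layerSet (S.layer x + 1)).ncard
        * Real.log (T * Fintype.card X * Fintype.card A / δ) /
          max 1 ((pdgdOps S T δ C K (fun s => E s ω) t).counters.N x a : ℝ)) := by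
  classical
  have hcX : 2 ≤ Fintype.card X := by have := lt_card hP; omega
  have hcX' : (2 : ℝ) ≤ Fintype.card X := by exact_mod_cast hcX
  have hcA : (1 : ℝ) ≤ Fintype.card A := by exact_mod_cast Fintype.card_pos (α := A)
  have hT1 : (1 : ℝ) ≤ T := by exact_mod_cast hT
  obtain ⟨hδ0, hδ1⟩ := hδ
  by_cases hxL : S.layer x < L
  swap
  -- In the last layer nothing is ever counted and the row of `P` is zero.
  · refine ⟨∅, by simp; positivity, fun ω _ hlay t ht => ?_⟩
    have hM : ∀ x', (pdgdOps S T δ C K (fun s => E s ω) t).counters.M x a x' = 0 := by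
      intro x'
      induction t with
      | zero => rfl
      | succ t ih =>
        simp only [pdgdOps, AlgState.update]
        rw [Counters.update_M, ih (by omega), zero_add, Fintype.card_eq_zero_iff]
        refine ⟨fun j => hxL ?_⟩
        have h1 := hlay t (by omega) j.1.castSucc
        rw [j.2.1] at h1
        rw [h1]
        exact j.1.2
    simp only [hM, hP.eq_zero_of_last a _ hxL, Nat.cast_zero, zero_div, sub_zero, abs_zero,
      Finset.sum_const_zero]
    exact Real.sqrt_nonneg _
  set D : ℝ := T * Fintype.card X * Fintype.card A / δ with hD
  have hTXA : (Fintype.card X : ℝ) ≤ T * Fintype.card X * Fintype.card A := by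
    have h1 : (Fintype.card X : ℝ) ≤ T * Fintype.card X := le_mul_of_one_le_left (by positivity) hT1
    exact h1.trans (le_mul_of_one_le_right (by positivity) hcA)
  have hXD : (Fintype.card X : ℝ) ≤ D := hTXA.trans (le_div_self (by positivity) hδ0 hδ1.le)
  have hD0 : 0 < D := by linarith
  set F' : Finset X := Finset.univ.filter fun y => S.layer y = S.layer x + 1 with hF'
  have hcard : (S.layerSet (S.layer x + 1)).ncard = F'.card := by
    rw [← Set.ncard_coe_finset]; congr 1; ext y; simp [hF', LayeredSpace.layerSet]
  set s := F'.card with hs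
  have hs1 : 1 ≤ s := by
    obtain ⟨y, hy⟩ := exists_layer_eq (S := S) hP (k := S.layer x + 1) hxL
    exact Finset.card_pos.2 ⟨y, by simp [hF', hy]⟩
  have hs1' : (1 : ℝ) ≤ s := by exact_mod_cast hs1
  have hlogD : 1 / 2 ≤ Real.log D := by
    have h1 : Real.log 2 ≤ Real.log D := Real.log_le_log (by norm_num) (hcX'.trans hXD)
    linarith [Real.log_two_gt_d9]
  set k : Fin L := ⟨S.layer x, hxL⟩ with hk
  set V : ℕ → Set Ω := fun t => {ω | (E t ω).state k.castSucc = x ∧ (E t ω).action k = a} with hV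
  -- Chosen so that the Hoeffding bound `exp (-n ε² / 2)` equals `D ^ (-s)`. Fewer than `D ^ (s -
  -- 1)` sets `B` would not suffice for the count; at most that many do, leaving `1 / D` for each
  -- `n` and `T / D` in total.
  set eps : ℕ → ℝ := fun n => √(2 * s * Real.log D / n) with heps
  set bad : ℕ → Finset X → Set Ω := fun n B =>
    {ω | ∃ t ≤ T, trialCount V t ω = n ∧ n * (eps n / 2) ≤
      successCount V (fun t => {ω | (E t ω).state k.succ ∈ B}) t ω - n * ∑ y ∈ B, P x a y} with hbad
  have hbadle : ∀ n ∈ Finset.Icc 1 T, ∀ B, μ.real (bad n B) ≤ (D ^ s)⁻¹ := by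
    intro n hn B
    rw [Finset.mem_Icc] at hn
    have hn0 : (0 : ℝ) < n := by exact_mod_cast hn.1
    have h := measure_trial_deviation_le (μ := μ) (ℱ := history E)
      (𝒢 := fun t => stateHistory E t k) (history_mono E) (T := T) (fun t ht => hE.history_le ht)
      (fun t _ => history_le_stateHistory E t k) (fun t _ => stateHistory_le_history_succ E t k)
      (V := V) (D := fun t => {ω | (E t ω).state k.succ ∈ B})
      (fun t _ => measurableSet_stateHistory_visit E t k x a)
      (fun t _ => measurableSet_history_state E (Nat.lt_succ_self t) k.succ (B : Set X))
      (p := ∑ y ∈ B, P x a y)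
      ⟨Finset.sum_nonneg fun y _ => hP.nonneg x a y,
        (Finset.sum_le_univ_sum_of_nonneg fun y => hP.nonneg x a y).trans (hP.sum_le_one x a)⟩
      (fun t ht f hf hb h0 => hE.integral_next_state ht k x a B hf hb h0) n
      (Real.sqrt_nonneg (2 * s * Real.log D / n))
    refine h.trans (le_of_eq ?_)
    rw [Real.sq_sqrt (by positivity)]
    have e1 : (n : ℝ) * (2 * s * Real.log D / n) / 2 = s * Real.log D := by field_simp
    rw [e1, Real.exp_neg, ← Real.log_pow, Real.exp_log (by positivity)]
  refine ⟨⋃ n ∈ Finset.Icc 1 T, ⋃ B ∈ properSubsets F', bad n B, ?_, ?_⟩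
  · calc μ.real (⋃ n ∈ Finset.Icc 1 T, ⋃ B ∈ properSubsets F', bad n B)
        ≤ ∑ n ∈ Finset.Icc 1 T, ∑ B ∈ properSubsets F', μ.real (bad n B) :=
          (measureReal_biUnion_finset_le _ _).trans
            (Finset.sum_le_sum fun n _ => measureReal_biUnion_finset_le _ _)
      _ ≤ ∑ n ∈ Finset.Icc 1 T, 1 / D := by
          refine Finset.sum_le_sum fun n hn => ?_
          refine (Finset.sum_le_sum fun B _ => hbadle n hn B).trans ?_
          rw [Finset.sum_const, nsmul_eq_mul, ← div_eq_mul_inv, div_le_iff₀ (by positivity),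
            mul_comm]
          refine card_properSubsets_le F' hD0 fun h2 => le_trans ?_ hXD
          rw [← hs, ← hcard] at h2
          exact_mod_cast four_le_card_of_layer h2
      _ = δ / (Fintype.card X * Fintype.card A) := by
          rw [Finset.sum_const, nsmul_eq_mul, Nat.card_Icc, hD]
          simp only [add_tsub_cancel_right]
          field_simp
  · intro ω hω hlay t ht
    have hlay' : ∀ s < t, ∀ k : Fin (L + 1), S.layer ((E s ω).state k) = k :=
      fun s hs => hlay s (by omega)
    rw [counters_N_eq hlay' k rfl a]
    simp_rw [counters_M_eq hlay' k (rfl : S.layer x = k) a]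
    rw [hcard]
    set n := trialCount V t ω with hn
    set M : X → ℕ := fun y => successCount V (fun s => {ω | (E s ω).state k.succ = y}) t ω with hM
    have hMsum : ∀ B : Finset X, ∑ y ∈ B, M y
        = successCount V (fun s => {ω | (E s ω).state k.succ ∈ B}) t ω := fun B =>
      sum_successCount V (fun s ω => (E s ω).state k.succ) B t ω
    have hMtot : ∑ y, M y = n := by
      rw [hMsum]; simp [successCount, hn]
    have hM0 : ∀ y, S.layer y ≠ S.layer x + 1 → M y = 0 := by
      intro y hy
      simp only [hM, successCount, trialCount]
      rw [Finset.card_eq_zero, Finset.filter_eq_empty_iff]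
      rintro r hr ⟨-, h⟩
      have h1 := hlay' r (Finset.mem_range.1 hr) k.succ
      have h2 : (E r ω).state k.succ = y := h
      rw [h2] at h1
      exact hy h1
    -- Without visits the empirical row is zero, at distance one from `P`; the radius is at least
    -- one because `s ≥ 1` and `log D ≥ 1 / 2`.
    rcases Nat.eq_zero_or_pos n with h0 | hpos
    · have hMz : ∀ y, M y = 0 := fun y => by
        have := Finset.single_le_sum (f := M) (fun y _ => Nat.zero_le _) (Finset.mem_univ y)
        omega
      have e1 : ∑ x', |P x a x' - (M x' : ℝ) / max 1 (n : ℝ)| = 1 := by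
        rw [← hP.sum_eq_one x a hxL]
        refine Finset.sum_congr rfl fun y _ => ?_
        rw [hMz]; simp [abs_of_nonneg (hP.nonneg x a y)]
      refine e1.le.trans ?_
      rw [h0]
      simp only [Nat.cast_zero, zero_le_one, sup_of_le_left, div_one]
      rw [Real.one_le_sqrt]
      nlinarith
    · have hn1 : (1 : ℝ) ≤ n := by exact_mod_cast hpos
      have hn0 : (0 : ℝ) < n := by linarith
      rw [max_eq_right hn1]
      by_contra! hgt
      set d : X → ℝ := fun y => (M y : ℝ) / n - P x a y with hd
      have hdsum : ∑ y, d y = 0 := by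
        simp only [hd]
        rw [Finset.sum_sub_distrib, hP.sum_eq_one x a hxL, ← Finset.sum_div, ← Nat.cast_sum, hMtot,
          div_self hn0.ne', sub_self]
      have habs : ∑ x', |P x a x' - (M x' : ℝ) / n| = ∑ y, |d y| :=
        Finset.sum_congr rfl fun y _ => abs_sub_comm _ _
      -- The set that witnesses half of the 1-norm. It is a proper nonempty subset of the next
      -- layer, since over the empty set and over the whole layer the deviations sum to zero.
      set B : Finset X := Finset.univ.filter fun y => 0 < d y with hB
      have hdB : ∑ y, |d y| = 2 * ∑ y ∈ B, d y := sum_abs_eq_two_mul hdsum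
      have hgt' : eps n < 2 * ∑ y ∈ B, d y := by
        rw [← hdB, ← habs]; exact hgt
      have heps0 : 0 ≤ eps n := Real.sqrt_nonneg _
      have hd0 : ∀ y ∉ F', d y = 0 := fun y hy => by
        have hy' : S.layer y ≠ S.layer x + 1 := by simpa [hF'] using hy
        simp only [hd]
        rw [hM0 y hy', hP.eq_zero hy']; simp
      have hBF : B ⊆ F' := fun y hy => by
        by_contra h
        have : 0 < d y := by simpa [hB] using hy
        rw [hd0 y h] at this
        exact lt_irrefl _ this
      have hBmem : B ∈ properSubsets F' := by
        refine mem_properSubsets.2 ⟨hBF, ?_, ?_⟩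
        · by_contra h
          rw [Finset.not_nonempty_iff_eq_empty] at h
          rw [h, Finset.sum_empty] at hgt'
          linarith
        · by_contra! h
          have hBe : B = F' := Finset.Subset.antisymm hBF h
          have : ∑ y ∈ B, d y = ∑ y, d y := by
            rw [hBe]
            exact Finset.sum_subset (Finset.subset_univ _) fun y _ hy => hd0 y hy
          rw [this, hdsum] at hgt'
          linarith
      have hnT : n ≤ T := (trialCount_le V t ω).trans ht
      apply hω
      refine Set.mem_biUnion (Finset.mem_Icc.2 ⟨hpos, hnT⟩) (Set.mem_biUnion hBmem ?_)
      refine ⟨t, ht, rfl, ?_⟩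
      rw [← hMsum B]
      have e1 : ∑ y ∈ B, d y = (∑ y ∈ B, M y : ℕ) / (n : ℝ) - ∑ y ∈ B, P x a y := by
        simp only [hd]
        rw [Finset.sum_sub_distrib, ← Finset.sum_div, Nat.cast_sum]
      rw [e1] at hgt'
      have h3 : (n : ℝ) * (eps n / 2) ≤ n * ((∑ y ∈ B, M y : ℕ) / (n : ℝ) - ∑ y ∈ B, P x a y) :=
        mul_le_mul_of_nonneg_left (by linarith) hn0.le
      rw [mul_sub, mul_div_cancel₀ _ hn0.ne'] at h3
      exact h3

/-- With probability at least `1 - δ`, the confidence sets always contain the true transition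
function. -/
theorem IsInteraction.exists_clean_event [Nonempty A] (hE : IsInteraction μ S P π₀ T δ C K E)
    (hP : IsTransition S P) (hL : 0 < L) (hT : 0 < T) (hδ : δ ∈ Set.Ioo (0 : ℝ) 1) :
    ∃ F : Set Ω, μ.real F ≤ δ ∧ ∀ ω ∉ F, ∀ t ≤ T,
      P ∈ (pdgdOps S T δ C K (fun s => E s ω) t).counters.confSet S T δ := by
  choose F hF hgood using fun p : X × A => hE.exists_bad_event hP hL hT hδ p.1 p.2
  set Z : Set Ω := {ω | ¬ ∀ t < T, ∀ k : Fin (L + 1), S.layer ((E t ω).state k) = k} with hZ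
  have hZ0 : μ.real Z = 0 := by
    rw [measureReal_eq_zero_iff]; exact ae_iff.1 (hE.ae_layer hP)
  refine ⟨Z ∪ ⋃ p ∈ (Finset.univ : Finset (X × A)), F p, ?_, fun ω hω => ?_⟩
  · have h1 := measureReal_union_le (μ := μ) Z (⋃ p ∈ (Finset.univ : Finset (X × A)), F p)
    have h2 := measureReal_biUnion_finset_le (μ := μ) (Finset.univ : Finset (X × A)) F
    have h3 : ∑ p : X × A, μ.real (F p) ≤ δ := by
      refine (Finset.sum_le_sum fun p _ => hF p).trans (le_of_eq ?_)
      have hX : (Fintype.card X : ℝ) ≠ 0 := by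
        have := lt_card hP
        exact_mod_cast (by omega : Fintype.card X ≠ 0)
      have hA : (Fintype.card A : ℝ) ≠ 0 := by
        have := Fintype.card_pos (α := A); positivity
      rw [Finset.sum_const, nsmul_eq_mul, Finset.card_univ, Fintype.card_prod]
      push_cast
      field_simp
    linarith
  · have hl : ∀ t < T, ∀ k : Fin (L + 1), S.layer ((E t ω).state k) = k := by
      by_contra h; exact hω (Or.inl h)
    refine mem_confSet_of_forall hP fun t ht x a => hgood (x, a) ω (fun h => hω (Or.inr ?_)) hl t ht
    exact Set.mem_biUnion (Finset.mem_univ (x, a)) h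

end Confidence

/-! ### Measurability of the state of the algorithm -/

section Measurability

variable {X A Ω : Type*} [Fintype X] [Fintype A] {L m : ℕ}

instance countable_counters : Countable (Counters X A) := by
  have : Function.Injective fun c : Counters X A => (c.epoch, c.N, c.M, c.N0, c.M0) := by
    rintro ⟨⟩ ⟨⟩ h
    simp only [Prod.mk.injEq] at h
    obtain ⟨rfl, rfl, rfl, rfl, rfl⟩ := h
    rfl
  exact this.countable

/-- The projection set depends on the outcome only through the counters, which take countably many
values; for each value the projection is a fixed continuous map. -/
theorem measurable_of_countable_cases {Ω β γ : Type*} {mΩ : MeasurableSpace Ω}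
    {mγ : MeasurableSpace γ} [Countable β] {c : Ω → β} (hc : ∀ b, MeasurableSet {ω | c ω = b})
    {g : β → Ω → γ} (hg : ∀ b, Measurable (g b)) : Measurable fun ω => g (c ω) ω := by
  intro s hs
  have e : (fun ω => g (c ω) ω) ⁻¹' s = ⋃ b, {ω | c ω = b} ∩ g b ⁻¹' s := by
    ext ω; simp
  rw [e]
  exact MeasurableSet.iUnion fun b => (hc b).inter (hg b hs)

/-- A random state of the algorithm all of whose components are measurable. -/
structure IsMeasurableState (mΩ : MeasurableSpace Ω) (s : Ω → AlgState X A m) : Prop where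
  qhat : Measurable fun ω => (s ω).qhat
  lam : Measurable fun ω => (s ω).lam
  lossMax : Measurable fun ω => (s ω).lossMax
  counters : ∀ c, MeasurableSet {ω | (s ω).counters = c}

theorem IsMeasurableState.mono {m₁ m₂ : MeasurableSpace Ω} (h : m₁ ≤ m₂)
    {s : Ω → AlgState X A m} (hs : IsMeasurableState m₁ s) :
    IsMeasurableState m₂ s :=
  ⟨hs.qhat.mono h le_rfl, hs.lam.mono h le_rfl, hs.lossMax.mono h le_rfl,
    fun c => h _ (hs.counters c)⟩

theorem measurable_costOf {ι Ω : Type*} [Fintype ι] {mΩ : MeasurableSpace Ω}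
    {G : Ω → ι → Fin m → ℝ} {q : Ω → ι → ℝ} (hG : Measurable G) (hq : Measurable q) (i : Fin m) :
    Measurable fun ω => ∑ p, G ω p i * q ω p := by
  refine Finset.measurable_sum _ fun p _ => ?_
  exact (measurable_pi_iff.1 (measurable_pi_iff.1 hG p) i).mul (measurable_pi_iff.1 hq p)

theorem IsMeasurableState.update {mΩ : MeasurableSpace Ω} {S : LayeredSpace X L} (T : ℕ)
    (δ C K : ℝ) {s : Ω → AlgState X A m} (hs : IsMeasurableState mΩ s) {e : Ω → Episode X A L m}
    (h1 : ∀ z, MeasurableSet {ω | (e ω).state = z}) (h2 : ∀ z, MeasurableSet {ω | (e ω).action = z})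
    (h3 : Measurable fun ω => (e ω).reward) (h4 : Measurable fun ω => (e ω).cost) :
    IsMeasurableState mΩ fun ω => (s ω).update S T δ C K (e ω) := by
  have hloss : Measurable fun ω => (s ω).loss (e ω) := by
    refine measurable_pi_iff.2 fun p => ?_
    simp only [AlgState.loss]
    refine Measurable.sub (Finset.measurable_sum _ fun i _ => ?_) (measurable_pi_iff.1 h3 p)
    exact (measurable_pi_iff.1 (measurable_pi_iff.1 h4 p) i).mul (measurable_pi_iff.1 hs.lam i)
  have hmax : Measurable fun ω => max (s ω).lossMax ‖(s ω).loss (e ω)‖ :=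
    hs.lossMax.max hloss.norm
  have hcount : ∀ c, MeasurableSet {ω | (s ω).counters.update (e ω) = c} := by
    intro c
    have e1 : {ω | (s ω).counters.update (e ω) = c}
        = ⋃ c' : Counters X A, ⋃ z : Fin (L + 1) → X, ⋃ w : Fin L → A,
          ({ω | (s ω).counters = c'} ∩ ({ω | (e ω).state = z} ∩ {ω | (e ω).action = w})) ∩
            {_ω | c'.update (⟨z, w, 0, 0⟩ : Episode X A L m) = c} := by
      ext ω
      simp only [Set.mem_iUnion, Set.mem_inter_iff, Set.mem_ofPred_eq]
      constructor
      · intro h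
        exact ⟨_, _, _, ⟨rfl, rfl, rfl⟩, h⟩
      · rintro ⟨_, _, _, ⟨rfl, rfl, rfl⟩, h⟩
        exact h
    rw [e1]
    exact MeasurableSet.iUnion fun c' => MeasurableSet.iUnion fun z => MeasurableSet.iUnion fun w =>
      ((hs.counters c').inter ((h1 z).inter (h2 w))).inter (MeasurableSet.const _)
  refine ⟨?_, ?_, hmax, hcount⟩
  · simp only [AlgState.update]
    refine measurable_of_countable_cases (c := fun ω => (s ω).counters.update (e ω)) hcount
      (g := fun c ω => euclProj (occSet S (c.confSet S T δ)) fun p => (s ω).qhat p -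
        1 / (max (s ω).lossMax ‖(s ω).loss (e ω)‖ * C * √T) * (s ω).loss (e ω) p) fun c => ?_
    refine (continuous_euclProj (isCompact_occSet_confSet c T δ)
      (convex_occSet_confSet c T δ)).measurable.comp (measurable_pi_iff.2 fun p => ?_)
    exact (measurable_pi_iff.1 hs.qhat p).sub
      ((measurable_const.div ((hmax.mul measurable_const).mul measurable_const)).mul
        (measurable_pi_iff.1 hloss p))
  · simp only [AlgState.update]
    refine (continuous_euclProj (isCompact_box _) (convex_box _)).measurable.comp
      (measurable_pi_iff.2 fun i => ?_)
    exact (measurable_pi_iff.1 hs.lam i).add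
      (measurable_const.mul (measurable_costOf h4 hs.qhat i))

/-- Adaptedness of the iterates: it makes the dual vector of an episode independent of the fresh
constraint matrix. -/
theorem isMeasurableState_pdgdOps (S : LayeredSpace X L) (T : ℕ) (δ C K : ℝ)
    (E : ℕ → Ω → Episode X A L m) (t : ℕ) :
    IsMeasurableState (history E t) fun ω => pdgdOps S T δ C K (fun s => E s ω) t := by
  induction t with
  | zero =>
    exact ⟨measurable_const, measurable_const, measurable_const, 
      fun c => MeasurableSet.const ((initState A m S).counters = c)⟩
  | succ t ih =>
    have ht : t < t + 1 := Nat.lt_succ_self t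
    exact (ih.mono (history_mono E ht.le)).update (mΩ := history E (t + 1)) T δ C K
      (fun z => comap_state_le_history E ht _ ⟨{z}, trivial, rfl⟩)
      (fun z => comap_action_le_history E ht _ ⟨{z}, trivial, rfl⟩)
      (measurable_iff_comap_le.2 (comap_reward_le_history E ht))
      (measurable_iff_comap_le.2 (comap_cost_le_history E ht))

end Measurability

/-! ### Concentration of the stochastic constraints -/

section Azuma

variable {X A Ω : Type*} [Fintype X] [Fintype A] {L m : ℕ}

/-- The deviation of the cost of `q₀`, weighted by the dual vector `v` as long as the latter is
bounded by `ζ`. -/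
noncomputable def noiseTerm (Gbar : X × A → Fin m → ℝ) (q₀ : X × A → ℝ) (ζ : ℝ)
    (z : (Fin m → ℝ) × (X × A → Fin m → ℝ)) : ℝ :=
  if ∑ i, |z.1 i| ≤ ζ then ∑ i, z.1 i * (costOf z.2 q₀ i - costOf Gbar q₀ i) else 0

theorem measurable_noiseTerm (Gbar : X × A → Fin m → ℝ) (q₀ : X × A → ℝ) (ζ : ℝ) :
    Measurable (noiseTerm Gbar q₀ ζ) := by
  unfold noiseTerm costOf
  refine Measurable.ite (measurableSet_le ?_ measurable_const) ?_ measurable_const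
  · fun_prop
  · fun_prop

theorem abs_noiseTerm_le {Gbar g : X × A → Fin m → ℝ} {q₀ : X × A → ℝ} (hq : IsSubOcc L q₀)
    (hG : ∀ p i, |Gbar p i| ≤ 1) (hg : ∀ p i, |g p i| ≤ 1) {ζ : ℝ} (hζ : 0 ≤ ζ) (v : Fin m → ℝ) :
    |noiseTerm Gbar q₀ ζ (v, g)| ≤ ζ * (2 * L) := by
  unfold noiseTerm
  split_ifs with h
  · calc |∑ i, v i * (costOf g q₀ i - costOf Gbar q₀ i)|
        ≤ ∑ i, |v i| * (2 * L) := by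
          refine (Finset.abs_sum_le_sum_abs _ _).trans (Finset.sum_le_sum fun i _ => ?_)
          rw [abs_mul]
          refine mul_le_mul_of_nonneg_left ((abs_sub _ _).trans ?_) (abs_nonneg _)
          linarith [abs_costOf_le hg hq i, abs_costOf_le hG hq i]
      _ ≤ ζ * (2 * L) := by
          rw [← Finset.sum_mul]
          exact mul_le_mul_of_nonneg_right h (by positivity)
  · rw [abs_zero]; positivity

/-- Hoeffding's lemma for a variable in `[-Lζ, Lζ]`, centred at its mean; if the truncation is
active, the integrand is one. -/
theorem integral_exp_noiseTerm_le {𝒢 : Measure (X × A → Fin m → ℝ)} [IsProbabilityMeasure 𝒢]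
    (h𝒢 : ∀ᵐ g ∂𝒢, ∀ p i, |g p i| ≤ 1) {q₀ : X × A → ℝ} (hq : IsSubOcc L q₀) {ζ : ℝ}
    (hζ : 0 ≤ ζ) (c : ℝ) (v : Fin m → ℝ) :
    ∫ g, Real.exp (c * noiseTerm (meanCost 𝒢) q₀ ζ (v, g)) ∂𝒢
      ≤ Real.exp (c ^ 2 * (L * ζ) ^ 2 / 2) := by
  by_cases h : ∑ i, |v i| ≤ ζ
  swap
  · simp only [noiseTerm, if_neg h, mul_zero, Real.exp_zero, integral_const, probReal_univ,
      smul_eq_mul, mul_one]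
    exact Real.one_le_exp (by positivity)
  simp only [noiseTerm, if_pos h]
  set Y : (X × A → Fin m → ℝ) → ℝ := fun g => ∑ i, v i * costOf g q₀ i with hY
  have hYm : Measurable Y := by
    simp only [hY, costOf]; fun_prop
  have hYb : ∀ᵐ g ∂𝒢, Y g ∈ Set.Icc (-(L * ζ)) (L * ζ) := by
    filter_upwards [h𝒢] with g hg
    rw [Set.mem_Icc, ← abs_le]
    calc |∑ i, v i * costOf g q₀ i| ≤ ∑ i, |v i| * L := by
          refine (Finset.abs_sum_le_sum_abs _ _).trans (Finset.sum_le_sum fun i _ => ?_)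
          rw [abs_mul]
          exact mul_le_mul_of_nonneg_left (abs_costOf_le hg hq i) (abs_nonneg _)
      _ ≤ L * ζ := by
          rw [← Finset.sum_mul, mul_comm]
          exact mul_le_mul_of_nonneg_left h (by positivity)
  have hint : ∀ p i, Integrable (fun g : X × A → Fin m → ℝ => g p i) 𝒢 := fun p i =>
    Integrable.of_bound (by fun_prop : Measurable fun g : X × A → Fin m → ℝ => g p i).aestronglyMeasurable 1
      (by filter_upwards [h𝒢] with g hg using hg p i)
  have hmean : ∫ g, Y g ∂𝒢 = ∑ i, v i * costOf (meanCost 𝒢) q₀ i := by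
    simp only [hY, costOf]
    rw [integral_finsetSum]
    · refine Finset.sum_congr rfl fun i _ => ?_
      rw [integral_const_mul, integral_finsetSum _ fun p _ => (hint p i).mul_const _]
      simp only [integral_mul_const, meanCost]
    · exact fun i _ => (integrable_finsetSum _ fun p _ => (hint p i).mul_const _).const_mul _
  have h1 := (hasSubgaussianMGF_of_mem_Icc hYm.aemeasurable hYb).mgf_le c
  rw [mgf] at h1
  have e1 : ∀ g, ∑ i, v i * (costOf g q₀ i - costOf (meanCost 𝒢) q₀ i) = Y g - ∫ g, Y g ∂𝒢 := by
    intro g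
    rw [hmean, hY, ← Finset.sum_sub_distrib]
    exact Finset.sum_congr rfl fun i _ => by ring
  simp_rw [e1]
  refine h1.trans (le_of_eq ?_)
  congr 1
  have e2 : L * ζ - -(L * ζ) = 2 * (L * ζ) := by ring
  push_cast
  rw [e2, Real.norm_of_nonneg (by positivity)]
  ring

variable [mΩ : MeasurableSpace Ω] {μ : Measure Ω} [IsProbabilityMeasure μ]

/-- One step of the exponential supermartingale: the constraint matrix is independent of the past
increments and of the dual vector. -/
theorem integral_exp_add_noiseTerm_le {𝒢 : Measure (X × A → Fin m → ℝ)} [IsProbabilityMeasure 𝒢]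
    (h𝒢 : ∀ᵐ g ∂𝒢, ∀ p i, |g p i| ≤ 1) {q₀ : X × A → ℝ} (hq : IsSubOcc L q₀) {ζ : ℝ}
    (hζ : 0 ≤ ζ) (c : ℝ) {Z : Ω → ℝ} {v : Ω → Fin m → ℝ} {G : Ω → X × A → Fin m → ℝ}
    (hZ : Measurable Z) (hv : Measurable v) (hG : Measurable G) (hlaw : μ.map G = 𝒢)
    (hind : IndepFun (fun ω => (Z ω, v ω)) G μ)
    (hint : Integrable (fun ω => Real.exp (Z ω)) μ)
    (hint' : Integrable
      (fun ω => Real.exp (Z ω + c * noiseTerm (meanCost 𝒢) q₀ ζ (v ω, G ω))) μ) :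
    ∫ ω, Real.exp (Z ω + c * noiseTerm (meanCost 𝒢) q₀ ζ (v ω, G ω)) ∂μ
      ≤ Real.exp (c ^ 2 * (L * ζ) ^ 2 / 2) * ∫ ω, Real.exp (Z ω) ∂μ := by
  set U : Ω → ℝ × (Fin m → ℝ) := fun ω => (Z ω, v ω) with hU
  have hUm : Measurable U := hZ.prodMk hv
  set Φ : (ℝ × (Fin m → ℝ)) × (X × A → Fin m → ℝ) → ℝ := fun w =>
    Real.exp (w.1.1 + c * noiseTerm (meanCost 𝒢) q₀ ζ (w.1.2, w.2)) with hΦ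
  have hΦm : Measurable Φ := by
    have h1 : Measurable fun w : (ℝ × (Fin m → ℝ)) × (X × A → Fin m → ℝ) => (w.1.2, w.2) := by
      fun_prop
    have h2 := (measurable_noiseTerm (meanCost 𝒢) q₀ ζ).comp h1
    exact Real.measurable_exp.comp ((by fun_prop : Measurable
      fun w : (ℝ × (Fin m → ℝ)) × (X × A → Fin m → ℝ) => w.1.1).add (h2.const_mul c))
  -- Independence makes the joint law a product, so Fubini allows averaging over the matrix with `Z`
  -- and `v` frozen.
  have hprod : μ.map (fun ω => (U ω, G ω)) = (μ.map U).prod 𝒢 := by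
    rw [← hlaw]
    exact (indepFun_iff_map_prod_eq_prod_map_map hUm.aemeasurable hG.aemeasurable).1 hind
  have hpU : IsProbabilityMeasure (μ.map U) := Measure.isProbabilityMeasure_map hUm.aemeasurable
  have hΦi : Integrable Φ ((μ.map U).prod 𝒢) := by
    rw [← hprod, integrable_map_measure hΦm.aestronglyMeasurable (hUm.prodMk hG).aemeasurable]
    exact hint'
  have hei : Integrable (fun u : ℝ × (Fin m → ℝ) => Real.exp u.1) (μ.map U) := by
    rw [integrable_map_measure (by fun_prop) hUm.aemeasurable]
    exact hint
  calc ∫ ω, Real.exp (Z ω + c * noiseTerm (meanCost 𝒢) q₀ ζ (v ω, G ω)) ∂μ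
      = ∫ w, Φ w ∂((μ.map U).prod 𝒢) := by
        rw [← hprod, integral_map (hUm.prodMk hG).aemeasurable hΦm.aestronglyMeasurable]
    _ = ∫ u, ∫ g, Φ (u, g) ∂𝒢 ∂(μ.map U) := integral_prod _ hΦi
    _ ≤ ∫ u, Real.exp (c ^ 2 * (L * ζ) ^ 2 / 2) * Real.exp u.1 ∂(μ.map U) := by
        refine integral_mono hΦi.integral_prod_left (hei.const_mul _) fun u => ?_
        simp only [hΦ, Real.exp_add]
        rw [integral_const_mul, mul_comm]
        exact mul_le_mul_of_nonneg_right (integral_exp_noiseTerm_le h𝒢 hq hζ c u.2)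
          (Real.exp_pos _).le
    _ = _ := by
        rw [integral_const_mul, integral_map hUm.aemeasurable (by fun_prop)]

variable {T : ℕ} {S : LayeredSpace X L} {P : X → A → X → ℝ} {π₀ : X → A → ℝ} {δ C K : ℝ}
  {E : ℕ → Ω → Episode X A L m}

theorem StochasticCosts.isProbabilityMeasure {𝒢 : Measure (X × A → Fin m → ℝ)}
    (hE : IsInteraction μ S P π₀ T δ C K E) (hT : 0 < T) (h : StochasticCosts μ T E 𝒢) :
    IsProbabilityMeasure 𝒢 := by
  rw [← (h 0 hT).1]
  exact Measure.isProbabilityMeasure_map (hE.measurable_cost 0 hT).aemeasurable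

theorem StochasticCosts.ae_abs_le {𝒢 : Measure (X × A → Fin m → ℝ)}
    (hE : IsInteraction μ S P π₀ T δ C K E) (hT : 0 < T) (h : StochasticCosts μ T E 𝒢) :
    ∀ᵐ g ∂𝒢, ∀ p i, |g p i| ≤ 1 := by
  rw [← (h 0 hT).1]
  refine ae_all_iff.2 fun p => ae_all_iff.2 fun i => ?_
  rw [ae_map_iff (hE.measurable_cost 0 hT).aemeasurable
    (measurableSet_le (by fun_prop) measurable_const)]
  exact Filter.Eventually.of_forall fun ω => abs_le.2 (hE.cost_mem 0 hT ω p i)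

theorem abs_meanCost_le {𝒢 : Measure (X × A → Fin m → ℝ)} [IsProbabilityMeasure 𝒢]
    (h𝒢 : ∀ᵐ g ∂𝒢, ∀ p i, |g p i| ≤ 1) (p : X × A) (i : Fin m) : |meanCost 𝒢 p i| ≤ 1 := by
  have h := norm_integral_le_of_norm_le_const (μ := 𝒢) (f := fun g => g p i) (C := 1)
    (by filter_upwards [h𝒢] with g hg using hg p i)
  simpa [meanCost] using h

/-- A Hoeffding–Azuma bound for the noise in the constraints between the episodes `t₁` and `t₂`. -/
theorem StochasticCosts.measure_noise_le {𝒢 : Measure (X × A → Fin m → ℝ)}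
    (hE : IsInteraction μ S P π₀ T δ C K E) (h : StochasticCosts μ T E 𝒢) (hL : 0 < L)
    (hT : 0 < T) {q₀ : X × A → ℝ} (hq : IsSubOcc L q₀) {ζ : ℝ} (hζ : 0 < ζ) {l : ℝ} (hl : 0 ≤ l)
    {t₁ t₂ : ℕ} (h12 : t₁ ≤ t₂) (h2 : t₂ ≤ T) :
    μ.real {ω | L * ζ * √(2 * T * l) ≤ ∑ t ∈ Finset.Ico t₁ t₂, noiseTerm (meanCost 𝒢) q₀ ζ
      ((pdgdOps S T δ C K (fun s => E s ω) t).lam, (E t ω).cost)} ≤ Real.exp (-l) := by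
  have hprob := h.isProbabilityMeasure hE hT
  have h𝒢 := h.ae_abs_le hE hT
  have hmc := abs_meanCost_le h𝒢
  set ξ : ℕ → Ω → ℝ := fun t ω => noiseTerm (meanCost 𝒢) q₀ ζ
      ((pdgdOps S T δ C K (fun s => E s ω) t).lam, (E t ω).cost) with hξ
  have hξm : ∀ t n, t < n → Measurable[history E n] (ξ t) := fun t n htn => by
    refine (measurable_noiseTerm (meanCost 𝒢) q₀ ζ).comp (Measurable.prodMk ?_ ?_)
    · exact (isMeasurableState_pdgdOps S T δ C K E t).lam.mono (history_mono E htn.le) le_rfl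
    · exact measurable_iff_comap_le.2 (comap_cost_le_history E htn)
  have hξb : ∀ t < T, ∀ ω, |ξ t ω| ≤ ζ * (2 * L) := fun t ht ω =>
    abs_noiseTerm_le hq hmc (fun p i => abs_le.2 (hE.cost_mem t ht ω p i)) hζ.le _
  set R : ℝ := L * ζ with hR
  have hR0 : 0 < R := by positivity
  have hT0 : (0 : ℝ) < T := by exact_mod_cast hT
  -- The optimal Chernoff parameter: the threshold contributes `2 * l` to the exponent and the `T`
  -- increments at most `l`, leaving `exp (-l)`.
  set c : ℝ := √(2 * T * l) / (T * R) with hc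
  have hc0 : 0 ≤ c := by positivity
  have hmeas : ∀ n ≤ T, Measurable[history E n] fun ω => ∑ t ∈ Finset.Ico t₁ n, c * ξ t ω :=
    fun n hn => Finset.measurable_sum _ fun t ht =>
      measurable_const.mul (hξm t n (Finset.mem_Ico.1 ht).2)
  have hint : ∀ n ≤ T, Integrable (fun ω => Real.exp (∑ t ∈ Finset.Ico t₁ n, c * ξ t ω)) μ := by
    intro n hn
    refine Integrable.of_bound (Real.measurable_exp.comp
      ((hmeas n hn).mono (hE.history_le hn) le_rfl)).aestronglyMeasurable
      (Real.exp (∑ t ∈ Finset.Ico t₁ n, c * (ζ * (2 * L)))) (Filter.Eventually.of_forall fun ω => ?_)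
    rw [Real.norm_eq_abs, abs_of_pos (Real.exp_pos _)]
    refine Real.exp_le_exp.2 (Finset.sum_le_sum fun t ht => ?_)
    rw [Finset.mem_Ico] at ht
    exact mul_le_mul_of_nonneg_left ((le_abs_self _).trans (hξb t (by omega) ω)) hc0
  have hmgf : ∀ n, t₁ ≤ n → n ≤ T → ∫ ω, Real.exp (∑ t ∈ Finset.Ico t₁ n, c * ξ t ω) ∂μ
      ≤ Real.exp ((n - t₁ : ℕ) * (c ^ 2 * R ^ 2 / 2)) := by
    intro n hn
    induction n, hn using Nat.le_induction with
    | base => simp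
    | succ n hn ih =>
      intro hnT
      have hi := hint (n + 1) hnT
      simp only [Finset.sum_Ico_succ_top hn] at hi ⊢
      have hlam := (isMeasurableState_pdgdOps S T δ C K E n).lam
      have hUm : Measurable[history E n] fun ω => (∑ t ∈ Finset.Ico t₁ n, c * ξ t ω,
          (pdgdOps S T δ C K (fun s => E s ω) n).lam) := (hmeas n (by omega)).prodMk hlam
      have hind : IndepFun (fun ω => (∑ t ∈ Finset.Ico t₁ n, c * ξ t ω,
          (pdgdOps S T δ C K (fun s => E s ω) n).lam)) (fun ω => (E n ω).cost) μ := by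
        rw [IndepFun_iff_Indep]
        exact indep_of_indep_of_le_left (h n hnT).2.symm hUm.comap_le
      have hle := hE.history_le (t := n) (by omega)
      refine (integral_exp_add_noiseTerm_le h𝒢 hq hζ.le c
        ((hmeas n (by omega)).mono hle le_rfl) (hlam.mono hle le_rfl) (hE.measurable_cost n hnT)
        (h n hnT).1 hind (hint n (by omega)) hi).trans ?_
      rw [Nat.succ_sub hn, Nat.cast_succ, add_mul, one_mul, add_comm, Real.exp_add]
      exact mul_le_mul_of_nonneg_left (ih (by omega)) (Real.exp_pos _).le
  have hsq : √(2 * T * l) ^ 2 = 2 * T * l := Real.sq_sqrt (by positivity)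
  have hcε : c * (R * √(2 * T * l)) = 2 * l := by
    have : c * (R * √(2 * T * l)) = √(2 * T * l) ^ 2 / T := by rw [hc]; field_simp
    rw [this, hsq]; field_simp
  have hcR : T * (c ^ 2 * R ^ 2 / 2) = l := by
    have : T * (c ^ 2 * R ^ 2 / 2) = √(2 * T * l) ^ 2 / T / 2 := by rw [hc]; field_simp
    rw [this, hsq]; field_simp
  have hmarkov := mul_meas_ge_le_integral_of_nonneg (μ := μ)
    (f := fun ω => Real.exp (∑ t ∈ Finset.Ico t₁ t₂, c * ξ t ω))
    (Filter.Eventually.of_forall fun ω => (Real.exp_pos _).le) (hint t₂ h2) (Real.exp (2 * l))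
  have hsub : μ.real {ω | R * √(2 * T * l) ≤ ∑ t ∈ Finset.Ico t₁ t₂, ξ t ω} ≤
      μ.real {ω | Real.exp (2 * l) ≤ Real.exp (∑ t ∈ Finset.Ico t₁ t₂, c * ξ t ω)} := by
    refine measureReal_mono fun ω hω => Real.exp_le_exp.2 ?_
    rw [← Finset.mul_sum, ← hcε]
    exact mul_le_mul_of_nonneg_left hω hc0
  have hup : ∫ ω, Real.exp (∑ t ∈ Finset.Ico t₁ t₂, c * ξ t ω) ∂μ ≤ Real.exp l := by
    refine (hmgf t₂ h12 h2).trans (Real.exp_le_exp.2 ?_)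
    rw [← hcR]
    have : ((t₂ - t₁ : ℕ) : ℝ) ≤ T := by exact_mod_cast (by omega : t₂ - t₁ ≤ T)
    gcongr
  refine hsub.trans ?_
  have e1 : Real.exp (-l) = Real.exp l / Real.exp (2 * l) := by
    rw [← Real.exp_sub]; congr 1; ring
  rw [e1, le_div_iff₀ (Real.exp_pos _), mul_comm]
  exact hmarkov.trans hup

/-- With probability at least `1 - δ`, the noise in the constraints is small between any two
episodes. -/
theorem StochasticCosts.exists_noise_event {𝒢 : Measure (X × A → Fin m → ℝ)}
    (hE : IsInteraction μ S P π₀ T δ C K E) (h : StochasticCosts μ T E 𝒢) (hL : 0 < L)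
    (hT : 0 < T) (hδ : 0 < δ) {q₀ : X × A → ℝ} (hq : IsSubOcc L q₀) {ζ : ℝ} (hζ : 0 < ζ)
    (hlog : 0 ≤ Real.log ((T : ℝ) ^ 2 / δ)) :
    ∃ F : Set Ω, μ.real F ≤ δ ∧ ∀ ω ∉ F, ∀ t₁ t₂, t₁ < t₂ → t₂ ≤ T →
      ∑ t ∈ Finset.Ico t₁ t₂, noiseTerm (meanCost 𝒢) q₀ ζ
        ((pdgdOps S T δ C K (fun s => E s ω) t).lam, (E t ω).cost)
      ≤ L * ζ * √(2 * T * Real.log ((T : ℝ) ^ 2 / δ)) := by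
  set l := Real.log ((T : ℝ) ^ 2 / δ) with hl
  set bad : ℕ × ℕ → Set Ω := fun r => {ω | r.1 < r.2 ∧ L * ζ * √(2 * T * l) ≤
    ∑ t ∈ Finset.Ico r.1 r.2, noiseTerm (meanCost 𝒢) q₀ ζ
      ((pdgdOps S T δ C K (fun s => E s ω) t).lam, (E t ω).cost)} with hbad
  have hT0 : (0 : ℝ) < T := by exact_mod_cast hT
  refine ⟨⋃ r ∈ Finset.range T ×ˢ Finset.Icc 1 T, bad r, ?_, fun ω hω t₁ t₂ h12 h2 => ?_⟩
  -- The logarithm is tuned to a union over `T ^ 2` pairs of endpoints.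
  · have hexp : Real.exp (-l) = δ / T ^ 2 := by
      rw [Real.exp_neg, hl, Real.exp_log (by positivity), inv_div]
    calc μ.real (⋃ r ∈ Finset.range T ×ˢ Finset.Icc 1 T, bad r)
        ≤ ∑ r ∈ Finset.range T ×ˢ Finset.Icc 1 T, μ.real (bad r) :=
          measureReal_biUnion_finset_le _ _
      _ ≤ ∑ r ∈ Finset.range T ×ˢ Finset.Icc 1 T, δ / T ^ 2 := by
          refine Finset.sum_le_sum fun r hr => ?_
          rw [Finset.mem_product, Finset.mem_range, Finset.mem_Icc] at hr
          by_cases h12 : r.1 < r.2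
          · rw [← hexp]
            refine le_trans (measureReal_mono fun ω hω => hω.2)
              (h.measure_noise_le hE hL hT hq hζ hlog h12.le hr.2.2)
          · have : bad r = ∅ := Set.eq_empty_of_forall_notMem fun ω hω => h12 hω.1
            rw [this, measureReal_empty]
            positivity
      _ = δ := by
          rw [Finset.sum_const, nsmul_eq_mul, Finset.card_product, Finset.card_range, Nat.card_Icc,
            Nat.add_sub_cancel]
          push_cast
          field_simp
  · by_contra! hgt
    exact hω (Set.mem_biUnion (show (t₁, t₂) ∈ Finset.range T ×ˢ Finset.Icc 1 T by
      simp only [Finset.mem_product, Finset.mem_range, Finset.mem_Icc]; omega) ⟨h12, hgt.le⟩)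

end Azuma

/-! ### Strictly feasible occupancy measures. -/

section Feasibility

variable {X A : Type*} [Fintype X] [Fintype A] {L m T : ℕ} {S : LayeredSpace X L}
  {P : X → A → X → ℝ} {π₀ : X → A → ℝ}

theorem isSubOcc_of_mem (hP : IsTransition S P) {q : X × A → ℝ} (hq : q ∈ occSet S {P}) :
    IsSubOcc L q :=
  isSubOcc_of_mem_occSet (fun Q hQ => by rw [Set.mem_singleton_iff] at hQ; rwa [hQ]) hq

theorem occSet_nonempty (hπ₀ : IsPolicy π₀) : (occSet S {P}).Nonempty :=
  ⟨_, P, rfl, π₀, hπ₀, rfl⟩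

theorem iInf_neg_costOf_le (hm : 0 < m) (hP : IsTransition S P) {G : X × A → Fin m → ℝ}
    (hG : ∀ p i, |G p i| ≤ 1) {q : X × A → ℝ} (hq : q ∈ occSet S {P}) :
    ⨅ i, -costOf G q i ≤ L :=
  (ciInf_le (Set.finite_range _).bddBelow ⟨0, hm⟩).trans
    ((neg_le_abs _).trans (abs_costOf_le hG (isSubOcc_of_mem hP hq) _))

theorem rhoStoch_le (hm : 0 < m) (hP : IsTransition S P) (hπ₀ : IsPolicy π₀)
    {G : X × A → Fin m → ℝ} (hG : ∀ p i, |G p i| ≤ 1) : rhoStoch S P G ≤ L := by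
  refine csSup_le ((occSet_nonempty hπ₀).image _) ?_
  rintro _ ⟨q, hq, rfl⟩
  exact iInf_neg_costOf_le hm hP hG hq

theorem rhoAdv_le (hm : 0 < m) (hT : 0 < T) (hP : IsTransition S P) (hπ₀ : IsPolicy π₀)
    {G : ℕ → X × A → Fin m → ℝ} (hG : ∀ t < T, ∀ p i, |G t p i| ≤ 1) : rhoAdv S P T G ≤ L := by
  refine csSup_le ((occSet_nonempty hπ₀).image _) ?_
  rintro _ ⟨q, hq, rfl⟩
  exact (ciInf_le (Set.finite_range _).bddBelow (⟨0, hT⟩ : Fin T)).trans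
    (iInf_neg_costOf_le hm hP (hG 0 hT) hq)

/-- Settling for half of the supremum avoids showing that it is attained. -/
theorem exists_feasible_of_rhoStoch_pos (hπ₀ : IsPolicy π₀) {G : X × A → Fin m → ℝ}
    (hρ : 0 < rhoStoch S P G) :
    ∃ q ∈ occSet S {P}, ∀ i, costOf G q i ≤ -(rhoStoch S P G / 2) := by
  obtain ⟨_, ⟨q, hq, rfl⟩, hlt⟩ := exists_lt_of_lt_csSup ((occSet_nonempty hπ₀).image _)
    (half_lt_self hρ)
  refine ⟨q, hq, fun i => ?_⟩
  have h := hlt.trans_le (ciInf_le (Set.finite_range _).bddBelow i)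
  exact le_neg_of_le_neg h.le

theorem exists_feasible_of_rhoAdv_pos (hπ₀ : IsPolicy π₀) {G : ℕ → X × A → Fin m → ℝ}
    (hρ : 0 < rhoAdv S P T G) :
    ∃ q ∈ occSet S {P}, ∀ t < T, ∀ i, costOf (G t) q i ≤ -(rhoAdv S P T G / 2) := by
  obtain ⟨_, ⟨q, hq, rfl⟩, hlt⟩ := exists_lt_of_lt_csSup ((occSet_nonempty hπ₀).image _)
    (half_lt_self hρ)
  refine ⟨q, hq, fun t ht i => ?_⟩
  have h1 := hlt.trans_le (ciInf_le (Set.finite_range _).bddBelow (⟨t, ht⟩ : Fin T))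
  have h := h1.trans_le (ciInf_le (Set.finite_range _).bddBelow i)
  exact le_neg_of_le_neg h.le

theorem sum_mul_costOf_le {v : Fin m → ℝ} (hv : ∀ i, 0 ≤ v i) {G : X × A → Fin m → ℝ}
    {q : X × A → ℝ} {r : ℝ} (h : ∀ i, costOf G q i ≤ -r) :
    ∑ i, v i * costOf G q i ≤ -r * ∑ i, |v i| := by
  rw [Finset.mul_sum]
  refine Finset.sum_le_sum fun i _ => ?_
  rw [abs_of_nonneg (hv i), mul_comm (-r)]
  exact mul_le_mul_of_nonneg_left (h i) (hv i)

end Feasibility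

/-! ### From exceptional events to the theorem. -/

theorem one_sub_le_measureReal {Ω : Type*} [MeasurableSpace Ω] {μ : Measure Ω}
    [IsProbabilityMeasure μ] {F G : Set Ω} {ε : ℝ} (hF : μ.real F ≤ ε) (h : ∀ ω ∉ F, ω ∈ G) :
    1 - ε ≤ μ.real G := by
  have h1 : (Set.univ : Set Ω) ⊆ F ∪ G := fun ω _ => by
    by_cases hω : ω ∈ F
    · exact Or.inl hω
    · exact Or.inr (h ω hω)
  have h2 := (measureReal_mono (μ := μ) h1).trans (measureReal_union_le F G)
  rw [probReal_univ] at h2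
  linarith

end CMDP

theorem mainTheorem4 {X A Ω : Type*} [Fintype X] [Fintype A] [Nonempty A] [MeasurableSpace Ω]
    (μ : Measure Ω) [IsProbabilityMeasure μ]
    {L m T : ℕ} (hL : 0 < L) (hm : 0 < m) (hT : 0 < T) (δ : ℝ) (hδ : δ ∈ Set.Ioo (0 : ℝ) 1)
    (S : LayeredSpace X L) (P : X → A → X → ℝ) (hP : IsTransition S P)
    (π₀ : X → A → ℝ) (hπ₀ : IsPolicy π₀) (C K : ℝ)
    (hC : C = 5 * (Fintype.card X * Fintype.card A) / L)
    (hK : K = 100 * m * (Fintype.card X * Fintype.card A))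
    (E : ℕ → Ω → Episode X A L m) (hE : IsInteraction μ S P π₀ T δ C K E) :
    -- stochastic constraints
    (∀ 𝒢 : Measure (X × A → Fin m → ℝ), StochasticCosts μ T E 𝒢 →
      RhoCondition T L m (rhoStoch S P (meanCost 𝒢)) →
      1 - 2 * δ ≤ μ.real {ω | ∀ t ≤ T, ∑ i, |(pdgdOps S T δ C K (fun s => E s ω) t).lam i| ≤
        20 * m * L ^ 2 / rhoStoch S P (meanCost 𝒢) ^ 2}) ∧
    -- adversarial constraints
    (1 - δ ≤ μ.real {ω | RhoCondition T L m (rhoAdv S P T fun s => (E s ω).cost) →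
      ∀ t ≤ T, ∑ i, |(pdgdOps S T δ C K (fun s => E s ω) t).lam i| ≤
        20 * m * L ^ 2 / rhoAdv S P T (fun s => (E s ω).cost) ^ 2}) := by
  obtain ⟨F, hF, hclean⟩ := hE.exists_clean_event hP hL hT hδ
  refine ⟨fun 𝒢 h𝒢 hcond => ?_, one_sub_le_measureReal hF fun ω hω hcond => ?_⟩
  · have hprob := h𝒢.isProbabilityMeasure hE hT
    have hmean := abs_meanCost_le (h𝒢.ae_abs_le hE hT)
    set ρ := rhoStoch S P (meanCost 𝒢) with hρ
    have hρL : ρ ≤ L := rhoStoch_le hm hP hπ₀ hmean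
    have hρ0 : 0 < ρ := hcond.pos hL hm hT
    have hlog := hcond.one_le_log hρL hL hm hT hδ
    obtain ⟨q₀, hq₀, hfeas⟩ := exists_feasible_of_rhoStoch_pos hπ₀ hρ0
    rw [← hρ] at hfeas
    have hζ : 0 < 20 * m * (L : ℝ) ^ 2 / ρ ^ 2 := by positivity
    obtain ⟨F', hF', hnoise⟩ := h𝒢.exists_noise_event hE hL hT hδ.1 (isSubOcc_of_mem hP hq₀) hζ
      (zero_le_one.trans hlog)
    refine one_sub_le_measureReal (F := F ∪ F')
      ((measureReal_union_le F F').trans (by linarith)) fun ω hω => ?_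
    refine sum_abs_lam_le hL hm hT hC hK hP (fun t ht => hE.reward_mem t ht ω)
      (fun t ht => hE.cost_mem t ht ω) (hclean ω fun h => hω (Or.inl h)) hq₀ hρ0 hρL hlog rfl
      fun t₁ t₂ h12 h2 hle => ?_
    have h1 := hnoise ω (fun h => hω (Or.inr h)) t₁ t₂ h12 h2
    refine le_trans ?_ (add_le_add_right h1 _)
    rw [← Finset.sum_add_distrib]
    refine Finset.sum_le_sum fun t ht => ?_
    -- Before `t₂` the dual vectors are bounded by `ζ`, so the truncation in the noise is inactive.
    rw [noiseTerm, if_pos (hle t (Finset.mem_Ico.1 ht).2)]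
    have h3 := sum_mul_costOf_le (G := meanCost 𝒢) (q := q₀) (r := ρ / 2)
      (fun i => (lam_mem_box (S := S) (T := T) (δ := δ) (C := C) (K := K)
        (e := fun s => E s ω) t i).1) hfeas
    simp only [mul_sub, Finset.sum_sub_distrib]
    linarith
  · have hcost : ∀ t < T, ∀ p i, |(E t ω).cost p i| ≤ 1 := fun t ht p i =>
      abs_le.2 (hE.cost_mem t ht ω p i)
    have hρL := rhoAdv_le hm hT hP hπ₀ hcost
    have hρ0 := RhoCondition.pos hcond hL hm hT
    have hlog := RhoCondition.one_le_log hcond hρL hL hm hT hδ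
    -- Here `q₀` is chosen after the run `ω`, which is harmless because the exceptional event `F`
    -- does not involve it.
    obtain ⟨q₀, hq₀, hfeas⟩ := exists_feasible_of_rhoAdv_pos hπ₀ hρ0
    refine sum_abs_lam_le hL hm hT hC hK hP (fun t ht => hE.reward_mem t ht ω)
      (fun t ht => hE.cost_mem t ht ω) (hclean ω hω) hq₀ hρ0 hρL hlog rfl
      fun t₁ t₂ h12 h2 hle => ?_
    refine le_trans (Finset.sum_le_sum fun t ht => ?_) (le_add_of_nonneg_right (by positivity))
    exact sum_mul_costOf_le (fun i => (lam_mem_box (S := S) (T := T) (δ := δ) (C := C) (K := K)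
      (e := fun s => E s ω) t i).1) (hfeas t (by have := (Finset.mem_Ico.1 ht).2; omega))
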